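/- **Setting.** Let $d\ge 2$ and $N\ge 1$, and let $\mathcal P=\bigcup_{i=1}^N\mathcal L_i\subset\mathbb R^d$ be a union of $N$ pairwise incommensurable affine lattices of densities $\overline n_i>0$ with $\overline n_1+\dots+\overline n_N=1$. The densities below depend on $\mathcal P$ only through $\overline n_1,\dots,\overline n_N$. Let $\mathcal B_1^{d-1}$ be the open unit ball of $\mathbb R^{d-1}$, let $\overline\sigma$ be its volume, and let $\zeta$ be the Riemann zeta function. Derivatives with respect to $\xi\in[0,\infty)$ are one-sided at $\xi=0$. *Single lattice.* For $z\in\mathbb R^{d-1}$ and $\xi\ge 0$ let $\mathfrak Z(\xi,z)=\{x\in\mathbb R^d: 0<x_1<\xi,\ \|(x_2,\dots,x_d)-z\|<1\}$. Let $\mu_1$ be the $\operatorname{SL}(d,\mathbb R)$-invariant probability measure on the space $\operatorname{SL}(d,\mathbb Z)\backslash\operatorname{SL}(d,\mathbb R)$ of lattices $\mathbb Z^dM$ of covolume one, and let $\mu$ be the $\operatorname{ASL}(d,\mathbb R)$-invariant probability measure on the space of affine lattices $(\mathbb Z^d+t)M$ of covolume one ($M$ distributed according to $\mu_1$, and $t$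 independent and uniform in $[0,1)^d$). The limiting free path densities for a single lattice are $$\Phi_{0}(\xi,z)=-\frac{d}{d\xi}\,\mu_1\bigl(\{\mathbb Z^dM\cap\mathfrak Z(\xi,z)=\emptyset\}\bigr),\qquad \Phi(\xi)=-\frac{d}{d\xi}\,\mu\bigl(\{(\mathbb Z^d+t)M\cap\mathfrak Z(\xi,0)=\emptyset\}\bigr),$$ for a particle that leaves a scatterer with exit parameter $z$ and for a generic initial point, respectively. *Union of lattices.* Put $$\Phi_0^{(j)}(\xi,z)=-\frac{d}{d\xi}\Bigl(\int_{\overline n_j\xi}^\infty\Phi_0(\xi',z)\,d\xi'\prod_{i\ne j}\int_{\overline n_i\xi}^\infty\Phi(\xi')\,d\xi'\Bigr),$$ $$\overline\Phi_{0,\mathcal P}(\xi)=\frac1{\overline\sigma}\sum_{j=1}^N\overline n_j\int_{\mathcal B_1^{d-1}}\Phi_0^{(j)}(\xi,z)\,dz,\qquad \Phi_{\mathcal P}(\xi)=-\frac{d}{d\xi}\prod_{i=1}^N\int_{\overline n_i\xi}^\infty\Phi(\xi')\,d\xi'.$$ **Theorem.** For every $\xi\ge 0$ the derivatives that define $\Phi_0^{(j)}(\xi,z)$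 (for almost every $z\in\mathcal B_1^{d-1}$) and $\Phi_{\mathcal P}(\xi)$ exist, $\Phi_0^{(j)}(\xi,\cdot)$ is integrable on $\mathcal B_1^{d-1}$, and $$\overline\Phi_{0,\mathcal P}(\xi)=\overline\sigma\Bigl(1-\Bigl(1-\frac1{\zeta(d)}\Bigr)\sum_{j=1}^N\overline n_j^2\Bigr)+O(\xi),$$ $$\Phi_{\mathcal P}(\xi)=\overline\sigma-\overline\sigma^2\Bigl(1-\Bigl(1-\frac1{\zeta(d)}\Bigr)\sum_{j=1}^N\overline n_j^2\Bigr)\xi+O(\xi^2),$$ where the implied constants depend only on $d$, $N$ and $\overline n_1,\dots,\overline n_N$, and not on $\xi\ge 0$. -/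

import Mathlib

open MeasureTheory

namespace LatticeUnion

/-! The ambient dimension is `d = m + 1` throughout; a vector of `ℝ^d` is a function on
`Fin (m + 1)`, its coordinate `0` is the flight direction, and its other `m = d - 1` coordinates
form a vector of the Euclidean space `ℝ^(d-1)`. Vectors are row vectors: matrices act from the
right. -/

/-- The group `SL(d, ℝ)`. -/
abbrev SLR (m : ℕ) : Type := Matrix.SpecialLinearGroup (Fin (m + 1)) ℝ

/-- The subgroup `SL(d, ℤ)` of `SL(d, ℝ)`. -/
abbrev SLZ (m : ℕ) : Subgroup (SLR m) :=
  (Matrix.SpecialLinearGroup.map (n := Fin (m + 1)) (Int.castRingHom ℝ)).range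

/-- `SL(d, ℝ)` carries its Borel `σ`-algebra. -/
instance instMeasurableSpaceSLR (m : ℕ) : MeasurableSpace (SLR m) := borel _

instance instBorelSpaceSLR (m : ℕ) : BorelSpace (SLR m) := ⟨rfl⟩

instance instLocallyCompactSpaceSLR (m : ℕ) : LocallyCompactSpace (SLR m) :=
  have : LocallyCompactSpace (Matrix (Fin (m + 1)) (Fin (m + 1)) ℝ) :=
    inferInstanceAs (LocallyCompactSpace (Fin (m + 1) → Fin (m + 1) → ℝ))
  Matrix.SpecialLinearGroup.isClosedEmbedding_val.locallyCompactSpace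

instance instSecondCountableTopologySLR (m : ℕ) : SecondCountableTopology (SLR m) :=
  have : SecondCountableTopology (Matrix (Fin (m + 1)) (Fin (m + 1)) ℝ) :=
    inferInstanceAs (SecondCountableTopology (Fin (m + 1) → Fin (m + 1) → ℝ))
  Matrix.SpecialLinearGroup.isClosedEmbedding_val.isEmbedding.secondCountableTopology

/-- `SL(d, ℤ)`, acting on `SL(d, ℝ)` by left multiplication, has a Borel fundamental domain. -/
theorem exists_fundamentalDomain (m : ℕ) :
    ∃ F : Set (SLR m), MeasurableSet F ∧
      IsFundamentalDomain (SLZ m) F (Measure.haar : Measure (SLR m)) := by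
  classical
  -- a neighbourhood of the identity which meets the discrete subgroup only in the identity
  obtain ⟨W, hWo, hW⟩ : ∃ W : Set (SLR m), IsOpen W ∧
      ∀ γ : SLZ m, (γ : SLR m) ∈ W ↔ γ = 1 := by
    have h : IsOpen ({1} : Set (SLZ m)) := isOpen_discrete _
    obtain ⟨W, hWo, hW⟩ := isOpen_induced_iff.1 h
    exact ⟨W, hWo, fun γ => by simpa using Set.ext_iff.1 hW γ⟩
  have hW1 : (1 : SLR m) ∈ W := by simpa using (hW 1).2 rfl
  obtain ⟨V, hVo, hV1, hV⟩ : ∃ V : Set (SLR m), IsOpen V ∧ (1 : SLR m) ∈ V ∧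
      ∀ a ∈ V, ∀ b ∈ V, a * b⁻¹ ∈ W := by
    have hc : Continuous fun p : SLR m × SLR m => p.1 * p.2⁻¹ := by fun_prop
    have hn : (fun p : SLR m × SLR m => p.1 * p.2⁻¹) ⁻¹' W ∈ nhds ((1 : SLR m), (1 : SLR m)) :=
      (hWo.preimage hc).mem_nhds (by simpa using hW1)
    rw [nhds_prod_eq, Filter.mem_prod_same_iff] at hn
    obtain ⟨t, ht, hts⟩ := hn
    obtain ⟨V, hVt, hVo, hV1⟩ := mem_nhds_iff.1 ht
    exact ⟨V, hVo, hV1, fun a ha b hb => hts (Set.mk_mem_prod (hVt ha) (hVt hb))⟩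
  -- countably many right translates of this neighbourhood cover the group
  have hUo : ∀ g : SLR m, IsOpen ((fun x : SLR m => x * g⁻¹) ⁻¹' V) := fun g =>
    hVo.preimage (continuous_mul_const _)
  obtain ⟨T, hTc, hT⟩ := TopologicalSpace.isOpen_iUnion_countable
    (fun g : SLR m => (fun x : SLR m => x * g⁻¹) ⁻¹' V) hUo
  have hcov : ∀ x : SLR m, ∃ g ∈ T, x * g⁻¹ ∈ V := fun x => by
    have hx : x ∈ ⋃ g : SLR m, (fun x : SLR m => x * g⁻¹) ⁻¹' V :=
      Set.mem_iUnion.2 ⟨x, by simpa using hV1⟩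
    rw [← hT] at hx
    simpa using hx
  have hTne : T.Nonempty := by
    obtain ⟨g, hg, -⟩ := hcov 1
    exact ⟨g, hg⟩
  obtain ⟨e, he⟩ := hTc.exists_eq_range hTne
  let U : ℕ → Set (SLR m) := fun n => (fun x : SLR m => x * (e n)⁻¹) ⁻¹' V
  have hcovU : ∀ x : SLR m, ∃ n, x ∈ U n := fun x => by
    obtain ⟨g, hg, hx⟩ := hcov x
    rw [he] at hg
    obtain ⟨n, rfl⟩ := hg
    exact ⟨n, hx⟩
  have hinj : ∀ n (γ : SLZ m) (x : SLR m), x ∈ U n → γ • x ∈ U n → γ = 1 := by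
    intro n γ x hx hγx
    have h := hV _ hγx _ hx
    refine (hW γ).1 ?_
    have h' : (γ • x) * (e n)⁻¹ * (x * (e n)⁻¹)⁻¹ = (γ : SLR m) := by
      rw [Subgroup.smul_def, smul_eq_mul]
      group
    rwa [h'] at h
  let F : Set (SLR m) := ⋃ n, (U n ∩ ⋂ k ∈ Finset.range n, ⋂ γ : SLZ m, {x | γ • x ∉ U k})
  have hF : MeasurableSet F := by
    refine MeasurableSet.iUnion fun n => (hUo (e n)).measurableSet.inter ?_
    refine Finset.measurableSet_biInter _ fun k _ => IsClosed.measurableSet ?_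
    refine isClosed_iInter fun γ => IsOpen.isClosed_compl (s := {x | γ • x ∈ U k}) ?_
    exact (hUo (e k)).preimage (continuous_const_smul γ)
  have hmem : ∀ x, x ∈ F ↔ ∃ n, x ∈ U n ∧ ∀ k < n, ∀ γ : SLZ m, γ • x ∉ U k := fun x => by
    simp [F]
  refine ⟨F, hF, IsFundamentalDomain.mk' hF.nullMeasurableSet fun x => ?_⟩
  have hex : ∃ n, ∃ γ : SLZ m, γ • x ∈ U n := by
    obtain ⟨n, hn⟩ := hcovU x
    exact ⟨n, 1, by simpa using hn⟩
  obtain ⟨γ, hγ⟩ := Nat.find_spec hex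
  refine ⟨γ, (hmem _).2 ⟨Nat.find hex, hγ, fun k hk δ hδ => ?_⟩, fun δ hδ => ?_⟩
  · exact Nat.find_min hex hk ⟨δ * γ, by rwa [mul_smul]⟩
  · obtain ⟨n, hn, hmin⟩ := (hmem _).1 hδ
    have hn' : n = Nat.find hex := by
      refine le_antisymm (not_lt.1 fun hlt => ?_) (Nat.find_min' hex ⟨δ, hn⟩)
      refine hmin _ hlt (γ * δ⁻¹) ?_
      rwa [mul_smul, inv_smul_smul]
    subst hn'
    have h1 : δ * γ⁻¹ = 1 := by
      refine hinj _ (δ * γ⁻¹) (γ • x) hγ ?_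
      rwa [mul_smul, inv_smul_smul]
    exact mul_inv_eq_one.1 h1

/-- A Borel fundamental domain of `SL(d, ℤ)` in `SL(d, ℝ)`. -/
noncomputable def fundamentalDomain (m : ℕ) : Set (SLR m) :=
  Classical.choose (exists_fundamentalDomain m)

/-- The invariant probability measure on the space `SL(d, ℤ) \ SL(d, ℝ)` of lattices of covolume
one, as a measure on representatives: Haar measure conditioned on a fundamental domain. The
probability of an `SL(d, ℤ)`-invariant event does not depend on the fundamental domain. -/
noncomputable def latticeMeasure (m : ℕ) : Measure (SLR m) :=
  ProbabilityTheory.cond (Measure.haar : Measure (SLR m)) (fundamentalDomain m)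

/-- The invariant probability measure on the space `ASL(d, ℤ) \ ASL(d, ℝ)` of affine lattices of
covolume one, as a measure on representatives: the pair `(M, t)` stands for the affine lattice
`(ℤ^d + t) M`, with `ℤ^d M` a random lattice and `t` independent and uniform in `[0, 1)^d`. -/
noncomputable def affineLatticeMeasure (m : ℕ) : Measure (SLR m × (Fin (m + 1) → ℝ)) :=
  (latticeMeasure m).prod (volume.restrict (Set.univ.pi fun _ => Set.Ico (0 : ℝ) 1))

/-- The affine lattice `(ℤ^d + t) M`. -/
def affineLattice (m : ℕ) (M : SLR m) (t : Fin (m + 1) → ℝ) : Set (Fin (m + 1) → ℝ) :=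
  Set.range fun k : Fin (m + 1) → ℤ => Matrix.vecMul ((fun i => (k i : ℝ)) + t) M.1

/-- The open cylinder of length `ξ` and radius `1` whose axis starts at `(0, z)` and has the
direction of the first coordinate. -/
def cylinder (m : ℕ) (ξ : ℝ) (z : EuclideanSpace ℝ (Fin m)) : Set (Fin (m + 1) → ℝ) :=
  {x | 0 < x 0 ∧ x 0 < ξ ∧ ‖WithLp.toLp 2 (Fin.tail x) - z‖ < 1}

/-- The probability that a random lattice of covolume one has no point in the cylinder of length
`ξ` that starts at `(0, z)`. -/
noncomputable def voidProb₀ (m : ℕ) (z : EuclideanSpace ℝ (Fin m)) (ξ : ℝ) : ℝ :=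
  (latticeMeasure m).real {M | Disjoint (affineLattice m M 0) (cylinder m ξ z)}

/-- The probability that a random affine lattice of covolume one has no point in the cylinder of
length `ξ` that starts at the origin. -/
noncomputable def voidProb (m : ℕ) (ξ : ℝ) : ℝ :=
  (affineLatticeMeasure m).real {p | Disjoint (affineLattice m p.1 p.2) (cylinder m ξ 0)}

/-- The derivative on `[0, ∞)`: the usual one for `ξ > 0`, and the right derivative at `ξ = 0`. -/
noncomputable def ddξ (f : ℝ → ℝ) (ξ : ℝ) : ℝ := derivWithin f (Set.Ici 0) ξ

/-- `Φ_0(ξ, z)`: the density of the free path length for a single lattice of covolume one and a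
particle that leaves a scatterer with exit parameter `z`. -/
noncomputable def Φ₀ (m : ℕ) (ξ : ℝ) (z : EuclideanSpace ℝ (Fin m)) : ℝ :=
  - ddξ (voidProb₀ m z) ξ

/-- `Φ(ξ)`: the density of the free path length for a single lattice of covolume one and a generic
initial point. -/
noncomputable def Φ (m : ℕ) (ξ : ℝ) : ℝ := - ddξ (voidProb m) ξ

/-- `∫_{n_j ξ}^∞ Φ_0(ξ', z) dξ' ∏_{i ≠ j} ∫_{n_i ξ}^∞ Φ(ξ') dξ'`. -/
noncomputable def survival₀ (m : ℕ) {N : ℕ} (n : Fin N → ℝ) (j : Fin N)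
    (z : EuclideanSpace ℝ (Fin m)) (ξ : ℝ) : ℝ :=
  (∫ ξ' in Set.Ioi (n j * ξ), Φ₀ m ξ' z) *
    ∏ i ∈ Finset.univ.erase j, ∫ ξ' in Set.Ioi (n i * ξ), Φ m ξ'

/-- `∏_i ∫_{n_i ξ}^∞ Φ(ξ') dξ'`. -/
noncomputable def survival (m : ℕ) {N : ℕ} (n : Fin N → ℝ) (ξ : ℝ) : ℝ :=
  ∏ i, ∫ ξ' in Set.Ioi (n i * ξ), Φ m ξ'

/-- `Φ_0^{(j)}(ξ, z)`: the free path density for the union of `N` lattices of densities `n i` and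
a particle that leaves a scatterer of the `j`-th lattice with exit parameter `z`. -/
noncomputable def Φ₀Union (m : ℕ) {N : ℕ} (n : Fin N → ℝ) (j : Fin N) (ξ : ℝ)
    (z : EuclideanSpace ℝ (Fin m)) : ℝ :=
  - ddξ (survival₀ m n j z) ξ

/-- The volume of the unit ball of dimension `d - 1`. -/
noncomputable def sigmaBar (m : ℕ) : ℝ :=
  volume.real (Metric.ball (0 : EuclideanSpace ℝ (Fin m)) 1)

/-- The density of the free path length between consecutive collisions for the union of `N`
lattices of densities `n i`. -/
noncomputable def ΦBar₀ (m : ℕ) {N : ℕ} (n : Fin N → ℝ) (ξ : ℝ) : ℝ :=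
  1 / sigmaBar m *
    ∑ j, n j * ∫ z in Metric.ball (0 : EuclideanSpace ℝ (Fin m)) 1, Φ₀Union m n j ξ z

/-- The density of the free path length from a generic initial point for the union of `N` lattices
of densities `n i`. -/
noncomputable def ΦUnion (m : ℕ) {N : ℕ} (n : Fin N → ℝ) (ξ : ℝ) : ℝ :=
  - ddξ (survival m n) ξ

end LatticeUnion

/-! Write κ = 1/ζ(d) and σ for the volume of the unit ball of ℝ^(d-1). The theorem rests on two
exact formulas for a single lattice of covolume one.

Lattice: if ‖z‖ < 1, the cylinder over z is star-shaped about the origin, so its lowest lattice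
point is primitive. Unfolding the sum over primitive vectors gives `latticeMeasure_isVoid_compl`:
the void probability is 1 - κ ∫_0^ξ ψ(z,s) ds, where ψ(z,s) measures the w in the ball around z for
which a random lattice containing (s,w) as a primitive vector has no point below it in the cylinder.
Such a lattice is given by a random (d-1)-dimensional lattice A and a uniform shear b. A further
point in the cylinder forces A to have a nonzero vector shorter than 2 s^(1/(d-1)), which has
probability O(s). Hence ψ = σ + O(s) uniformly in z (`volume_ball_le_freeDensity`). Continuity of ψ
in s (`tendsto_freeDensity`) makes the derivatives exist.

Affine lattice: averaging over the translation and looking for the lowest point gives Φ(ξ) = ∫ (void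
probability over z) dz over the unit ball (`affineLatticeMeasure_cylinder_compl`). Therefore Φ(ξ) =
σ - κσ²ξ + O(ξ²).

Union: void probabilities tend to 0 as ξ grows, so they are the tail integrals in the definitions,
and everything reduces to the product rule. At ξ = 0 the particle's own lattice contributes κσ n_j
and the others σ(1 - n_j). Averaging over j with weights n_j produces 1 - (1 - κ) ∑ n_j². The slope
of Φ for the union arises in the same way, own lattice against others.

The underlying measure theory is Siegel's mean value formula. Haar measure on SL(d,ℝ) is a multiple
of dy dA db, with y the first row, A in SL(d-1,ℝ) and b a shear
(`exists_haar_eq_smul_coordMeasure`); `lintegral_fundamentalDomain_tsum_primVec` is the unfolding.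
Finite covolume follows by induction on d with Minkowski's theorem, and counting lattice points in
large balls shows that the constant is 1/ζ(d) (`meanConst_mul_zetaSum`). -/

namespace LatticeUnion

open scoped ENNReal NNReal Topology Pointwise

/-! ### Unimodularity of SL(d, ℝ) -/

section Unimodular

open Matrix Matrix.SpecialLinearGroup

variable {ι : Type*} [Fintype ι] [DecidableEq ι]

/-- A homomorphism from `SL(ι, ℝ)` to the positive reals is trivial on transvections. -/
theorem map_transvection_eq_one (φ : SpecialLinearGroup ι ℝ →* ℝ≥0) (hφ : ∀ g, φ g ≠ 0)
    {i j : ι} (hij : i ≠ j) (a : ℝ) : φ (SpecialLinearGroup.transvection hij a) = 1 := by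
  have h2 : (2 : ℝ) ≠ 0 := two_ne_zero
  -- Conjugation by diag(2, 1/2) multiplies the parameter of a transvection by 4. The value x of φ
  -- thus satisfies x = x⁴, and a positive x must be 1.
  have hconj : diag2n hij 2 h2 * SpecialLinearGroup.transvection hij a =
      SpecialLinearGroup.transvection hij (2 * (2 * a)) * diag2n hij 2 h2 := by
    ext k l
    simp only [coe_mul, diag2n_coe, transvection_coe, Matrix.add_apply, diagonal_mul,
      mul_diagonal, single_apply, Matrix.one_apply]
    by_cases hk : k = i <;> by_cases hl : l = j <;> by_cases hkl : k = l <;>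
      (simp_all [eq_comm]; try grind)
  have hadd : SpecialLinearGroup.transvection hij (2 * (2 * a)) =
      SpecialLinearGroup.transvection hij a ^ 4 := by
    rw [show 2 * (2 * a) = a + a + a + a by ring]
    simp only [transvection_add, pow_succ, pow_zero, one_mul]
  have h := congrArg φ hconj
  rw [map_mul, map_mul, hadd, map_pow, mul_comm] at h
  have h' := mul_right_cancel₀ (hφ _) h
  set x := φ (SpecialLinearGroup.transvection hij a)
  have hx : x ≠ 0 := hφ _
  have h3 : x ^ 3 = 1 := by
    have : x * x ^ 3 = x * 1 := by rw [mul_one, ← pow_succ']; exact h'.symm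
    exact mul_left_cancel₀ hx this
  exact (pow_eq_one_iff_of_nonneg zero_le three_ne_zero).1 h3

/-- With w(c) = x(c) y(-1/c) x(c) for the upper and lower transvections x and y, the right side is
w(c) w(-1), where w(c) is the antidiagonal matrix with entries c and -1/c. -/
theorem diag2n_eq_prod_transvection {i j : ι} (hij : i ≠ j) {c : ℝ} (hc : c ≠ 0) :
    diag2n hij c hc = SpecialLinearGroup.transvection hij c *
      (SpecialLinearGroup.transvection hij.symm (- c⁻¹) *
      (SpecialLinearGroup.transvection hij c *
      (SpecialLinearGroup.transvection hij (-1) *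
      (SpecialLinearGroup.transvection hij.symm 1 *
      SpecialLinearGroup.transvection hij (-1))))) := by
  ext k l
  simp only [coe_mul, diag2n_coe]
  simp only [SpecialLinearGroup.transvection]
  have hone : ∀ a b : ι, Matrix.transvection i j (-1 : ℝ) a b =
      (1 : Matrix ι ι ℝ) a b + if a = i then - (1 : Matrix ι ι ℝ) j b else 0 := by
    intro a b
    by_cases ha : a = i
    · subst ha
      have := transvection_mul_apply_same a j b (-1 : ℝ) (1 : Matrix ι ι ℝ)
      rw [Matrix.mul_one] at this
      rw [this]; simp
    · have := transvection_mul_apply_of_ne i j a b ha (-1 : ℝ) (1 : Matrix ι ι ℝ)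
      rw [Matrix.mul_one] at this
      rw [this]; simp [ha]
  by_cases hki : k = i
  · subst hki
    simp [hij, hij.symm, hone, diagonal_apply, Matrix.one_apply]
    by_cases h1 : k = l <;> by_cases h2 : j = l <;> simp [h1, h2] <;> field_simp <;> ring_nf
    all_goals simp_all
  · by_cases hkj : k = j
    · subst hkj
      simp [hij, hij.symm, hone, diagonal_apply, Matrix.one_apply]
      by_cases h1 : k = l <;> by_cases h2 : i = l <;> simp [h1, h2] <;> field_simp <;> ring_nf
    · simp [hki, hkj, hone, diagonal_apply, Matrix.one_apply]

/-- Transvections and the matrices `diag2n`, themselves products of transvections, generate the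
group. This is applied to the modular character. -/
theorem monoidHom_eq_one (φ : SpecialLinearGroup ι ℝ →* ℝ≥0) (hφ : ∀ g, φ g ≠ 0)
    (g : SpecialLinearGroup ι ℝ) : φ g = 1 := by
  rcases subsingleton_or_nontrivial ι with hι | hι
  · rw [Subsingleton.elim g 1, map_one]
  · refine diagonal_transvection_induction' (fun g => φ g = 1) g (fun i j hij c hc => ?_)
      (fun i j hij a => map_transvection_eq_one φ hφ hij a) fun A B hA hB => ?_
    · rw [diag2n_eq_prod_transvection hij hc]
      simp only [map_mul, map_transvection_eq_one φ hφ, mul_one]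
    · rw [map_mul, hA, hB, mul_one]

end Unimodular

instance instIsMulRightInvariantHaarSLR (m : ℕ) :
    (Measure.haar : Measure (SLR m)).IsMulRightInvariant := ⟨fun g => by
  rw [Measure.map_right_mul_eq_modularCharacterFun_smul]
  have h : Measure.modularCharacter g = 1 :=
    monoidHom_eq_one Measure.modularCharacter (fun g => (Measure.modularCharacterFun_pos g).ne') g
  change Measure.modularCharacterFun g = 1 at h
  rw [h, one_smul]⟩

/-- By right invariance the inverted measure is left invariant, hence c times Haar measure.
Inverting twice gives c² = 1. -/
instance instIsInvInvariantHaarSLR (m : ℕ) :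
    (Measure.haar : Measure (SLR m)).IsInvInvariant := ⟨by
  set μ := (Measure.haar : Measure (SLR m)) with hμ
  obtain ⟨c, hcd⟩ : ∃ c : ℝ≥0∞, c = Measure.haarScalarFactor μ.inv μ := ⟨_, rfl⟩
  have hc : μ.inv = c • μ := by
    rw [hcd]
    exact Measure.isMulLeftInvariant_eq_smul_of_regular μ.inv μ
  have hμeq : μ = c ^ 2 • μ := by
    conv_lhs => rw [← Measure.inv_inv μ, hc, Measure.inv_def, Measure.map_smul,
      ← Measure.inv_def, hc, smul_smul, ← pow_two]
  obtain ⟨K⟩ : Nonempty (TopologicalSpace.PositiveCompacts (SLR m)) := inferInstance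
  have hK : c ^ 2 * μ K = 1 ^ 2 * μ K := by
    conv_rhs => rw [hμeq]
    simp
  have h2 : c ^ 2 = 1 ^ 2 :=
    (ENNReal.mul_left_inj (Measure.measure_pos_of_nonempty_interior _ K.interior_nonempty).ne'
      K.isCompact.measure_lt_top.ne).1 hK
  have h1 : c = 1 := (ENNReal.pow_right_strictMono two_ne_zero).injective h2
  rw [hc, h1, one_smul]⟩

end LatticeUnion

namespace LatticeUnion

open scoped ENNReal NNReal Topology Pointwise
open Matrix (vecMul)

/-! ### Coordinates on `SL(d, ℝ)` -/

section Coordinates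

variable {m : ℕ}

/-- The element of `SL(d, ℝ)` given by a matrix of determinant one. -/
def mkSLR (A : Matrix (Fin (m + 1)) (Fin (m + 1)) ℝ) (hA : A.det = 1) : SLR m := ⟨A, hA⟩

@[simp] theorem mkSLR_val (A : Matrix (Fin (m + 1)) (Fin (m + 1)) ℝ) (hA : A.det = 1) :
    (mkSLR A hA).1 = A := rfl

/-- Needed for the Lusin-Souslin theorem: measurable injective images of Borel sets under the
coordinates are Borel. -/
instance instPolishSpaceSLR (m : ℕ) : PolishSpace (SLR m) :=
  have : PolishSpace (Matrix (Fin (m + 1)) (Fin (m + 1)) ℝ) :=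
    inferInstanceAs (PolishSpace (Fin (m + 1) → Fin (m + 1) → ℝ))
  Matrix.SpecialLinearGroup.isClosedEmbedding_val.polishSpace

theorem measurable_entry (i j : Fin (m + 1)) : Measurable fun M : SLR m => M.1 i j := by
  have : Continuous fun M : SLR m => M.1 i j :=
    (continuous_apply_apply i j).comp continuous_subtype_val
  exact this.measurable

theorem measurable_SLR_iff {X : Type*} [MeasurableSpace X] {f : X → SLR m} :
    Measurable f ↔ ∀ i j, Measurable fun x => (f x).1 i j := by
  refine ⟨fun h i j => (measurable_entry i j).comp h, fun h => ?_⟩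
  let _ : MeasurableSpace (Matrix (Fin (m + 1)) (Fin (m + 1)) ℝ) :=
    inferInstanceAs (MeasurableSpace (Fin (m + 1) → Fin (m + 1) → ℝ))
  have : BorelSpace (Matrix (Fin (m + 1)) (Fin (m + 1)) ℝ) :=
    inferInstanceAs (BorelSpace (Fin (m + 1) → Fin (m + 1) → ℝ))
  have he : MeasurableEmbedding (fun M : SLR m => M.1) :=
    Topology.IsClosedEmbedding.measurableEmbedding (α := SLR m)
      Matrix.SpecialLinearGroup.isClosedEmbedding_val
  have hf : Measurable ((fun M : SLR m => M.1) ∘ f) :=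
    measurable_pi_lambda _ fun i => measurable_pi_lambda _ fun j => h i j
  exact (@MeasurableEmbedding.measurable_comp_iff X (SLR m) _ _ _ _ _ _ he).1 hf

theorem continuous_SLR_iff {X : Type*} [TopologicalSpace X] {f : X → SLR m} :
    Continuous f ↔ ∀ i j, Continuous fun x => (f x).1 i j := by
  refine (Topology.IsInducing.continuous_iff (Y := SLR m)
    Matrix.SpecialLinearGroup.isClosedEmbedding_val.isInducing).trans ?_
  exact ⟨fun h i j => (continuous_apply_apply i j).comp h, fun h => continuous_matrix h⟩

theorem continuousAt_SLR_iff {X : Type*} [TopologicalSpace X] {f : X → SLR m} {x : X} :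
    ContinuousAt f x ↔ ∀ i j, ContinuousAt (fun x => (f x).1 i j) x := by
  refine (Topology.IsInducing.continuousAt_iff (Y := SLR m)
    Matrix.SpecialLinearGroup.isClosedEmbedding_val.isInducing).trans ?_
  exact ⟨fun h i j => (continuous_apply_apply i j).continuousAt.comp h,
    fun h => continuousAt_pi.2 fun i => continuousAt_pi.2 fun j => h i j⟩

/-- The matrix with rows `(1, 0)` and `(b i, A i)`. -/
noncomputable def stabMat (b : Fin (m + 1) → ℝ) (A : SLR m) : SLR (m + 1) :=
  mkSLR (Matrix.of (Fin.cons (Fin.cons 1 0) fun i => Fin.cons (b i) (A.1 i))) <| by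
    rw [Matrix.det_succ_row_zero, Fin.sum_univ_succ]
    simp only [Matrix.of_apply, Fin.cons_zero, Fin.cons_succ, Pi.zero_apply]
    have : ((Matrix.of (Fin.cons (Fin.cons 1 0) fun i => Fin.cons (b i) (A.1 i)) :
        Matrix (Fin (m + 2)) (Fin (m + 2)) ℝ).submatrix Fin.succ (Fin.succAbove 0)) = A.1 := by
      ext i j
      simp
    rw [this]
    simp [A.2]

@[simp] theorem stabMat_zero_zero (b : Fin (m + 1) → ℝ) (A : SLR m) :
    (stabMat b A).1 0 0 = 1 := rfl

@[simp] theorem stabMat_zero_succ (b : Fin (m + 1) → ℝ) (A : SLR m) (j : Fin (m + 1)) :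
    (stabMat b A).1 0 j.succ = 0 := rfl

@[simp] theorem stabMat_succ_zero (b : Fin (m + 1) → ℝ) (A : SLR m) (i : Fin (m + 1)) :
    (stabMat b A).1 i.succ 0 = b i := rfl

@[simp] theorem stabMat_succ_succ (b : Fin (m + 1) → ℝ) (A : SLR m) (i j : Fin (m + 1)) :
    (stabMat b A).1 i.succ j.succ = A.1 i j := rfl

theorem stabMat_mul (b β : Fin (m + 1) → ℝ) (A B : SLR m) :
    stabMat b A * stabMat β B = stabMat (b + A.1.mulVec β) (A * B) := by
  ext i j
  rw [Matrix.SpecialLinearGroup.coe_mul, Matrix.mul_apply, Fin.sum_univ_succ]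
  refine Fin.cases ?_ (fun i => ?_) i <;> refine Fin.cases ?_ (fun j => ?_) j <;>
    simp [Matrix.mulVec, dotProduct, Matrix.mul_apply]

theorem stabMat_injective {b β : Fin (m + 1) → ℝ} {A B : SLR m}
    (h : stabMat b A = stabMat β B) : b = β ∧ A = B := by
  constructor
  · ext i
    rw [← stabMat_succ_zero b A, h, stabMat_succ_zero]
  · ext i j
    rw [← stabMat_succ_succ b A, h, stabMat_succ_succ]

/-- Expanding the determinant along the first row shows that the lower right block has determinant
one. These matrices form the stabilizer of the first unit row vector. -/
theorem exists_eq_stabMat {h : SLR (m + 1)} (h0 : h.1 0 = Fin.cons 1 0) :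
    ∃ b A, h = stabMat b A := by
  have hdet : (Matrix.of fun i j : Fin (m + 1) => h.1 i.succ j.succ).det = 1 := by
    have h1 := h.2
    rw [Matrix.det_succ_row_zero, Fin.sum_univ_succ] at h1
    simp only [h0, Fin.cons_zero, Fin.cons_succ, Pi.zero_apply] at h1
    have : (h.1.submatrix Fin.succ (Fin.succAbove 0)) =
        (Matrix.of fun i j : Fin (m + 1) => h.1 i.succ j.succ) := by
      ext i j
      simp
    rw [this] at h1
    simpa using h1
  refine ⟨fun i => h.1 i.succ 0, mkSLR _ hdet, ?_⟩
  ext i j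
  refine Fin.cases ?_ (fun i => ?_) i
  · rw [h0]
    refine Fin.cases ?_ (fun j => ?_) j
    · rw [stabMat_zero_zero, Fin.cons_zero]
    · rw [stabMat_zero_succ, Fin.cons_succ, Pi.zero_apply]
  · refine Fin.cases ?_ (fun j => ?_) j
    · rw [stabMat_succ_zero]
    · rw [stabMat_succ_succ, mkSLR_val, Matrix.of_apply]

theorem row_zero_stabMat_mul (b : Fin (m + 1) → ℝ) (A : SLR m) (M : SLR (m + 1)) :
    (stabMat b A * M).1 0 = M.1 0 := by
  ext j
  rw [Matrix.SpecialLinearGroup.coe_mul, Matrix.mul_apply, Fin.sum_univ_succ]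
  simp

/-- The diagonal entries of `sec`. -/
noncomputable def secDiag (m : ℕ) (s : ℝ) : Fin (m + 1) → ℝ :=
  -- The product of these entries is 1/s. The sign is put into one entry so that negative s is
  -- covered as well.
  Fin.cons ((SignType.sign s : ℝ) * |s| ^ (-(1 / (m + 1 : ℝ)))) fun _ => |s| ^ (-(1 / (m + 1 : ℝ)))

theorem prod_secDiag {s : ℝ} (hs : s ≠ 0) : s * ∏ i, secDiag m s i = 1 := by
  have h : (|s| ^ (-(1 / (m + 1 : ℝ)))) ^ (m + 1) = |s|⁻¹ := by
    rw [← Real.rpow_natCast, ← Real.rpow_mul (abs_nonneg s), ← Real.rpow_neg_one]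
    congr 1
    push_cast
    field_simp
  rw [Fin.prod_univ_succ]
  simp only [secDiag, Fin.cons_zero, Fin.cons_succ, Finset.prod_const, Finset.card_univ,
    Fintype.card_fin]
  rw [mul_assoc, ← pow_succ', h, ← mul_assoc, self_mul_sign, mul_inv_cancel₀ (abs_ne_zero.2 hs)]

/-- A matrix with first row `y`. -/
noncomputable def sec (y : Fin (m + 2) → ℝ) : SLR (m + 1) :=
  if hy : y 0 = 0 then 1 else
    mkSLR (Matrix.of (Fin.cons y fun i => Fin.cons 0 fun j =>
        if i = j then secDiag m (y 0) i else 0)) <| by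
      rw [Matrix.det_of_isUpperTriangular]
      · rw [Fin.prod_univ_succ]
        simpa using prod_secDiag hy
      · intro i j hij
        refine Fin.cases (fun hij => ?_) (fun i hij => ?_) i hij
        · simp at hij
        · refine Fin.cases (fun _ => ?_) (fun j hij => ?_) j hij
          · simp
          · have : i ≠ j := fun h => by simp [h] at hij
            simp [this]

theorem row_zero_sec {y : Fin (m + 2) → ℝ} (hy : y 0 ≠ 0) : (sec y).1 0 = y := by
  rw [sec, dif_neg hy]
  rfl

theorem sec_succ {y : Fin (m + 2) → ℝ} (hy : y 0 ≠ 0) (i : Fin (m + 1)) :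
    (sec y).1 i.succ = Fin.cons 0 fun j => if i = j then secDiag m (y 0) i else 0 := by
  rw [sec, dif_neg hy]
  rfl

theorem measurable_secDiag (i : Fin (m + 1)) : Measurable fun s => secDiag m s i := by
  have hsign : Measurable fun s : ℝ => (SignType.sign s : ℝ) := by
    have : (fun s : ℝ => (SignType.sign s : ℝ)) =
        fun s => if 0 < s then 1 else if s < 0 then -1 else 0 := by
      ext s
      rw [sign_apply]
      split_ifs <;> simp
    rw [this]
    exact Measurable.ite measurableSet_Ioi measurable_const
      (Measurable.ite measurableSet_Iio measurable_const measurable_const)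
  refine Fin.cases ?_ (fun i => ?_) i
  · simp only [secDiag, Fin.cons_zero]
    fun_prop
  · simp only [secDiag, Fin.cons_succ]
    fun_prop

theorem measurable_sec : Measurable (sec : (Fin (m + 2) → ℝ) → SLR (m + 1)) := by
  classical
  have hS : MeasurableSet {y : Fin (m + 2) → ℝ | y 0 = 0} :=
    (measurableSet_singleton 0).preimage (measurable_pi_apply 0)
  refine measurable_SLR_iff.2 fun i j => ?_
  have : (fun y : Fin (m + 2) → ℝ => (sec y).1 i j) = fun y => if y 0 = 0 then
      (1 : SLR (m + 1)).1 i j else (Fin.cons y fun i => Fin.cons 0 fun j =>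
        if i = j then secDiag m (y 0) i else 0 : Fin (m + 2) → Fin (m + 2) → ℝ) i j := by
    ext y
    by_cases hy : y 0 = 0 <;> simp [sec, hy]
  rw [this]
  refine Measurable.ite hS measurable_const ?_
  refine Fin.cases ?_ (fun i => ?_) i
  · simpa using measurable_pi_apply j
  · refine Fin.cases ?_ (fun j => ?_) j
    · simp
    · by_cases hij : i = j
      · simpa [hij, Function.comp_def] using (measurable_secDiag j).comp (measurable_pi_apply 0)
      · simp [hij]

theorem continuous_stabMat :
    Continuous fun p : (Fin (m + 1) → ℝ) × SLR m => stabMat p.1 p.2 := by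
  refine continuous_SLR_iff.2 fun i j => ?_
  refine Fin.cases ?_ (fun i => ?_) i <;> refine Fin.cases ?_ (fun j => ?_) j
  · simp only [stabMat_zero_zero]; fun_prop
  · simp only [stabMat_zero_succ]; fun_prop
  · simp only [stabMat_succ_zero]; fun_prop
  · simp only [stabMat_succ_succ]
    exact continuous_SLR_iff.1 continuous_snd i j

/-- The coordinates `(y, A, b) ↦ (1, 0; b, A) * sec y` on `SL(d, ℝ)`. -/
noncomputable def coord (p : (Fin (m + 2) → ℝ) × SLR m × (Fin (m + 1) → ℝ)) : SLR (m + 1) :=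
  stabMat p.2.2 p.2.1 * sec p.1

theorem measurable_coord :
    Measurable (coord : (Fin (m + 2) → ℝ) × SLR m × (Fin (m + 1) → ℝ) → SLR (m + 1)) := by
  have h1 : Measurable fun p : (Fin (m + 2) → ℝ) × SLR m × (Fin (m + 1) → ℝ) =>
      stabMat p.2.2 p.2.1 :=
    continuous_stabMat.measurable.comp (by fun_prop :
      Measurable fun p : (Fin (m + 2) → ℝ) × SLR m × (Fin (m + 1) → ℝ) => (p.2.2, p.2.1))
  exact h1.mul (measurable_sec.comp measurable_fst)

theorem row_zero_coord {p : (Fin (m + 2) → ℝ) × SLR m × (Fin (m + 1) → ℝ)} (hp : p.1 0 ≠ 0) :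
    (coord p).1 0 = p.1 := by
  rw [coord, row_zero_stabMat_mul, row_zero_sec hp]

/-- The stabilizer acts on the fibre coordinates (A, b) alone. A fundamental domain for its integer
points is therefore a product over the fibre. -/
theorem stabMat_mul_coord (β : Fin (m + 1) → ℝ) (B : SLR m)
    (p : (Fin (m + 2) → ℝ) × SLR m × (Fin (m + 1) → ℝ)) :
    stabMat β B * coord p = coord (p.1, B * p.2.1, β + B.1.mulVec p.2.2) := by
  rw [coord, coord, ← mul_assoc, stabMat_mul]

theorem coord_injOn :
    Set.InjOn (coord : (Fin (m + 2) → ℝ) × SLR m × (Fin (m + 1) → ℝ) → SLR (m + 1))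
      {p | p.1 0 ≠ 0} := by
  rintro ⟨y, A, b⟩ hy ⟨y', A', b'⟩ hy' h
  have h0 : y = y' := by
    have := congrArg (fun M : SLR (m + 1) => M.1 0) h
    simpa only [row_zero_coord hy, row_zero_coord hy'] using this
  subst h0
  obtain ⟨h1, h2⟩ := stabMat_injective (mul_right_cancel h)
  simp_all

end Coordinates

end LatticeUnion

namespace LatticeUnion

open scoped ENNReal NNReal Topology Pointwise
open Matrix (vecMul)

/-! ### Haar measure in coordinates -/

section HaarCoordinates

variable {m : ℕ}

theorem coe_mul_SLR (g h : SLR m) : (g * h).1 = g.1 * h.1 := rfl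

theorem row_mul (g h : SLR m) (i : Fin (m + 1)) : (g * h).1 i = vecMul (g.1 i) h.1 := rfl

theorem vecMul_mul (x : Fin (m + 1) → ℝ) (g h : SLR m) :
    vecMul x (g * h).1 = vecMul (vecMul x g.1) h.1 := by
  rw [coe_mul_SLR, Matrix.vecMul_vecMul]

theorem vecMul_one_SLR (x : Fin (m + 1) → ℝ) : vecMul x (1 : SLR m).1 = x :=
  Matrix.vecMul_one x

theorem vecMul_mul_inv (x : Fin (m + 1) → ℝ) (g : SLR m) : vecMul (vecMul x g.1) g⁻¹.1 = x := by
  rw [← vecMul_mul, mul_inv_cancel, vecMul_one_SLR]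

theorem measurePreserving_vecMul (g : SLR m) :
    MeasurePreserving (fun x : Fin (m + 1) → ℝ => vecMul x g.1) volume volume := by
  refine ⟨by fun_prop, ?_⟩
  have h := Real.map_matrix_volume_pi_eq_smul_volume_pi (M := g.1.transpose)
    (by rw [Matrix.det_transpose, g.2]; exact one_ne_zero)
  rw [Matrix.det_transpose, g.2] at h
  simp only [inv_one, abs_one, ENNReal.ofReal_one, one_smul] at h
  have hfun : (fun x => vecMul x g.1) = ⇑(Matrix.toLin' g.1.transpose) := by
    ext x : 1
    rw [Matrix.toLin'_apply, Matrix.mulVec_transpose]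
  rw [hfun, h]

theorem ae_vecMul_zero_ne (g : SLR (m + 1)) :
    ∀ᵐ y : Fin (m + 2) → ℝ, vecMul y g.1 0 ≠ 0 := by
  have h0 : ∀ᵐ y : Fin (m + 2) → ℝ, y 0 ≠ 0 :=
    Measure.ae_eval_ne (fun _ => volume) 0 0
  exact (measurePreserving_vecMul g).quasiMeasurePreserving.ae h0

/-- The pushforward of `dy dA db` under the coordinates `coord`. -/
noncomputable def coordMeasure (m : ℕ) : Measure (SLR (m + 1)) :=
  Measure.map coord (volume.prod ((Measure.haar : Measure (SLR m)).prod volume))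

theorem lintegral_coordMeasure {f : SLR (m + 1) → ℝ≥0∞} (hf : Measurable f) :
    ∫⁻ M, f M ∂(coordMeasure m) =
      ∫⁻ y, ∫⁻ A, (∫⁻ b, f (coord (y, A, b))) ∂(Measure.haar : Measure (SLR m)) := by
  have hfc : Measurable fun p => f (coord (m := m) p) := hf.comp measurable_coord
  rw [coordMeasure, lintegral_map hf measurable_coord, lintegral_prod _ hfc.aemeasurable]
  refine lintegral_congr fun y => ?_
  rw [lintegral_prod]
  exact (hfc.comp measurable_prodMk_left).aemeasurable

/-- The matrix sec(y) g sec(yg)⁻¹ fixes the first unit vector, so it lies in the stabilizer. Right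
multiplication by g thus moves y to yg and acts on each fibre by right multiplication of A and
translation of b. -/
theorem exists_sec_mul {y : Fin (m + 2) → ℝ} (hy : y 0 ≠ 0) {g : SLR (m + 1)}
    (hyg : vecMul y g.1 0 ≠ 0) :
    ∃ β B, ∀ A b, coord (y, A, b) * g = coord (vecMul y g.1, A * B, b + A.1.mulVec β) := by
  have h : (sec y * g * (sec (vecMul y g.1))⁻¹).1 0 = Fin.cons 1 0 := by
    rw [row_mul, row_mul, row_zero_sec hy]
    nth_rw 1 [← row_zero_sec hyg]
    rw [← row_mul, mul_inv_cancel]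
    ext j
    refine Fin.cases ?_ (fun j => ?_) j <;> simp [(Fin.succ_ne_zero _).symm]
  obtain ⟨β, B, h⟩ := exists_eq_stabMat h
  refine ⟨β, B, fun A b => ?_⟩
  rw [coord, coord]
  simp only
  rw [← stabMat_mul, ← h]
  group

/-- Fibre by fibre: db is translation invariant, Haar measure in rank d-1 is right invariant, and y
↦ yg preserves dy since g has determinant one. The hyperplanes where `exists_sec_mul` fails are
null. -/
instance instIsMulRightInvariantCoordMeasure : (coordMeasure m).IsMulRightInvariant := ⟨fun g => by
  refine Measure.ext_of_lintegral _ fun f hf => ?_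
  have hmul : Measurable fun M : SLR (m + 1) => M * g := measurable_mul_const g
  have hfg : Measurable fun M => f (M * g) := hf.comp hmul
  rw [lintegral_map hf hmul, lintegral_coordMeasure hfg, lintegral_coordMeasure hf]
  set G : (Fin (m + 2) → ℝ) → ℝ≥0∞ := fun y =>
    ∫⁻ A, (∫⁻ b, f (coord (y, A, b))) ∂(Measure.haar : Measure (SLR m)) with hG
  have h3 : Measurable fun p : ((Fin (m + 2) → ℝ) × SLR m) × (Fin (m + 1) → ℝ) =>
      f (coord (p.1.1, p.1.2, p.2)) :=
    (hf.comp measurable_coord).comp (by fun_prop)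
  have hGm : Measurable G := (h3.lintegral_prod_right').lintegral_prod_right'
  have h1 : ∀ᵐ y : Fin (m + 2) → ℝ, (∫⁻ A, (∫⁻ b, f (coord (y, A, b) * g))
      ∂(Measure.haar : Measure (SLR m))) = G (vecMul y g.1) := by
    filter_upwards [ae_vecMul_zero_ne g, ae_vecMul_zero_ne 1] with y hyg hy
    rw [vecMul_one_SLR] at hy
    obtain ⟨β, B, h⟩ := exists_sec_mul hy hyg
    simp_rw [h]
    have h2 : ∀ A : SLR m, ∫⁻ b, f (coord (vecMul y g.1, A * B, b + A.1.mulVec β)) =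
        ∫⁻ b, f (coord (vecMul y g.1, A * B, b)) := fun A =>
      lintegral_add_right_eq_self (fun b => f (coord (vecMul y g.1, A * B, b))) _
    simp_rw [h2]
    exact lintegral_mul_right_eq_self
      (fun A : SLR m => ∫⁻ b, f (coord (vecMul y g.1, A, b))) B
  rw [lintegral_congr_ae h1]
  exact (measurePreserving_vecMul g).lintegral_comp hGm⟩

theorem secDiag_of_pos {s : ℝ} (hs : 0 < s) (i : Fin (m + 1)) :
    secDiag m s i = s ^ (-(1 / (m + 1 : ℝ))) := by
  refine Fin.cases ?_ (fun i => ?_) i <;> simp [secDiag, abs_of_pos hs, sign_pos hs]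

theorem continuousOn_sec :
    ContinuousOn (sec : (Fin (m + 2) → ℝ) → SLR (m + 1)) {y | 0 < y 0} := by
  intro y hy
  have hy' : 0 < y 0 := hy
  have hev : ∀ᶠ x : Fin (m + 2) → ℝ in 𝓝 y, 0 < x 0 :=
    (continuous_apply 0).continuousAt.eventually (lt_mem_nhds hy')
  refine ContinuousAt.continuousWithinAt (continuousAt_SLR_iff.2 fun i j => ?_)
  have : (fun y : Fin (m + 2) → ℝ => (sec y).1 i j) =ᶠ[𝓝 y] fun y =>
      (Fin.cons y fun i => Fin.cons 0 fun j =>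
        if i = j then y 0 ^ (-(1 / (m + 1 : ℝ))) else 0 : Fin (m + 2) → Fin (m + 2) → ℝ) i j := by
    filter_upwards [hev] with x hx
    refine Fin.cases ?_ (fun i => ?_) i
    · rw [row_zero_sec hx.ne', Fin.cons_zero]
    · rw [sec_succ hx.ne']
      simp [secDiag_of_pos hx]
  refine ContinuousAt.congr ?_ this.symm
  refine Fin.cases ?_ (fun i => ?_) i
  · simp only [Fin.cons_zero]; exact (continuous_apply j).continuousAt
  · refine Fin.cases ?_ (fun j => ?_) j
    · simp only [Fin.cons_succ, Fin.cons_zero]; fun_prop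
    · simp only [Fin.cons_succ]
      split_ifs
      · exact ((continuous_apply 0).continuousAt).rpow_const (Or.inl hy'.ne')
      · fun_prop

/-- Near the identity the entry `M.1 0 0` stays above 1/2, where `sec` is continuous. Compactness
then confines y, A and b to compact sets, up to the null hyperplane. -/
theorem exists_mem_nhds_coordMeasure_ne_top (m : ℕ) :
    ∃ s ∈ 𝓝 (1 : SLR (m + 1)), coordMeasure m s ≠ ∞ := by
  obtain ⟨K, hK, hK1⟩ := exists_compact_mem_nhds (1 : SLR (m + 1))
  have hentry : ∀ i j, Continuous fun M : SLR (m + 1) => M.1 i j :=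
    continuous_SLR_iff.1 continuous_id
  set S : Set (SLR (m + 1)) := K ∩ {M | 1 / 2 ≤ M.1 0 0} with hS
  have hSc : IsCompact S := hK.inter_right (isClosed_le continuous_const (hentry 0 0))
  have hS1 : S ∈ 𝓝 (1 : SLR (m + 1)) := by
    refine Filter.inter_mem hK1 ?_
    have h1 : (1 / 2 : ℝ) < (1 : SLR (m + 1)).1 0 0 := by
      simp; norm_num
    filter_upwards [(hentry 0 0).continuousAt.eventually (lt_mem_nhds h1)] with M hM using hM.le
  refine ⟨S, hS1, ?_⟩
  have hrow : Continuous fun M : SLR (m + 1) => M.1 0 := continuous_pi fun j => hentry 0 j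
  have hcont : ContinuousOn (fun M : SLR (m + 1) => M * (sec (M.1 0))⁻¹) S := by
    refine continuousOn_id.mul (ContinuousOn.inv ?_)
    refine continuousOn_sec.comp hrow.continuousOn fun M hM => ?_
    exact lt_of_lt_of_le (by norm_num : (0 : ℝ) < 1 / 2) hM.2
  have hT := hSc.image_of_continuousOn hcont
  set T := (fun M : SLR (m + 1) => M * (sec (M.1 0))⁻¹) '' S
  have hY := hSc.image hrow
  have hB : IsCompact ((fun M : SLR (m + 1) => fun i : Fin (m + 1) => M.1 i.succ 0) '' T) :=
    hT.image (continuous_pi fun i => hentry i.succ 0)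
  have hA : IsCompact ((fun A : SLR m => A.1) ⁻¹'
      ((fun M : SLR (m + 1) => (Matrix.of fun i j : Fin (m + 1) => M.1 i.succ j.succ)) '' T)) :=
    Matrix.SpecialLinearGroup.isClosedEmbedding_val.isCompact_preimage
      (hT.image (continuous_matrix fun i j => hentry i.succ j.succ))
  rw [coordMeasure, Measure.map_apply measurable_coord hSc.measurableSet]
  have hsub : coord ⁻¹' S ⊆ ({y : Fin (m + 2) → ℝ | y 0 = 0} ×ˢ Set.univ) ∪
      (((fun M : SLR (m + 1) => M.1 0) '' S) ×ˢ (((fun A : SLR m => A.1) ⁻¹'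
      ((fun M : SLR (m + 1) => (Matrix.of fun i j : Fin (m + 1) => M.1 i.succ j.succ)) '' T)) ×ˢ
      ((fun M : SLR (m + 1) => fun i : Fin (m + 1) => M.1 i.succ 0) '' T))) := by
    rintro ⟨y, A, b⟩ hp
    by_cases hy : y 0 = 0
    · exact Or.inl ⟨hy, trivial⟩
    · have hr : (coord (y, A, b)).1 0 = y := row_zero_coord hy
      have hm : stabMat b A ∈ T := by
        refine ⟨_, hp, ?_⟩
        simp only [hr]
        rw [coord]; group
      refine Or.inr ⟨⟨_, hp, hr⟩, ⟨_, hm, ?_⟩, ⟨_, hm, rfl⟩⟩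
      ext i j
      rfl
  refine ne_top_of_le_ne_top ?_ ((measure_mono hsub).trans (measure_union_le _ _))
  have h0 : volume {y : Fin (m + 2) → ℝ | y 0 = 0} = 0 :=
    Measure.pi_hyperplane (fun _ => volume) 0 0
  rw [Measure.prod_prod, Measure.prod_prod, Measure.prod_prod, h0, zero_mul, zero_add]
  exact ENNReal.mul_ne_top hY.measure_lt_top.ne
      (ENNReal.mul_ne_top hA.measure_lt_top.ne hB.measure_lt_top.ne)

instance instIsLocallyFiniteMeasureCoordMeasure : IsLocallyFiniteMeasure (coordMeasure m) := ⟨by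
  intro g
  obtain ⟨s, hs, hst⟩ := exists_mem_nhds_coordMeasure_ne_top m
  refine ⟨(fun x => x * g⁻¹) ⁻¹' s, ?_, ?_⟩
  · exact (continuous_mul_const g⁻¹).continuousAt.preimage_mem_nhds (by simpa using hs)
  · rw [measure_preimage_mul_right]
    exact hst.lt_top⟩

theorem coordMeasure_ne_zero (m : ℕ) : coordMeasure m ≠ 0 := by
  intro h
  have h1 : coordMeasure m Set.univ = 0 := by rw [h]; rfl
  rw [coordMeasure, Measure.map_apply measurable_coord MeasurableSet.univ, Set.preimage_univ,
    ← Set.univ_prod_univ, ← Set.univ_prod_univ, Measure.prod_prod, Measure.prod_prod] at h1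
  have hA := (Measure.measure_univ_ne_zero (μ := (Measure.haar : Measure (SLR m)))).2
    (NeZero.ne _)
  have hy := (Measure.measure_univ_ne_zero (μ := (volume : Measure (Fin (m + 2) → ℝ)))).2
    (NeZero.ne _)
  have hb := (Measure.measure_univ_ne_zero (μ := (volume : Measure (Fin (m + 1) → ℝ)))).2
    (NeZero.ne _)
  exact mul_ne_zero hy (mul_ne_zero hA hb) h1

/-- Haar measure on `SL(d, ℝ)` is a multiple of `dy dA db`. -/
theorem exists_haar_eq_smul_coordMeasure (m : ℕ) : ∃ c : ℝ≥0∞, c ≠ 0 ∧ c ≠ ∞ ∧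
    (Measure.haar : Measure (SLR (m + 1))) = c • coordMeasure m := by
  obtain ⟨K, hK, hK1⟩ := exists_compact_mem_nhds (1 : SLR (m + 1))
  have hs0 : (Measure.haar : Measure (SLR (m + 1))) K ≠ 0 :=
    (Measure.measure_pos_of_mem_nhds _ hK1).ne'
  have hst : (Measure.haar : Measure (SLR (m + 1))) K ≠ ∞ := hK.measure_lt_top.ne
  have hσ : SigmaFinite (coordMeasure m).inv :=
    (MeasurableEquiv.inv (SLR (m + 1))).sigmaFinite_map
  -- Uniqueness is used for left-invariant measures, whereas `coordMeasure` is right invariant. So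
  -- it is inverted first, and inverting back leaves Haar measure unchanged.
  have h := measure_eq_div_smul (coordMeasure m).inv (Measure.haar : Measure (SLR (m + 1))) hs0 hst
  set c := (coordMeasure m).inv K / (Measure.haar : Measure (SLR (m + 1))) K with hc
  have h2 : coordMeasure m = c • (Measure.haar : Measure (SLR (m + 1))) := by
    have h3 := congrArg Measure.inv h
    rw [Measure.inv_inv] at h3
    rw [h3, Measure.inv, Measure.map_smul, Measure.map_inv_eq_self]
  have hc0 : c ≠ 0 := by
    intro h0
    rw [h0, zero_smul] at h2
    exact coordMeasure_ne_zero m h2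
  have hct : c ≠ ∞ := by
    refine ENNReal.div_ne_top ?_ hs0
    rw [Measure.inv_apply]
    exact hK.inv.measure_lt_top.ne
  refine ⟨c⁻¹, ENNReal.inv_ne_zero.2 hct, ENNReal.inv_ne_top.2 hc0, ?_⟩
  rw [h2, smul_smul, ENNReal.inv_mul_cancel hc0 hct, one_smul]

end HaarCoordinates

end LatticeUnion

namespace LatticeUnion

open scoped ENNReal NNReal Topology Pointwise
open Matrix (vecMul)

/-! ### Unfolding -/

section Unfolding

variable {m : ℕ}

theorem measurableSet_fundamentalDomain (m : ℕ) : MeasurableSet (fundamentalDomain m) :=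
  (Classical.choose_spec (exists_fundamentalDomain m)).1

theorem isFundamentalDomain_fundamentalDomain (m : ℕ) :
    IsFundamentalDomain (SLZ m) (fundamentalDomain m) (Measure.haar : Measure (SLR m)) :=
  (Classical.choose_spec (exists_fundamentalDomain m)).2

instance instCountableSLZ : Countable (SLZ m) := by
  have : Countable (Matrix.SpecialLinearGroup (Fin (m + 1)) ℤ) := by
    have : Countable (Matrix (Fin (m + 1)) (Fin (m + 1)) ℤ) :=
      inferInstanceAs (Countable (Fin (m + 1) → Fin (m + 1) → ℤ))
    exact Subtype.val_injective.countable
  exact (MonoidHom.rangeRestrict_surjective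
    (Matrix.SpecialLinearGroup.map (n := Fin (m + 1)) (Int.castRingHom ℝ))).countable

/-- The real vector with the given integer coordinates. -/
def castVec {n : ℕ} (k : Fin n → ℤ) : Fin n → ℝ := fun i => (k i : ℝ)

theorem castVec_injective {n : ℕ} : Function.Injective (castVec (n := n)) := fun k l h => by
  ext i
  exact Int.cast_injective (congrFun h i)

theorem mem_SLZ_iff {M : SLR m} : M ∈ SLZ m ↔ ∀ i j, ∃ n : ℤ, M.1 i j = n := by
  constructor
  · rintro ⟨γ, rfl⟩ i j
    exact ⟨γ.1 i j, rfl⟩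
  · intro h
    choose f hf using h
    have hM : M.1 = (Int.castRingHom ℝ).mapMatrix (Matrix.of f) := by
      ext i j
      simp [hf]
    have hdet : (Matrix.of f).det = 1 := by
      have h1 := M.2
      rw [hM, ← RingHom.map_det] at h1
      exact Int.cast_injective (h1.trans (Int.cast_one (R := ℝ)).symm)
    refine ⟨⟨Matrix.of f, hdet⟩, ?_⟩
    ext i j
    rw [hf]
    rfl

theorem stabMat_mem_SLZ_iff {b : Fin (m + 1) → ℝ} {A : SLR m} :
    stabMat b A ∈ SLZ (m + 1) ↔ (∃ k, b = castVec k) ∧ A ∈ SLZ m := by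
  constructor
  · intro h
    rw [mem_SLZ_iff] at h
    refine ⟨?_, mem_SLZ_iff.2 fun i j => h i.succ j.succ⟩
    choose k hk using fun i : Fin (m + 1) => h i.succ 0
    exact ⟨k, funext hk⟩
  · rintro ⟨⟨k, rfl⟩, hA⟩
    refine mem_SLZ_iff.2 fun i j => ?_
    refine Fin.cases ?_ (fun i => ?_) i <;> refine Fin.cases ?_ (fun j => ?_) j
    · exact ⟨1, by simp⟩
    · exact ⟨0, by simp⟩
    · exact ⟨k i, rfl⟩
    · exact mem_SLZ_iff.1 hA i j

/-- The first row of an element of `SL(d, ℤ)`. -/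
noncomputable def rowZ (γ : SLZ m) : Fin (m + 1) → ℤ := fun j => ⌊γ.1.1 0 j⌋

theorem castVec_rowZ (γ : SLZ m) : castVec (rowZ γ) = γ.1.1 0 := by
  ext j
  obtain ⟨n, hn⟩ := mem_SLZ_iff.1 γ.2 0 j
  simp [castVec, rowZ, hn]

/-- The primitive integer vectors: the first rows of the elements of `SL(d, ℤ)`. -/
def primVec (m : ℕ) : Set (Fin (m + 1) → ℤ) := Set.range (rowZ (m := m))

theorem ae_existsUnique_smul_mem (m : ℕ) : ∀ᵐ A ∂(Measure.haar : Measure (SLR m)),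
    ∃! B : SLZ m, B • A ∈ fundamentalDomain m := by
  have hF := isFundamentalDomain_fundamentalDomain m
  have h2 : ∀ᵐ A ∂(Measure.haar : Measure (SLR m)), ∀ B C : SLZ m, B ≠ C →
      ¬ (B • A ∈ fundamentalDomain m ∧ C • A ∈ fundamentalDomain m) := by
    refine ae_all_iff.2 fun B => ae_all_iff.2 fun C => ?_
    by_cases hBC : B = C
    · simp [hBC]
    · have h := hF.aedisjoint (i := B⁻¹) (j := C⁻¹) (fun h => hBC (inv_injective h))
      have h' : (Measure.haar : Measure (SLR m))
        (B⁻¹ • fundamentalDomain m ∩ C⁻¹ • fundamentalDomain m) = 0 := h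
      filter_upwards [measure_eq_zero_iff_ae_notMem.1 h'] with A hA _ hA'
      refine hA ⟨?_, ?_⟩
      · rw [Set.mem_inv_smul_set_iff]; exact hA'.1
      · rw [Set.mem_inv_smul_set_iff]; exact hA'.2
  filter_upwards [hF.ae_covers, h2] with A ⟨B, hB⟩ hA
  refine ⟨B, hB, fun C hC => ?_⟩
  by_contra hne
  exact hA C B hne ⟨hC, hB⟩

/-- The half-open unit cube. -/
def unitCube (n : ℕ) : Set (Fin n → ℝ) := Set.univ.pi fun _ => Set.Ico (0 : ℝ) 1

theorem measurableSet_unitCube (n : ℕ) : MeasurableSet (unitCube n) :=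
  MeasurableSet.univ_pi fun _ => measurableSet_Ico

theorem existsUnique_castVec_add_mem {n : ℕ} (b : Fin n → ℝ) :
    ∃! k : Fin n → ℤ, castVec k + b ∈ unitCube n := by
  refine ⟨fun i => -⌊b i⌋, fun i _ => ?_, fun k hk => ?_⟩
  · simp only [castVec, Pi.add_apply, Int.cast_neg, neg_add_eq_sub, Int.self_sub_floor]
    exact ⟨Int.fract_nonneg _, Int.fract_lt_one _⟩
  · ext i
    obtain ⟨h1, h2⟩ := hk i trivial
    simp only [castVec, Pi.add_apply] at h1 h2
    have : ⌊b i⌋ = - k i := by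
      rw [Int.floor_eq_iff]
      push_cast
      constructor <;> linarith
    omega

/-- A fundamental domain of the stabilizer of the first unit vector in `SL(d, ℤ)`. -/
noncomputable def stabDomain (m : ℕ) : Set (SLR (m + 1)) :=
  coord '' ({y | y 0 ≠ 0} ×ˢ (fundamentalDomain m ×ˢ unitCube (m + 1)))

theorem measurableSet_zero_ne : MeasurableSet {y : Fin (m + 2) → ℝ | y 0 ≠ 0} :=
  ((measurableSet_singleton (0 : ℝ)).preimage (measurable_pi_apply (0 : Fin (m + 2)))).compl

/-- An instance of the Lusin-Souslin theorem, since `coord` is measurable and injective off the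
hyperplane. -/
theorem measurableSet_image_coord {S : Set (SLR m × (Fin (m + 1) → ℝ))} (hS : MeasurableSet S) :
    MeasurableSet (coord '' ({y : Fin (m + 2) → ℝ | y 0 ≠ 0} ×ˢ S)) :=
  (measurableSet_zero_ne.prod hS).image_of_measurable_injOn measurable_coord
    (coord_injOn.mono fun _ hp => hp.1)

theorem measurableSet_stabDomain : MeasurableSet (stabDomain m) :=
  measurableSet_image_coord ((measurableSet_fundamentalDomain m).prod (measurableSet_unitCube _))

theorem coord_mem_image_iff {S : Set (SLR m × (Fin (m + 1) → ℝ))} {y : Fin (m + 2) → ℝ}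
    (hy : y 0 ≠ 0) {A : SLR m} {b : Fin (m + 1) → ℝ} :
    coord (y, A, b) ∈ coord '' ({y : Fin (m + 2) → ℝ | y 0 ≠ 0} ×ˢ S) ↔ (A, b) ∈ S := by
  refine ⟨?_, fun h => ⟨(y, A, b), ⟨hy, h⟩, rfl⟩⟩
  rintro ⟨p, ⟨hp, hpS⟩, h⟩
  have := coord_injOn (m := m) hp (show (y, A, b).1 0 ≠ 0 from hy) h
  rw [this] at hpS
  exact hpS

/-- Transfers almost-sure properties from rank d-1 to rank d. The exceptional set is enlarged to a
measurable null set so that its image is measurable. -/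
theorem ae_haar_of_ae_coord {P : SLR m → Prop}
    (hP : ∀ᵐ A ∂(Measure.haar : Measure (SLR m)), P A) :
    ∀ᵐ M ∂(Measure.haar : Measure (SLR (m + 1))),
      ∃ y A b, y 0 ≠ 0 ∧ P A ∧ M = coord (y, A, b) := by
  obtain ⟨c, -, -, hc⟩ := exists_haar_eq_smul_coordMeasure m
  rw [hc]
  refine Measure.ae_smul_measure ?_ c
  set N := toMeasurable (Measure.haar : Measure (SLR m)) {A | ¬ P A} with hN
  have hN0 : (Measure.haar : Measure (SLR m)) N = 0 := by
    rw [hN, measure_toMeasurable]; exact hP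
  have hmeas : MeasurableSet
      (coord '' ({y : Fin (m + 2) → ℝ | y 0 ≠ 0} ×ˢ (Nᶜ ×ˢ (Set.univ : Set (Fin (m + 1) → ℝ))))) :=
    measurableSet_image_coord ((measurableSet_toMeasurable _ _).compl.prod MeasurableSet.univ)
  have hnull : ∀ᵐ M ∂(coordMeasure m), M ∈
      coord '' ({y : Fin (m + 2) → ℝ | y 0 ≠ 0} ×ˢ (Nᶜ ×ˢ (Set.univ : Set (Fin (m + 1) → ℝ)))) := by
    rw [coordMeasure]
    refine (ae_map_iff measurable_coord.aemeasurable hmeas).2 ?_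
    have h1 : ∀ᵐ p ∂((volume : Measure (Fin (m + 2) → ℝ)).prod
        ((Measure.haar : Measure (SLR m)).prod (volume : Measure (Fin (m + 1) → ℝ)))),
        p.1 0 ≠ 0 := by
      refine Measure.quasiMeasurePreserving_fst.ae (p := fun y : Fin (m + 2) → ℝ => y 0 ≠ 0) ?_
      exact Measure.ae_eval_ne (fun _ => volume) 0 0
    have h2 : ∀ᵐ p ∂((volume : Measure (Fin (m + 2) → ℝ)).prod
        ((Measure.haar : Measure (SLR m)).prod (volume : Measure (Fin (m + 1) → ℝ)))),
        p.2.1 ∉ N := by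
      refine Measure.quasiMeasurePreserving_snd.ae
        (p := fun q : SLR m × (Fin (m + 1) → ℝ) => q.1 ∉ N) ?_
      refine Measure.quasiMeasurePreserving_fst.ae (p := fun A : SLR m => A ∉ N) ?_
      exact measure_eq_zero_iff_ae_notMem.1 hN0
    filter_upwards [h1, h2] with p hp1 hp2
    exact ⟨p, ⟨hp1, hp2, trivial⟩, rfl⟩
  filter_upwards [hnull] with M hM
  obtain ⟨⟨y, A, b⟩, ⟨hy, hA, -⟩, rfl⟩ := hM
  refine ⟨y, A, b, hy, ?_, rfl⟩
  by_contra hPA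
  exact hA (subset_toMeasurable _ _ hPA)

theorem row_smul (γ : SLZ m) (M : SLR m) : (γ • M).1 0 = vecMul (castVec (rowZ γ)) M.1 := by
  rw [castVec_rowZ, Subgroup.smul_def, smul_eq_mul, row_mul]

/-- The integer matrices with first row p form one coset of the integer stabilizer. In the fibre
coordinates its element (k, B) sends A to BA and b to k + Bb: the fundamental domain of rank d-1
determines B, and then the unit cube determines k. -/
theorem ae_existsUnique_smul_mem_stabDomain (m : ℕ) :
    ∀ᵐ M ∂(Measure.haar : Measure (SLR (m + 1))), ∀ p ∈ primVec (m + 1),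
      ∃! γ : SLZ (m + 1), rowZ γ = p ∧ γ • M ∈ stabDomain m := by
  have h1 : ∀ᵐ M ∂(Measure.haar : Measure (SLR (m + 1))), ∀ γ : SLZ (m + 1),
      ∃ (y : Fin (m + 2) → ℝ) (A : SLR m) (b : Fin (m + 1) → ℝ), y 0 ≠ 0 ∧
        (∃! B : SLZ m, B • A ∈ fundamentalDomain m) ∧ γ.1 * M = coord (y, A, b) := by
    refine ae_all_iff.2 fun γ => ?_
    have h := ae_haar_of_ae_coord (P := fun A => ∃! B : SLZ m, B • A ∈ fundamentalDomain m)
      (ae_existsUnique_smul_mem m)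
    have hq := (measurePreserving_mul_left (Measure.haar : Measure (SLR (m + 1)))
      γ.1).quasiMeasurePreserving.tendsto_ae
    have h' := hq.eventually h
    filter_upwards [h'] with M hM
    obtain ⟨y, A, b, hy, hA, hM⟩ := hM
    exact ⟨y, A, b, hy, hA, hM⟩
  filter_upwards [h1] with M hM
  rintro p ⟨γ₀, rfl⟩
  obtain ⟨y, A, b, hy, ⟨B, hB, hBu⟩, hγ₀⟩ := hM γ₀
  have hstab : ∀ γ : SLZ (m + 1), rowZ γ = rowZ γ₀ → ∃ k : Fin (m + 1) → ℤ, ∃ C : SLZ m,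
      γ.1 = stabMat (castVec k) C.1 * γ₀.1 := by
    intro γ hγ
    have h0 : (γ.1 * γ₀.1⁻¹).1 0 = Fin.cons 1 0 := by
      rw [row_mul, ← castVec_rowZ, hγ, castVec_rowZ, ← row_mul, mul_inv_cancel]
      ext j
      refine Fin.cases ?_ (fun j => ?_) j <;> simp [(Fin.succ_ne_zero _).symm]
    obtain ⟨b', A', h'⟩ := exists_eq_stabMat h0
    have hmem : stabMat b' A' ∈ SLZ (m + 1) := by
      rw [← h']; exact mul_mem γ.2 (inv_mem γ₀.2)
    obtain ⟨⟨k, rfl⟩, hA'⟩ := stabMat_mem_SLZ_iff.1 hmem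
    exact ⟨k, ⟨A', hA'⟩, by rw [← h']; group⟩
  have hmemiff : ∀ (γ : SLZ (m + 1)) (k : Fin (m + 1) → ℤ) (C : SLZ m),
      γ.1 = stabMat (castVec k) C.1 * γ₀.1 → (γ • M ∈ stabDomain m ↔
        C • A ∈ fundamentalDomain m ∧ castVec k + C.1.1.mulVec b ∈ unitCube (m + 1)) := by
    intro γ k C h
    have : γ • M = coord (y, C.1 * A, castVec k + C.1.1.mulVec b) := by
      rw [Subgroup.smul_def, smul_eq_mul, h, mul_assoc]
      rw [hγ₀, stabMat_mul_coord]
    rw [this, stabDomain, coord_mem_image_iff hy]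
    rfl
  obtain ⟨k, hk, hku⟩ := existsUnique_castVec_add_mem (B.1.1.mulVec b)
  refine ⟨⟨stabMat (castVec k) B.1 * γ₀.1,
    mul_mem (stabMat_mem_SLZ_iff.2 ⟨⟨k, rfl⟩, B.2⟩) γ₀.2⟩, ⟨?_, ?_⟩, ?_⟩
  · apply castVec_injective
    rw [castVec_rowZ, castVec_rowZ, row_zero_stabMat_mul]
  · exact (hmemiff _ k B rfl).2 ⟨hB, hk⟩
  · rintro γ ⟨hγ, hγM⟩
    obtain ⟨l, C, hC⟩ := hstab γ hγ
    obtain ⟨hCA, hl⟩ := (hmemiff γ l C hC).1 hγM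
    obtain rfl : C = B := hBu C hCA
    obtain rfl : l = k := hku l hl
    exact Subtype.ext hC

/-- The constant that relates Haar measure to the measure in coordinates. -/
noncomputable def haarConst (m : ℕ) : ℝ≥0∞ :=
  Classical.choose (exists_haar_eq_smul_coordMeasure m)

theorem haarConst_ne_top (m : ℕ) : haarConst m ≠ ∞ :=
  (Classical.choose_spec (exists_haar_eq_smul_coordMeasure m)).2.1

theorem haar_eq (m : ℕ) :
    (Measure.haar : Measure (SLR (m + 1))) = haarConst m • coordMeasure m :=
  (Classical.choose_spec (exists_haar_eq_smul_coordMeasure m)).2.2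

/-- Unfolding. Primitive vectors are the cosets of the integer stabilizer in SL(d, ℤ), so summing
over them turns the integral over a domain for SL(d, ℤ) into one over the larger `stabDomain`, which
is a product in coordinates. `H` may also depend on the whole lattice; this is what allows
conditions such as "no lower point". -/
theorem lintegral_fundamentalDomain_tsum_primVec
    {H : (Fin (m + 2) → ℝ) → SLR (m + 1) → ℝ≥0∞} (hH : Measurable (Function.uncurry H))
    (hinv : ∀ y (γ : SLZ (m + 1)) M, H y (γ • M) = H y M) :
    ∫⁻ M in fundamentalDomain (m + 1), (∑' p : primVec (m + 1), H (vecMul (castVec p.1) M.1) M)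
      ∂(Measure.haar : Measure (SLR (m + 1))) =
    haarConst m * ∫⁻ y, ∫⁻ A in fundamentalDomain m,
      (∫⁻ b in unitCube (m + 1), H y (coord (y, A, b))) ∂(Measure.haar : Measure (SLR m)) := by
  classical
  have hrow : Measurable fun M : SLR (m + 1) => M.1 0 :=
    measurable_pi_lambda _ fun j => measurable_entry 0 j
  have hHr : Measurable fun M : SLR (m + 1) => H (M.1 0) M :=
    hH.comp (hrow.prodMk measurable_id)
  set g : SLR (m + 1) → ℝ≥0∞ := (stabDomain m).indicator fun M => H (M.1 0) M with hg
  have hgm : Measurable g := hHr.indicator measurableSet_stabDomain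
  have h1 : ∫⁻ M, g M ∂(Measure.haar : Measure (SLR (m + 1))) =
      ∫⁻ M in fundamentalDomain (m + 1), (∑' γ : SLZ (m + 1), g (γ • M))
        ∂(Measure.haar : Measure (SLR (m + 1))) := by
    rw [(isFundamentalDomain_fundamentalDomain (m + 1)).lintegral_eq_tsum'' g, lintegral_tsum]
    exact fun γ => (hgm.comp (measurable_const_smul γ)).aemeasurable
  have h2 : ∫⁻ M in fundamentalDomain (m + 1), (∑' γ : SLZ (m + 1), g (γ • M))
        ∂(Measure.haar : Measure (SLR (m + 1))) =
      ∫⁻ M in fundamentalDomain (m + 1), (∑' p : primVec (m + 1), H (vecMul (castVec p.1) M.1) M)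
      ∂(Measure.haar : Measure (SLR (m + 1))) := by
    refine lintegral_congr_ae (ae_restrict_of_ae ?_)
    filter_upwards [ae_existsUnique_smul_mem_stabDomain m] with M hM
    -- Group the γ by first row: in each fibre exactly one γ moves M into `stabDomain`.
    rw [← ENNReal.tsum_fiberwise _ fun γ : SLZ (m + 1) =>
      (⟨rowZ γ, Set.mem_range_self γ⟩ : primVec (m + 1))]
    refine tsum_congr fun p => ?_
    obtain ⟨γ, ⟨hγp, hγM⟩, hu⟩ := hM p.1 p.2
    rw [tsum_eq_single ⟨γ, Subtype.ext hγp⟩]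
    · simp only [hg, Set.indicator_of_mem hγM]
      rw [row_smul, hγp, hinv]
    · rintro ⟨δ, hδ⟩ hne
      have hδ' : rowZ δ = p.1 := congrArg Subtype.val hδ
      refine Set.indicator_of_notMem (fun hmem => hne ?_) _
      exact Subtype.ext (hu δ ⟨hδ', hmem⟩)
  rw [← h2, ← h1, haar_eq, lintegral_smul_measure, lintegral_coordMeasure hgm, smul_eq_mul]
  congr 1
  refine lintegral_congr_ae ?_
  have h0 : ∀ᵐ y : Fin (m + 2) → ℝ, y 0 ≠ 0 := Measure.ae_eval_ne (fun _ => volume) 0 0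
  filter_upwards [h0] with y hy
  rw [← lintegral_indicator (measurableSet_fundamentalDomain m)]
  refine lintegral_congr fun A => ?_
  by_cases hA : A ∈ fundamentalDomain m
  · rw [Set.indicator_of_mem hA, ← lintegral_indicator (measurableSet_unitCube _)]
    refine lintegral_congr fun b => ?_
    by_cases hb : b ∈ unitCube (m + 1)
    · rw [Set.indicator_of_mem hb, hg, Set.indicator_of_mem, row_zero_coord (p := (y, A, b)) hy]
      exact (coord_mem_image_iff hy).2 ⟨hA, hb⟩
    · rw [Set.indicator_of_notMem hb, hg, Set.indicator_of_notMem]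
      exact fun h => hb ((coord_mem_image_iff hy).1 h).2
  · rw [Set.indicator_of_notMem hA]
    have : ∀ b, g (coord (y, A, b)) = 0 := fun b => by
      rw [hg, Set.indicator_of_notMem]
      exact fun h => hA ((coord_mem_image_iff hy).1 h).1
    simp [this]

end Unfolding

end LatticeUnion

namespace LatticeUnion

open scoped ENNReal NNReal Topology Pointwise
open Matrix (vecMul)

/-! ### Primitive integer vectors -/

section Primitive

variable {m : ℕ}

/-- `k` is a positive multiple of the first row of an element of `SL(d, ℤ)`. -/
def IsMultipleOfRow (k : Fin (m + 2) → ℤ) : Prop :=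
  ∃ (γ : Matrix.SpecialLinearGroup (Fin (m + 2)) ℤ) (n : ℕ), 0 < n ∧ k = (n : ℤ) • γ.1 0

theorem IsMultipleOfRow.of_vecMul {k : Fin (m + 2) → ℤ}
    (g : Matrix.SpecialLinearGroup (Fin (m + 2)) ℤ) (h : IsMultipleOfRow (vecMul k g.1)) :
    IsMultipleOfRow k := by
  obtain ⟨γ, n, hn, h⟩ := h
  refine ⟨γ * g⁻¹, n, hn, ?_⟩
  have h1 : (γ * g⁻¹).1 0 = vecMul (γ.1 0) g⁻¹.1 := rfl
  have h2 : g.1 * g⁻¹.1 = 1 := congrArg Subtype.val (mul_inv_cancel g)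
  rw [h1, ← Matrix.smul_vecMul, ← h, Matrix.vecMul_vecMul, h2, Matrix.vecMul_one]

theorem vecMul_transvection {i j : Fin (m + 2)} (hij : i ≠ j) (c : ℤ) (k : Fin (m + 2) → ℤ) :
    vecMul k (Matrix.SpecialLinearGroup.transvection hij c).1 =
      Function.update k j (k j + k i * c) := by
  ext l
  rw [Matrix.SpecialLinearGroup.transvection_coe, Matrix.vecMul_add, Matrix.vecMul_one]
  by_cases hl : l = j
  · subst hl
    simp [Matrix.vecMul, dotProduct, Matrix.single_apply]
  · simp [Matrix.vecMul, dotProduct, hl, Ne.symm hl]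

theorem IsMultipleOfRow.of_update {k : Fin (m + 2) → ℤ} {i j : Fin (m + 2)} (hij : i ≠ j) (c : ℤ)
    (h : IsMultipleOfRow (Function.update k j (k j + k i * c))) : IsMultipleOfRow k :=
  IsMultipleOfRow.of_vecMul (Matrix.SpecialLinearGroup.transvection hij c)
    (by rwa [vecMul_transvection])

theorem isMultipleOfRow_single_zero {a : ℤ} (ha : 0 < a) :
    IsMultipleOfRow (Pi.single 0 a : Fin (m + 2) → ℤ) := by
  refine ⟨1, a.toNat, by omega, ?_⟩
  ext l
  rw [Int.toNat_of_nonneg ha.le]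
  by_cases hl : l = 0
  · subst hl; simp
  · simp [hl, Ne.symm hl]

/-- Two transvections carry a e_i to |a| e_0: add |a| at coordinate 0, then use it to cancel a at
coordinate i. -/
theorem isMultipleOfRow_single {i : Fin (m + 2)} (hi : i ≠ 0) {a : ℤ} (ha : a ≠ 0) :
    IsMultipleOfRow (Pi.single i a : Fin (m + 2) → ℤ) := by
  refine IsMultipleOfRow.of_update hi a.sign ?_
  refine IsMultipleOfRow.of_update hi.symm (-a.sign) ?_
  convert isMultipleOfRow_single_zero (m := m) (abs_pos.2 ha) using 1
  have h1 : a * a.sign = |a| := by rw [mul_comm]; exact Int.sign_mul_self_eq_abs a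
  have h2 : a.sign * |a| = a := Int.sign_mul_abs a
  ext l
  by_cases hl : l = i
  · subst hl
    simp [hi, h1]
    linarith [mul_comm a.sign |a|]
  · by_cases hl0 : l = 0
    · subst hl0; simp [hi.symm, h1]
    · simp [hl, hl0]

/-- Euclid's algorithm by transvections, with the sum of the absolute values of the coordinates
decreasing until a single coordinate is left. -/
theorem isMultipleOfRow (k : Fin (m + 2) → ℤ) (hk : k ≠ 0) : IsMultipleOfRow k := by
  induction hs : ∑ i, (k i).natAbs using Nat.strong_induction_on generalizing k with
  | _ s ih =>
  by_cases hex : ∃ i j, i ≠ j ∧ k i ≠ 0 ∧ k j ≠ 0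
  · obtain ⟨i, j, hij, hi, hj, hle⟩ :
        ∃ i j, i ≠ j ∧ k i ≠ 0 ∧ k j ≠ 0 ∧ (k i).natAbs ≤ (k j).natAbs := by
      obtain ⟨i, j, hij, hi, hj⟩ := hex
      rcases le_total (k i).natAbs (k j).natAbs with h | h
      · exact ⟨i, j, hij, hi, hj, h⟩
      · exact ⟨j, i, hij.symm, hj, hi, h⟩
    refine IsMultipleOfRow.of_update hij (-((k i).sign * (k j).sign)) ?_
    have habs : (k j + k i * -((k i).sign * (k j).sign)).natAbs < (k j).natAbs := by
      have h1 : k i * (k i).sign = |k i| := by rw [mul_comm]; exact Int.sign_mul_self_eq_abs _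
      have h2 : k j + k i * -((k i).sign * (k j).sign) = k j - |k i| * (k j).sign := by
        rw [← h1]; ring
      rw [h2, Int.abs_eq_natAbs]
      rcases lt_trichotomy (k j) 0 with h | h | h
      · rw [Int.sign_eq_neg_one_of_neg h]; omega
      · exact absurd h hj
      · rw [Int.sign_eq_one_of_pos h]; omega
    refine ih _ ?_ _ ?_ rfl
    · rw [← hs]
      refine Finset.sum_lt_sum (fun l _ => ?_) ⟨j, Finset.mem_univ _, ?_⟩
      · by_cases hl : l = j
        · subst hl; rw [Function.update_self]; exact habs.le
        · rw [Function.update_of_ne hl]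
      · rw [Function.update_self]; exact habs
    · intro h0
      have := congrFun h0 i
      rw [Function.update_of_ne hij] at this
      exact hi this
  · push Not at hex
    obtain ⟨i, hi⟩ : ∃ i, k i ≠ 0 := by
      by_contra! h
      exact hk (funext h)
    have hki : k = Pi.single i (k i) := by
      ext l
      by_cases hl : l = i
      · subst hl; simp
      · simp [hl, hex i l (Ne.symm hl) hi]
    rw [hki]
    by_cases hi0 : i = 0
    · subst hi0
      have h01 : (0 : Fin (m + 2)) ≠ 1 := Fin.zero_ne_one
      rcases lt_or_gt_of_ne hi with hneg | hpos
      -- A negative multiple of e_0 is moved to e_1 first, from where the sign can be corrected on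
      -- the way back. This needs dimension at least two.
      · refine IsMultipleOfRow.of_update h01 1 ?_
        refine IsMultipleOfRow.of_update h01.symm (-1) ?_
        convert isMultipleOfRow_single (m := m) h01.symm hi using 1
        ext l
        by_cases hl : l = 0
        · subst hl; simp [h01]
        · by_cases hl1 : l = 1
          · subst hl1; simp
          · simp [hl, hl1]
      · exact isMultipleOfRow_single_zero hpos
    · exact isMultipleOfRow_single hi0 hi

theorem rowZ_map (γ : Matrix.SpecialLinearGroup (Fin (m + 1)) ℤ) :
    γ.1 0 ∈ primVec m := by
  refine ⟨⟨Matrix.SpecialLinearGroup.map (Int.castRingHom ℝ) γ, γ, rfl⟩, ?_⟩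
  apply castVec_injective
  rw [castVec_rowZ]
  rfl

/-- A Bézout certificate of primitivity: the first column of the inverse matrix. -/
theorem exists_dotProduct_eq_one {p : Fin (m + 1) → ℤ} (hp : p ∈ primVec m) :
    ∃ v : Fin (m + 1) → ℤ, dotProduct p v = 1 := by
  obtain ⟨γ, rfl⟩ := hp
  obtain ⟨δ, hδ⟩ := γ.2
  refine ⟨fun i => δ⁻¹.1 i 0, ?_⟩
  have h1 : rowZ γ = δ.1 0 := by
    apply castVec_injective
    rw [castVec_rowZ, ← hδ]
    rfl
  rw [h1]
  have h2 : (δ * δ⁻¹).1 0 0 = 1 := by rw [mul_inv_cancel]; rfl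
  exact h2

theorem ne_zero_of_mem_primVec {p : Fin (m + 1) → ℤ} (hp : p ∈ primVec m) : p ≠ 0 := by
  obtain ⟨v, hv⟩ := exists_dotProduct_eq_one hp
  rintro rfl
  simp at hv

theorem dvd_of_smul_eq_smul {p q : Fin (m + 1) → ℤ} (hq : q ∈ primVec m) {a b : ℤ}
    (h : a • p = b • q) : a ∣ b := by
  obtain ⟨v, hv⟩ := exists_dotProduct_eq_one hq
  have h1 : a * dotProduct p v = b := by
    have := congrArg (fun w => dotProduct w v) h
    simp only [smul_dotProduct, hv, smul_eq_mul, mul_one] at this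
    exact this
  exact ⟨_, h1.symm⟩

/-- Every nonzero integer vector is in a unique way a positive multiple of a primitive one. -/
noncomputable def equivPrimVec (m : ℕ) :
    ℕ+ × primVec (m + 1) ≃ {k : Fin (m + 2) → ℤ // k ≠ 0} :=
  Equiv.ofBijective (fun q => ⟨((q.1 : ℕ) : ℤ) • q.2.1, by
      refine smul_ne_zero ?_ (ne_zero_of_mem_primVec q.2.2)
      exact_mod_cast q.1.ne_zero⟩) <| by
    constructor
    · rintro ⟨a, p, hp⟩ ⟨b, q, hq⟩ h
      have h' : ((a : ℕ) : ℤ) • p = ((b : ℕ) : ℤ) • q := congrArg Subtype.val h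
      have hab : (a : ℕ) = b := Nat.dvd_antisymm
        (Int.natCast_dvd_natCast.1 (dvd_of_smul_eq_smul hq h'))
        (Int.natCast_dvd_natCast.1 (dvd_of_smul_eq_smul hp h'.symm))
      obtain rfl : a = b := PNat.coe_injective hab
      have hpq : p = q := smul_right_injective _ (by exact_mod_cast a.ne_zero) h'
      subst hpq
      rfl
    · rintro ⟨k, hk⟩
      obtain ⟨γ, n, hn, h⟩ := isMultipleOfRow k hk
      exact ⟨(⟨n, hn⟩, ⟨γ.1 0, rowZ_map γ⟩), Subtype.ext h.symm⟩

theorem tsum_ne_zero_eq (f : (Fin (m + 2) → ℤ) → ℝ≥0∞) :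
    ∑' k : {k : Fin (m + 2) → ℤ // k ≠ 0}, f k.1 =
      ∑' n : ℕ+, ∑' p : primVec (m + 1), f (((n : ℕ) : ℤ) • p.1) := by
  rw [← (equivPrimVec m).tsum_eq, ENNReal.tsum_prod']
  rfl

end Primitive

end LatticeUnion

namespace LatticeUnion

open scoped ENNReal NNReal Topology Pointwise
open Matrix (vecMul)

/-! ### The mean value formula -/

section MeanValue

variable {m : ℕ}

theorem volume_unitCube (n : ℕ) : volume (unitCube n) = 1 := by
  rw [unitCube, volume_pi_pi]
  simp

theorem measurable_vecMul_prod (p : Fin (m + 1) → ℝ) :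
    Measurable fun M : SLR m => vecMul p M.1 := by
  refine measurable_pi_lambda _ fun j => ?_
  simp only [Matrix.vecMul, dotProduct]
  exact Finset.measurable_sum _ fun i _ => (measurable_entry i j).const_mul _

theorem castVec_smul {n : ℕ} (a : ℕ) (k : Fin n → ℤ) :
    castVec ((a : ℤ) • k) = (a : ℝ) • castVec k := by
  ext i
  simp [castVec]

/-- `ζ(d)`. -/
noncomputable def zetaSum (m : ℕ) : ℝ≥0∞ := ∑' n : ℕ+, ENNReal.ofReal (((n : ℕ) : ℝ) ^ (m + 2))⁻¹

theorem summable_zeta (m : ℕ) : Summable fun n : ℕ+ => (((n : ℕ) : ℝ) ^ (m + 2))⁻¹ :=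
  (Real.summable_nat_pow_inv.2 (by omega : 1 < m + 2)).comp_injective PNat.coe_injective

theorem zetaSum_ne_top (m : ℕ) : zetaSum m ≠ ∞ := by
  rw [zetaSum, ← ENNReal.ofReal_tsum_of_nonneg (fun n => by positivity) (summable_zeta m)]
  exact ENNReal.ofReal_ne_top

theorem toReal_zetaSum (m : ℕ) :
    (zetaSum m).toReal = (riemannZeta ((m + 2 : ℕ) : ℂ)).re := by
  rw [zetaSum, ← ENNReal.ofReal_tsum_of_nonneg (fun n => by positivity) (summable_zeta m),
    ENNReal.toReal_ofReal (tsum_nonneg fun n => by positivity)]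
  rw [zeta_nat_eq_tsum_of_gt_one (by omega : 1 < m + 2)]
  have h1 : ∑' n : ℕ, 1 / (n : ℂ) ^ (m + 2) = ((∑' n : ℕ, ((n : ℝ) ^ (m + 2))⁻¹ : ℝ) : ℂ) := by
    rw [Complex.ofReal_tsum]
    refine tsum_congr fun n => ?_
    push_cast
    rw [one_div]
  rw [h1, Complex.ofReal_re]
  rw [tsum_pnat_eq_tsum_succ (f := fun n : ℕ => ((n : ℝ) ^ (m + 2))⁻¹),
    (Real.summable_nat_pow_inv.2 (by omega : 1 < m + 2)).tsum_eq_zero_add]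
  simp

theorem lintegral_comp_smul (f : (Fin (m + 2) → ℝ) → ℝ≥0∞) (n : ℕ+) :
    ∫⁻ y, f (((n : ℕ) : ℝ) • y) = ENNReal.ofReal (((n : ℕ) : ℝ) ^ (m + 2))⁻¹ * ∫⁻ y, f y := by
  have hn : ((n : ℕ) : ℝ) ≠ 0 := by exact_mod_cast n.ne_zero
  have h := Measure.map_addHaar_smul (volume : Measure (Fin (m + 2) → ℝ)) hn
  have h3 : ∫⁻ y, f (((n : ℕ) : ℝ) • y) = ∫⁻ y, f y ∂(Measure.map (((n : ℕ) : ℝ) • ·)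
      (volume : Measure (Fin (m + 2) → ℝ))) :=
    (lintegral_map_equiv f
      (Homeomorph.smulOfNeZero ((n : ℕ) : ℝ) hn (α := Fin (m + 2) → ℝ)).toMeasurableEquiv).symm
  rw [h3, h, lintegral_smul_measure, smul_eq_mul]
  simp

/-- A nonzero vector is n times a primitive one, and scaling the argument by n contributes n^(-d);
the sum over n is ζ(d). The formula is kept unnormalised because it serves to prove that the
covolume is finite. -/
theorem lintegral_fundamentalDomain_tsum_ne_zero {f : (Fin (m + 2) → ℝ) → ℝ≥0∞}
    (hf : Measurable f) :
    ∫⁻ M in fundamentalDomain (m + 1),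
      (∑' k : {k : Fin (m + 2) → ℤ // k ≠ 0}, f (vecMul (castVec k.1) M.1))
      ∂(Measure.haar : Measure (SLR (m + 1))) =
    haarConst m * (Measure.haar : Measure (SLR m)) (fundamentalDomain m) *
      (zetaSum m * ∫⁻ y, f y) := by
  have h1 : ∀ n : ℕ+, ∫⁻ M in fundamentalDomain (m + 1),
      (∑' p : primVec (m + 1), f (((n : ℕ) : ℝ) • vecMul (castVec p.1) M.1))
      ∂(Measure.haar : Measure (SLR (m + 1))) =
      haarConst m * (Measure.haar : Measure (SLR m)) (fundamentalDomain m) *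
      (ENNReal.ofReal (((n : ℕ) : ℝ) ^ (m + 2))⁻¹ * ∫⁻ y, f y) := by
    intro n
    have hfn : Measurable fun y : Fin (m + 2) → ℝ => f (((n : ℕ) : ℝ) • y) :=
      hf.comp (measurable_const_smul _)
    rw [lintegral_fundamentalDomain_tsum_primVec
      (H := fun y _ => f (((n : ℕ) : ℝ) • y)) (hfn.comp measurable_fst) (fun _ _ _ => rfl)]
    simp only [lintegral_const, Measure.restrict_apply MeasurableSet.univ, Set.univ_inter,
      volume_unitCube, mul_one]
    rw [lintegral_mul_const _ hfn, lintegral_comp_smul]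
    ring
  have h2 : ∀ M : SLR (m + 1),
      ∑' k : {k : Fin (m + 2) → ℤ // k ≠ 0}, f (vecMul (castVec k.1) M.1) =
      ∑' n : ℕ+, ∑' p : primVec (m + 1), f (((n : ℕ) : ℝ) • vecMul (castVec p.1) M.1) := by
    intro M
    rw [tsum_ne_zero_eq fun k => f (vecMul (castVec k) M.1)]
    simp_rw [castVec_smul, Matrix.smul_vecMul]
  simp_rw [h2]
  rw [lintegral_tsum]
  · simp_rw [h1]
    rw [ENNReal.tsum_mul_left, ENNReal.tsum_mul_right, zetaSum]
  · intro n
    refine (Measurable.tsum fun p => ?_).aemeasurable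
    exact hf.comp ((measurable_const_smul ((n : ℕ) : ℝ)).comp (measurable_vecMul_prod _))

/-- Minkowski's theorem for the sup norm. -/
theorem exists_ne_zero_norm_lt_two (M : SLR m) :
    ∃ k : Fin (m + 1) → ℤ, k ≠ 0 ∧
      vecMul (castVec k) M.1 ∈ Metric.ball (0 : Fin (m + 1) → ℝ) 2 := by
  set s : Set (Fin (m + 1) → ℝ) := (fun x => vecMul x M.1) ⁻¹' Metric.ball 0 2 with hs
  have hvol : volume s = ENNReal.ofReal (4 ^ (m + 1)) := by
    rw [hs, (measurePreserving_vecMul M).measure_preimage Metric.isOpen_ball.measurableSet.nullMeasurableSet,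
      Real.volume_pi_ball _ two_pos]
    norm_num
  set b := Pi.basisFun ℝ (Fin (m + 1))
  have hfund := ZSpan.isAddFundamentalDomain' b (volume : Measure (Fin (m + 1) → ℝ))
  have : Countable (Submodule.span ℤ (Set.range b)).toAddSubgroup :=
    inferInstanceAs (Countable (Submodule.span ℤ (Set.range b)))
  have hsymm : ∀ x ∈ s, -x ∈ s := fun x hx => by simpa [hs, Matrix.neg_vecMul] using hx
  have hconv : Convex ℝ s := (convex_ball _ _).linear_preimage M.1.vecMulLinear
  -- The sup-norm ball of radius 2 has side 4, hence volume 4^d, which exceeds the threshold 2^d.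
  have hlt : volume (ZSpan.fundamentalDomain b) * 2 ^ Module.finrank ℝ (Fin (m + 1) → ℝ) <
      volume s := by
    have hcube := volume_unitCube (m + 1)
    rw [unitCube] at hcube
    rw [hvol, ZSpan.fundamentalDomain_pi_basisFun, hcube, one_mul, Module.finrank_fin_fun,
      ENNReal.ofReal_pow (by norm_num)]
    exact ENNReal.pow_lt_pow_left (Nat.succ_ne_zero m) (by norm_num)
  obtain ⟨⟨x, hx⟩, hx0, hxs⟩ :=
    exists_ne_zero_mem_lattice_of_measure_mul_two_pow_lt_measure hfund hsymm hconv hlt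
  have hx' := (b.mem_span_iff_repr_mem ℤ x).1 hx
  choose k hk using hx'
  have hkx : castVec k = x := by
    ext i
    have := hk i
    simpa [b, castVec] using this
  refine ⟨k, ?_, ?_⟩
  · rintro rfl
    apply hx0
    ext i
    simp [← hkx, castVec]
  · rw [hkx]; exact hxs

theorem haar_fundamentalDomain_ne_zero (m : ℕ) :
    (Measure.haar : Measure (SLR m)) (fundamentalDomain m) ≠ 0 :=
  (isFundamentalDomain_fundamentalDomain m).measure_ne_zero (NeZero.ne _)

/-- `SL(d, ℤ)` has finite covolume in `SL(d, ℝ)`. -/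
theorem haar_fundamentalDomain_ne_top (m : ℕ) :
    (Measure.haar : Measure (SLR m)) (fundamentalDomain m) ≠ ∞ := by
  induction m with
  | zero =>
    have : Subsingleton (SLR 0) := inferInstanceAs
      (Subsingleton (Matrix.SpecialLinearGroup (Fin 1) ℝ))
    have : Finite (SLR 0) := Finite.of_subsingleton
    exact (measure_lt_top_of_subset (Set.subset_univ _) isCompact_univ.measure_lt_top.ne).ne
  | succ m ih =>
    -- By Minkowski's theorem the number of nonzero points in the ball is at least 1 for every
    -- lattice, so the covolume is at most the integral of this number, which is finite by the
    -- covolume of rank one less.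
    have h := lintegral_fundamentalDomain_tsum_ne_zero (m := m)
      (f := (Metric.ball (0 : Fin (m + 2) → ℝ) 2).indicator 1)
      (measurable_one.indicator Metric.isOpen_ball.measurableSet)
    rw [lintegral_indicator_one Metric.isOpen_ball.measurableSet] at h
    refine ne_top_of_le_ne_top ?_ (?_ : _ ≤ ∫⁻ M in fundamentalDomain (m + 1),
      (∑' k : {k : Fin (m + 2) → ℤ // k ≠ 0}, (Metric.ball (0 : Fin (m + 2) → ℝ) 2).indicator 1
        (vecMul (castVec k.1) M.1)) ∂(Measure.haar : Measure (SLR (m + 1))))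
    · rw [h]
      exact ENNReal.mul_ne_top (ENNReal.mul_ne_top (haarConst_ne_top m) ih)
        (ENNReal.mul_ne_top (zetaSum_ne_top m) measure_ball_lt_top.ne)
    · rw [← setLIntegral_one]
      refine lintegral_mono fun M => ?_
      obtain ⟨k, hk, hkM⟩ := exists_ne_zero_norm_lt_two M
      refine le_trans ?_ (ENNReal.le_tsum ⟨k, hk⟩)
      rw [Set.indicator_of_mem hkM, Pi.one_apply]

instance instIsProbabilityMeasureLatticeMeasure : IsProbabilityMeasure (latticeMeasure m) :=
  ProbabilityTheory.cond_isProbabilityMeasure_of_finite (haar_fundamentalDomain_ne_zero m)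
    (haar_fundamentalDomain_ne_top m)

theorem lintegral_latticeMeasure (f : SLR m → ℝ≥0∞) :
    ∫⁻ M, f M ∂(latticeMeasure m) =
      ((Measure.haar : Measure (SLR m)) (fundamentalDomain m))⁻¹ *
        ∫⁻ M in fundamentalDomain m, f M ∂(Measure.haar : Measure (SLR m)) := by
  rw [latticeMeasure, ProbabilityTheory.cond, lintegral_smul_measure, smul_eq_mul]

/-- The constant of the mean value formula. -/
noncomputable def meanConst (m : ℕ) : ℝ≥0∞ :=
  haarConst m * (Measure.haar : Measure (SLR m)) (fundamentalDomain m) *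
    ((Measure.haar : Measure (SLR (m + 1))) (fundamentalDomain (m + 1)))⁻¹

theorem lintegral_tsum_primVec
    {H : (Fin (m + 2) → ℝ) → SLR (m + 1) → ℝ≥0∞} (hH : Measurable (Function.uncurry H))
    (hinv : ∀ y (γ : SLZ (m + 1)) M, H y (γ • M) = H y M) :
    ∫⁻ M, (∑' p : primVec (m + 1), H (vecMul (castVec p.1) M.1) M) ∂(latticeMeasure (m + 1)) =
    meanConst m * ∫⁻ y, ∫⁻ A, (∫⁻ b in unitCube (m + 1), H y (coord (y, A, b)))
      ∂(latticeMeasure m) := by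
  rw [lintegral_latticeMeasure, lintegral_fundamentalDomain_tsum_primVec hH hinv]
  simp_rw [lintegral_latticeMeasure]
  rw [lintegral_const_mul' _ _ (ENNReal.inv_ne_top.2 (haar_fundamentalDomain_ne_zero m)), meanConst]
  rw [← mul_assoc, ← mul_assoc]
  congr 1
  have h := ENNReal.mul_inv_cancel (haar_fundamentalDomain_ne_zero m)
    (haar_fundamentalDomain_ne_top m)
  calc _ = haarConst m *
        ((Measure.haar : Measure (SLR (m + 1))) (fundamentalDomain (m + 1)))⁻¹ * 1 := by ring
    _ = _ := by rw [← h]; ring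

theorem lintegral_tsum_ne_zero {f : (Fin (m + 2) → ℝ) → ℝ≥0∞} (hf : Measurable f) :
    ∫⁻ M, (∑' k : {k : Fin (m + 2) → ℤ // k ≠ 0}, f (vecMul (castVec k.1) M.1))
      ∂(latticeMeasure (m + 1)) = meanConst m * zetaSum m * ∫⁻ y, f y := by
  rw [lintegral_latticeMeasure, lintegral_fundamentalDomain_tsum_ne_zero hf, meanConst]
  ring

theorem meanConst_ne_top (m : ℕ) : meanConst m ≠ ∞ :=
  ENNReal.mul_ne_top (ENNReal.mul_ne_top (haarConst_ne_top m) (haar_fundamentalDomain_ne_top m))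
    (ENNReal.inv_ne_top.2 (haar_fundamentalDomain_ne_zero _))

end MeanValue

end LatticeUnion

namespace LatticeUnion

open scoped ENNReal NNReal Topology Pointwise
open Matrix (vecMul)

/-! ### The constant of the mean value formula -/

section MeanConst

variable {m : ℕ}

/-- The number of points of the lattice `ℤ^d M` in `S`. -/
noncomputable def latCount (M : SLR m) (S : Set (Fin (m + 1) → ℝ)) : ℝ≥0∞ :=
  ∑' k : Fin (m + 1) → ℤ, S.indicator 1 (vecMul (castVec k) M.1)

theorem castVec_sub {n : ℕ} (k l : Fin n → ℤ) : castVec (k - l) = castVec k - castVec l := by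
  ext i; simp [castVec]

theorem castVec_zero {n : ℕ} : castVec (0 : Fin n → ℤ) = 0 := by
  ext i; simp [castVec]

theorem castVec_neg {n : ℕ} (k : Fin n → ℤ) : castVec (-k) = -castVec k := by
  ext i; simp [castVec]

theorem castVec_add {n : ℕ} (k l : Fin n → ℤ) : castVec (k + l) = castVec k + castVec l := by
  ext i; simp [castVec]

theorem latCount_eq (M : SLR m) (S : Set (Fin (m + 1) → ℝ)) (h0 : (0 : Fin (m + 1) → ℝ) ∈ S) :
    latCount M S = 1 + ∑' k : {k : Fin (m + 1) → ℤ // k ≠ 0},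
      S.indicator 1 (vecMul (castVec k.1) M.1) := by
  classical
  rw [latCount, ENNReal.tsum_eq_add_tsum_ite (0 : Fin (m + 1) → ℤ)]
  congr 1
  · rw [castVec_zero, Matrix.zero_vecMul, Set.indicator_of_mem h0, Pi.one_apply]
  · rw [show (∑' k : {k : Fin (m + 1) → ℤ // k ≠ 0},
      S.indicator (1 : (Fin (m + 1) → ℝ) → ℝ≥0∞) (vecMul (castVec k.1) M.1)) =
      ∑' k : ({0}ᶜ : Set (Fin (m + 1) → ℤ)), S.indicator 1 (vecMul (castVec k.1) M.1) from rfl,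
      tsum_subtype ({0}ᶜ : Set (Fin (m + 1) → ℤ))
        fun k => S.indicator (1 : (Fin (m + 1) → ℝ) → ℝ≥0∞) (vecMul (castVec k) M.1)]
    refine tsum_congr fun k => ?_
    by_cases hk : k = 0 <;> simp [hk]

theorem measurable_latCount {S : Set (Fin (m + 1) → ℝ)} (hS : MeasurableSet S) :
    Measurable fun M : SLR m => latCount M S :=
  Measurable.tsum fun _ => (measurable_one.indicator hS).comp (measurable_vecMul_prod _)

/-- The translate of the half-open unit cube by `j`. -/
def floorCell (j : Fin (m + 1) → ℤ) : Set (Fin (m + 1) → ℝ) := {x | (fun i => ⌊x i⌋) = j}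

/-- A translate of the unit cube contains at most as many lattice points as the ball of radius one
of the sup norm. -/
theorem tsum_indicator_cube_le (M : SLR m) (j : Fin (m + 1) → ℤ) :
    ∑' k : Fin (m + 1) → ℤ, (floorCell j).indicator (1 : (Fin (m + 1) → ℝ) → ℝ≥0∞)
      (vecMul (castVec k) M.1) ≤ latCount M (Metric.ball 0 1) := by
  by_cases h : ∃ l : Fin (m + 1) → ℤ, (fun i => ⌊vecMul (castVec l) M.1 i⌋) = j
  · classical
    obtain ⟨l, hl⟩ := h
    -- Shift the index by a lattice point l of the cell: differences of two points in a unit cell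
    -- have sup norm below 1.
    rw [latCount, ← (Equiv.addRight l).tsum_eq]
    refine ENNReal.tsum_le_tsum fun k => ?_
    rw [Set.indicator_apply]
    split_ifs with hk
    · have hball : vecMul (castVec k) M.1 ∈ Metric.ball (0 : Fin (m + 1) → ℝ) 1 := by
        rw [mem_ball_zero_iff, pi_norm_lt_iff one_pos]
        intro i
        have h1 : ⌊vecMul (castVec (k + l)) M.1 i⌋ = ⌊vecMul (castVec l) M.1 i⌋ :=
          (congrFun hk i).trans (congrFun hl i).symm
        have h2 := Int.abs_sub_lt_one_of_floor_eq_floor h1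
        rw [castVec_add, Matrix.add_vecMul] at h2
        simpa using h2
      rw [Set.indicator_of_mem hball]
      rfl
    · exact zero_le
  · push Not at h
    have : ∀ k : Fin (m + 1) → ℤ, (floorCell j).indicator
        (1 : (Fin (m + 1) → ℝ) → ℝ≥0∞) (vecMul (castVec k) M.1) = 0 := fun k =>
      Set.indicator_of_notMem (s := floorCell j) (h k) _
    simp [this]

/-- The ball of radius n is covered by (2n)^d unit cells. This is the domination needed for the
limit of normalised mean counts. -/
theorem latCount_ball_le (M : SLR m) (n : ℕ) :
    latCount M (Metric.ball 0 n) ≤ (2 * n : ℝ≥0∞) ^ (m + 1) * latCount M (Metric.ball 0 1) := by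
  set J : Finset (Fin (m + 1) → ℤ) := Fintype.piFinset fun _ => Finset.Ico (-n : ℤ) n with hJ
  have hcard : (J.card : ℝ≥0∞) = (2 * n : ℝ≥0∞) ^ (m + 1) := by
    rw [hJ, Fintype.card_piFinset_const, Int.card_Ico]
    have : ((n : ℤ) - -n).toNat = 2 * n := by omega
    rw [this]
    push_cast
    rfl
  calc latCount M (Metric.ball 0 n)
      ≤ ∑' k : Fin (m + 1) → ℤ, ∑ j ∈ J, (floorCell j).indicator 1 (vecMul (castVec k) M.1) := by
        classical
        refine ENNReal.tsum_le_tsum fun k => ?_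
        rw [Set.indicator_apply]
        split_ifs with hk
        · have hmem : (fun i => ⌊vecMul (castVec k) M.1 i⌋) ∈ J := by
            rw [hJ, Fintype.mem_piFinset]
            intro i
            have h1 := (norm_le_pi_norm (vecMul (castVec k) M.1) i).trans_lt
              (mem_ball_zero_iff.1 hk)
            rw [Real.norm_eq_abs, abs_lt] at h1
            rw [Finset.mem_Ico, Int.le_floor, Int.floor_lt]
            push_cast
            exact ⟨h1.1.le, h1.2⟩
          refine le_trans ?_ (Finset.single_le_sum (fun _ _ => zero_le) hmem)
          rw [Set.indicator_of_mem (s := floorCell _)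
            (show vecMul (castVec k) M.1 ∈ floorCell _ from rfl)]
        · exact zero_le
    _ = ∑ j ∈ J, ∑' k : Fin (m + 1) → ℤ, (floorCell j).indicator 1 (vecMul (castVec k) M.1) :=
        Summable.tsum_finsetSum fun _ _ => ENNReal.summable
    _ ≤ ∑ j ∈ J, latCount M (Metric.ball 0 1) :=
        Finset.sum_le_sum fun j _ => tsum_indicator_cube_le M j
    _ = _ := by rw [Finset.sum_const, nsmul_eq_mul, hcard]

theorem finite_castVec_mem (M : SLR m) {S : Set (Fin (m + 1) → ℝ)} (hS : Bornology.IsBounded S) :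
    {k : Fin (m + 1) → ℤ | vecMul (castVec k) M.1 ∈ S}.Finite := by
  have hb : Bornology.IsBounded ((fun x => vecMul x M⁻¹.1) '' S) :=
    (M⁻¹.1.vecMulLinear.toContinuousLinearMap.lipschitz).isBounded_image hS
  obtain ⟨R, hR⟩ := hb.subset_closedBall 0
  refine (Set.Finite.pi' (ι := Fin (m + 1)) (t := fun _ => Set.Icc (-⌈R⌉) ⌈R⌉)
    fun _ => Set.finite_Icc _ _).subset fun k hk i => ?_
  have h1 : castVec k ∈ Metric.closedBall (0 : Fin (m + 1) → ℝ) R :=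
    hR ⟨_, hk, vecMul_mul_inv _ _⟩
  have h2 := (norm_le_pi_norm (castVec k) i).trans (mem_closedBall_zero_iff.1 h1)
  rw [Real.norm_eq_abs, abs_le] at h2
  have h3 : (k i : ℝ) = castVec k i := rfl
  rw [Set.mem_Icc, ← Int.cast_le (R := ℝ), ← Int.cast_le (R := ℝ), h3]
  push_cast
  exact ⟨by linarith [Int.le_ceil R], by linarith [Int.le_ceil R]⟩

/-- The indices of the points of the lattice `ℤ^d M` in `S`. -/
def latIndex (M : SLR m) (S : Set (Fin (m + 1) → ℝ)) : Set (Fin (m + 1) → ℤ) :=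
  {k | vecMul (castVec k) M.1 ∈ S}

theorem latCount_eq_encard (M : SLR m) (S : Set (Fin (m + 1) → ℝ)) :
    latCount M S = (latIndex M S).encard := by
  classical
  rw [latCount, ← ENNReal.tsum_set_one, tsum_subtype (latIndex M S) (fun _ => (1 : ℝ≥0∞))]
  refine tsum_congr fun k => ?_
  rw [Set.indicator_apply, Set.indicator_apply]
  rfl

theorem latIndex_ball_image (M : SLR m) {n : ℕ} (hn : 0 < n) :
    ((fun x => vecMul x M.1) ⁻¹' Metric.ball 0 1 ∩
      (n : ℝ)⁻¹ • (Submodule.span ℤ (Set.range (Pi.basisFun ℝ (Fin (m + 1)))) :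
        Set (Fin (m + 1) → ℝ))) =
      (fun k => (n : ℝ)⁻¹ • castVec k) '' latIndex M (Metric.ball 0 n) := by
  have hn' : (0 : ℝ) < n := by exact_mod_cast hn
  have hiff : ∀ k : Fin (m + 1) → ℤ, (n : ℝ)⁻¹ • castVec k ∈
      (fun x => vecMul x M.1) ⁻¹' Metric.ball 0 1 ↔ k ∈ latIndex M (Metric.ball 0 n) := by
    intro k
    rw [latIndex, Set.mem_preimage, Set.mem_ofPred_eq, Matrix.smul_vecMul, mem_ball_zero_iff,
      mem_ball_zero_iff, norm_smul, norm_inv, Real.norm_natCast, inv_mul_lt_iff₀ hn', mul_one]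
  ext x
  constructor
  · rintro ⟨hx, y, hy, rfl⟩
    have hy' := ((Pi.basisFun ℝ (Fin (m + 1))).mem_span_iff_repr_mem ℤ y).1 hy
    choose k hk using hy'
    have hky : castVec k = y := by
      ext i
      simpa [castVec] using hk i
    subst hky
    exact ⟨k, (hiff k).1 hx, rfl⟩
  · rintro ⟨k, hk, rfl⟩
    refine ⟨(hiff k).2 hk, castVec k, ?_, rfl⟩
    refine ((Pi.basisFun ℝ (Fin (m + 1))).mem_span_iff_repr_mem ℤ _).2 fun i => ⟨k i, ?_⟩
    simp [castVec]

theorem continuous_vecMul_const (M : SLR m) : Continuous fun x => vecMul x M.1 :=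
  M.1.vecMulLinear.continuous_of_finiteDimensional

theorem latCount_ball_eq_card (M : SLR m) {n : ℕ} (hn : 0 < n) :
    latCount M (Metric.ball 0 n) = ENNReal.ofReal (Nat.card
      ↑((fun x => vecMul x M.1) ⁻¹' Metric.ball 0 1 ∩
      (n : ℝ)⁻¹ • (Submodule.span ℤ (Set.range (Pi.basisFun ℝ (Fin (m + 1)))) :
        Set (Fin (m + 1) → ℝ)))) := by
  have hn' : (0 : ℝ) < n := by exact_mod_cast hn
  have hinj : Function.Injective fun k : Fin (m + 1) → ℤ => (n : ℝ)⁻¹ • castVec k :=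
    (smul_right_injective _ (inv_ne_zero hn'.ne')).comp castVec_injective
  have hTf : (latIndex M (Metric.ball 0 n)).Finite := finite_castVec_mem M Metric.isBounded_ball
  rw [latCount_eq_encard, latIndex_ball_image M hn, Nat.card_image_of_injective hinj,
    ENNReal.ofReal_natCast, ← hTf.cast_ncard_eq, Nat.card_coe_set_eq]
  rfl

theorem isBounded_preimage_vecMul (M : SLR m) {S : Set (Fin (m + 1) → ℝ)}
    (hS : Bornology.IsBounded S) : Bornology.IsBounded ((fun x => vecMul x M.1) ⁻¹' S) := by
  have h : (fun x => vecMul x M.1) ⁻¹' S ⊆ (fun x => vecMul x M⁻¹.1) '' S := fun x hx =>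
    ⟨_, hx, vecMul_mul_inv _ _⟩
  exact ((M⁻¹.1.vecMulLinear.toContinuousLinearMap.lipschitz).isBounded_image hS).subset h

theorem volume_preimage_vecMul_ball (M : SLR m) :
    volume.real ((fun x => vecMul x M.1) ⁻¹' Metric.ball (0 : Fin (m + 1) → ℝ) 1) =
      2 ^ (m + 1) := by
  rw [measureReal_def, (measurePreserving_vecMul M).measure_preimage
    Metric.isOpen_ball.measurableSet.nullMeasurableSet, Real.volume_pi_ball _ one_pos,
    ENNReal.toReal_ofReal (by positivity)]
  simp

theorem tendsto_latCount_div (M : SLR m) :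
    Filter.Tendsto (fun n : ℕ => latCount M (Metric.ball 0 n) / (n : ℝ≥0∞) ^ (m + 1)) Filter.atTop
      (𝓝 (ENNReal.ofReal (2 ^ (m + 1)))) := by
  have hconv : Convex ℝ ((fun x => vecMul x M.1) ⁻¹' Metric.ball (0 : Fin (m + 1) → ℝ) 1) :=
    (convex_ball _ _).linear_preimage M.1.vecMulLinear
  have h := tendsto_card_div_pow_atTop_volume _
    (isBounded_preimage_vecMul M (Metric.isBounded_ball (x := 0) (r := 1)))
    (Metric.isOpen_ball.preimage (continuous_vecMul_const M)).measurableSet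
    (hconv.addHaar_frontier volume)
  rw [volume_preimage_vecMul_ball] at h
  have h' := (ENNReal.continuous_ofReal.tendsto _).comp h
  refine h'.congr' ?_
  filter_upwards [Filter.eventually_gt_atTop 0] with n hn
  have hn' : (0 : ℝ) < n := by exact_mod_cast hn
  rw [latCount_ball_eq_card M hn, Function.comp_apply, Fintype.card_fin,
    ENNReal.ofReal_div_of_pos (by positivity), ENNReal.ofReal_pow hn'.le, ENNReal.ofReal_natCast,
    ENNReal.ofReal_natCast]

theorem lintegral_latCount_ball (r : ℝ) (hr : 0 < r) :
    ∫⁻ M, latCount M (Metric.ball 0 r) ∂(latticeMeasure (m + 1)) =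
      1 + meanConst m * zetaSum m * ENNReal.ofReal ((2 * r) ^ (m + 2)) := by
  simp_rw [latCount_eq _ _ (Metric.mem_ball_self hr)]
  rw [lintegral_add_left measurable_const, lintegral_one, measure_univ,
    lintegral_tsum_ne_zero (measurable_one.indicator Metric.isOpen_ball.measurableSet),
    lintegral_indicator_one Metric.isOpen_ball.measurableSet, Real.volume_pi_ball _ hr,
    Fintype.card_fin]

/-- The number of lattice points in a ball of radius n, divided by n^d, tends to 2^d for every
lattice. By dominated convergence so does its mean, while the mean value formula gives the limit
(constant · ζ(d)) · 2^d. -/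
theorem meanConst_mul_zetaSum (m : ℕ) : meanConst m * zetaSum m = 1 := by
  have hfin : meanConst m * zetaSum m ≠ ∞ :=
    ENNReal.mul_ne_top (meanConst_ne_top m) (zetaSum_ne_top m)
  have hlim : Filter.Tendsto (fun n : ℕ => ∫⁻ M,
      latCount M (Metric.ball 0 n) / (n : ℝ≥0∞) ^ (m + 2) ∂(latticeMeasure (m + 1))) Filter.atTop
      (𝓝 (∫⁻ _, ENNReal.ofReal (2 ^ (m + 2)) ∂(latticeMeasure (m + 1)))) := by
    refine tendsto_lintegral_filter_of_dominated_convergence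
      (fun M => 2 ^ (m + 2) * latCount M (Metric.ball 0 1)) ?_ ?_ ?_ ?_
    · exact Filter.Eventually.of_forall fun n =>
        (measurable_latCount Metric.isOpen_ball.measurableSet).div_const _
    · filter_upwards [Filter.eventually_gt_atTop 0] with n hn
      refine Filter.Eventually.of_forall fun M => ?_
      have hn' : (n : ℝ≥0∞) ^ (m + 2) ≠ 0 := pow_ne_zero _ (by exact_mod_cast hn.ne')
      have hnt : (n : ℝ≥0∞) ^ (m + 2) ≠ ∞ := ENNReal.pow_ne_top (ENNReal.natCast_ne_top n)
      refine ENNReal.div_le_of_le_mul ((latCount_ball_le M n).trans_eq ?_)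
      rw [mul_pow]
      ring
    · rw [lintegral_const_mul _ (measurable_latCount Metric.isOpen_ball.measurableSet),
        lintegral_latCount_ball 1 one_pos]
      exact ENNReal.mul_ne_top (ENNReal.pow_ne_top ENNReal.ofNat_ne_top)
        (ENNReal.add_ne_top.2 ⟨ENNReal.one_ne_top, ENNReal.mul_ne_top hfin ENNReal.ofReal_ne_top⟩)
    · exact Filter.Eventually.of_forall fun M => tendsto_latCount_div M
  have hlim2 : Filter.Tendsto (fun n : ℕ => ∫⁻ M,
      latCount M (Metric.ball 0 n) / (n : ℝ≥0∞) ^ (m + 2) ∂(latticeMeasure (m + 1))) Filter.atTop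
      (𝓝 (0 + meanConst m * zetaSum m * ENNReal.ofReal (2 ^ (m + 2)))) := by
    have h1 : Filter.Tendsto (fun n : ℕ => ((n : ℝ≥0∞) ^ (m + 2))⁻¹ +
        meanConst m * zetaSum m * ENNReal.ofReal (2 ^ (m + 2))) Filter.atTop
        (𝓝 (0 + meanConst m * zetaSum m * ENNReal.ofReal (2 ^ (m + 2)))) := by
      refine Filter.Tendsto.add ?_ tendsto_const_nhds
      have h2 := ((ENNReal.continuous_pow (m + 2)).tendsto 0).comp
        ENNReal.tendsto_inv_nat_nhds_zero
      rw [zero_pow (by omega)] at h2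
      exact h2.congr fun n => by rw [ENNReal.inv_pow]; rfl
    refine h1.congr' ?_
    filter_upwards [Filter.eventually_gt_atTop 0] with n hn
    have hn0 : (0 : ℝ) < n := by exact_mod_cast hn
    have hn' : (n : ℝ≥0∞) ^ (m + 2) ≠ 0 := pow_ne_zero _ (by exact_mod_cast hn.ne')
    have hnt : (n : ℝ≥0∞) ^ (m + 2) ≠ ∞ := ENNReal.pow_ne_top (ENNReal.natCast_ne_top n)
    simp_rw [div_eq_mul_inv]
    rw [lintegral_mul_const _ (measurable_latCount Metric.isOpen_ball.measurableSet),
      lintegral_latCount_ball _ hn0, mul_pow, ENNReal.ofReal_mul (by positivity),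
      ENNReal.ofReal_pow hn0.le, ENNReal.ofReal_natCast, add_mul, one_mul, mul_assoc, mul_assoc,
      mul_assoc, mul_assoc, ENNReal.mul_inv_cancel hn' hnt, mul_one]
  have heq := tendsto_nhds_unique hlim hlim2
  rw [lintegral_const, measure_univ, mul_one, zero_add] at heq
  have h2 : ENNReal.ofReal ((2 : ℝ) ^ (m + 2)) ≠ 0 := by
    rw [Ne, ENNReal.ofReal_eq_zero]; push Not; positivity
  refine (ENNReal.mul_left_inj h2 ENNReal.ofReal_ne_top).1 ?_
  rw [one_mul, ← heq]

theorem lintegral_tsum_ne_zero_eq {f : (Fin (m + 2) → ℝ) → ℝ≥0∞} (hf : Measurable f) :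
    ∫⁻ M, (∑' k : {k : Fin (m + 2) → ℤ // k ≠ 0}, f (vecMul (castVec k.1) M.1))
      ∂(latticeMeasure (m + 1)) = ∫⁻ y, f y := by
  rw [lintegral_tsum_ne_zero hf, meanConst_mul_zetaSum, one_mul]

theorem toReal_meanConst (m : ℕ) :
    (meanConst m).toReal = 1 / (riemannZeta ((m + 2 : ℕ) : ℂ)).re := by
  have h := congrArg ENNReal.toReal (meanConst_mul_zetaSum m)
  rw [ENNReal.toReal_mul, toReal_zetaSum, ENNReal.toReal_one] at h
  exact eq_one_div_of_mul_eq_one_left h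

end MeanConst

end LatticeUnion

namespace LatticeUnion

open scoped ENNReal NNReal Topology Pointwise
open Matrix (vecMul)

/-! ### Void events and their behaviour for long cylinders -/

section Void

variable {m : ℕ}

/-- The lattice `ℤ^d M` has no point in `S`. -/
def IsVoid (M : SLR m) (S : Set (Fin (m + 1) → ℝ)) : Prop :=
  ∀ k : Fin (m + 1) → ℤ, vecMul (castVec k) M.1 ∉ S

theorem disjoint_affineLattice_iff {M : SLR m} {t : Fin (m + 1) → ℝ}
    {S : Set (Fin (m + 1) → ℝ)} :
    Disjoint (affineLattice m M t) S ↔ ∀ k, vecMul (castVec k + t) M.1 ∉ S := by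
  rw [Set.disjoint_left, affineLattice, Set.forall_mem_range]
  rfl

theorem disjoint_affineLattice_zero_iff {M : SLR m} {S : Set (Fin (m + 1) → ℝ)} :
    Disjoint (affineLattice m M 0) S ↔ IsVoid M S := by
  rw [disjoint_affineLattice_iff]
  simp only [add_zero, IsVoid]

theorem exists_equiv_smul (γ : SLZ m) : ∃ σ : Equiv.Perm (Fin (m + 1) → ℤ),
    ∀ k (M : SLR m), vecMul (castVec k) (γ • M).1 = vecMul (castVec (σ k)) M.1 := by
  obtain ⟨_, g, rfl⟩ := γ
  refine ⟨⟨fun k => vecMul k g.1, fun k => vecMul k g⁻¹.1, fun k => ?_, fun k => ?_⟩, fun k M => ?_⟩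
  · change vecMul (vecMul k g.1) g⁻¹.1 = k
    rw [Matrix.vecMul_vecMul, ← Matrix.SpecialLinearGroup.coe_mul, mul_inv_cancel]
    exact Matrix.vecMul_one k
  · change vecMul (vecMul k g⁻¹.1) g.1 = k
    rw [Matrix.vecMul_vecMul, ← Matrix.SpecialLinearGroup.coe_mul, inv_mul_cancel]
    exact Matrix.vecMul_one k
  · rw [Subgroup.smul_def, smul_eq_mul, vecMul_mul]
    congr 1
    ext j
    simp [castVec, Matrix.vecMul, dotProduct]

theorem isVoid_smul_iff (γ : SLZ m) {M : SLR m} {S : Set (Fin (m + 1) → ℝ)} :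
    IsVoid (γ • M) S ↔ IsVoid M S := by
  obtain ⟨σ, hσ⟩ := exists_equiv_smul γ
  simp only [IsVoid, hσ]
  exact σ.forall_congr_left.trans (by simp)

theorem isVoid_mul_iff {M g : SLR m} {S : Set (Fin (m + 1) → ℝ)} :
    IsVoid (M * g) S ↔ IsVoid M ((fun x => vecMul x g.1) ⁻¹' S) := by
  simp only [IsVoid, vecMul_mul, Set.mem_preimage]

theorem IsVoid.mono {M : SLR m} {S T : Set (Fin (m + 1) → ℝ)} (h : IsVoid M T) (hST : S ⊆ T) :
    IsVoid M S := fun k hk => h k (hST hk)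

theorem measurable_vecMul_comp {X : Type*} [MeasurableSpace X] {f : X → SLR m}
    {v : X → Fin (m + 1) → ℝ} (hf : Measurable f) (hv : Measurable v) :
    Measurable fun x => vecMul (v x) (f x).1 := by
  refine measurable_pi_lambda _ fun j => ?_
  simp only [Matrix.vecMul, dotProduct]
  exact Finset.measurable_sum _ fun i _ =>
    ((measurable_pi_apply i).comp hv).mul (measurable_SLR_iff.1 hf i j)

theorem measurableSet_isVoid {X : Type*} [MeasurableSpace X] {f : X → SLR m}
    {S : X → Set (Fin (m + 1) → ℝ)} (hf : Measurable f)
    (hS : MeasurableSet {p : X × (Fin (m + 1) → ℝ) | p.2 ∈ S p.1}) :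
    MeasurableSet {x | IsVoid (f x) (S x)} := by
  have : {x | IsVoid (f x) (S x)} = ⋂ k : Fin (m + 1) → ℤ,
      {x | (x, vecMul (castVec k) (f x).1) ∈ {p : X × (Fin (m + 1) → ℝ) | p.2 ∈ S p.1}}ᶜ := by
    ext x
    simp [IsVoid]
  rw [this]
  exact MeasurableSet.iInter fun k => (measurableSet_preimage
    (measurable_id.prodMk (measurable_vecMul_comp hf measurable_const)) hS).compl

theorem measurableSet_isVoid_const {S : Set (Fin (m + 1) → ℝ)} (hS : MeasurableSet S) :
    MeasurableSet {M : SLR m | IsVoid M S} :=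
  measurableSet_isVoid measurable_id (hS.preimage measurable_snd)

/-- Invariant functions have the same mean over a random lattice and its image under a fixed
element of the group. -/
theorem lintegral_latticeMeasure_mul_right {f : SLR m → ℝ≥0∞}
    (hf : ∀ (γ : SLZ m) M, f (γ • M) = f M) (g : SLR m) :
    ∫⁻ M, f (M * g) ∂(latticeMeasure m) = ∫⁻ M, f M ∂(latticeMeasure m) := by
  have hF := isFundamentalDomain_fundamentalDomain m
  have hpres := measurePreserving_mul_right (Measure.haar : Measure (SLR m)) g⁻¹
  -- Left and right multiplication commute, so a right translate of a fundamental domain is again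
  -- one, and integrals of invariant functions agree on both.
  have hF' : IsFundamentalDomain (SLZ m) ((fun x : SLR m => x * g⁻¹) ⁻¹' fundamentalDomain m)
      (Measure.haar : Measure (SLR m)) :=
    hF.preimage_of_equiv hpres.quasiMeasurePreserving (e := id) Function.bijective_id
      fun γ x => by simp only [id, Subgroup.smul_def, smul_eq_mul, mul_assoc]
  rw [lintegral_latticeMeasure, lintegral_latticeMeasure, hF.setLIntegral_eq hF' f hf]
  congr 1
  have h := (measurePreserving_mul_right (Measure.haar : Measure (SLR m)) g).setLIntegral_comp_preimage_emb
    (measurableEmbedding_mulRight g) f ((fun x : SLR m => x * g⁻¹) ⁻¹' fundamentalDomain m)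
  rw [← h, Set.preimage_preimage]
  simp only [mul_inv_cancel_right, Set.preimage_id']

theorem latticeMeasure_isVoid_preimage {S : Set (Fin (m + 1) → ℝ)} (hS : MeasurableSet S)
    (g : SLR m) : latticeMeasure m {M | IsVoid M ((fun x => vecMul x g.1) ⁻¹' S)} =
      latticeMeasure m {M | IsVoid M S} := by
  have hm := measurableSet_isVoid_const hS
  have h := lintegral_latticeMeasure_mul_right (f := {M | IsVoid M S}.indicator 1)
    (fun γ M => by
      classical
      simp only [Set.indicator_apply, Set.mem_ofPred_eq, isVoid_smul_iff, Pi.one_apply]) g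
  rw [lintegral_indicator_one hm] at h
  rw [← h, ← lintegral_indicator_one (measurableSet_isVoid_const
    (hS.preimage (continuous_vecMul_const g).measurable))]
  refine lintegral_congr fun M => ?_
  classical
  simp only [Set.indicator_apply, Set.mem_ofPred_eq, isVoid_mul_iff, Pi.one_apply]

/-- The cylinder of length `a` and radius `r` around the axis of the first coordinate. -/
def tube (m : ℕ) (a r : ℝ) : Set (Fin (m + 1) → ℝ) :=
  {x | 0 < x 0 ∧ x 0 < a ∧ ‖WithLp.toLp 2 (Fin.tail x)‖ < r}

theorem continuous_tail : Continuous fun x : Fin (m + 1) → ℝ => WithLp.toLp 2 (Fin.tail x) :=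
  (PiLp.continuous_toLp 2 _).comp (continuous_pi fun i => continuous_apply i.succ)

theorem isOpen_tube (a r : ℝ) : IsOpen (tube m a r) :=
  (isOpen_lt continuous_const (continuous_apply 0)).inter
    ((isOpen_lt (continuous_apply 0) continuous_const).inter
      (isOpen_lt continuous_tail.norm continuous_const))

theorem tube_mono {a b r s : ℝ} (hab : a ≤ b) (hrs : r ≤ s) : tube m a r ⊆ tube m b s :=
  fun _ hx => ⟨hx.1, hx.2.1.trans_le hab, hx.2.2.trans_le hrs⟩

theorem cylinder_zero (ξ : ℝ) : cylinder m ξ 0 = tube m ξ 1 := by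
  simp [cylinder, tube]

theorem tube_subset_cylinder (ξ : ℝ) (z : EuclideanSpace ℝ (Fin m)) :
    tube m ξ (1 - ‖z‖) ⊆ cylinder m ξ z := fun x hx =>
  ⟨hx.1, hx.2.1, by linarith [norm_sub_le (WithLp.toLp 2 (Fin.tail x)) z, hx.2.2]⟩

theorem cylinder_mono {ξ η : ℝ} (h : ξ ≤ η) (z : EuclideanSpace ℝ (Fin m)) :
    cylinder m ξ z ⊆ cylinder m η z := fun _ hx => ⟨hx.1, hx.2.1.trans_le h, hx.2.2⟩

/-- The diagonal matrix with entries `n^(d-1), 1/n, …, 1/n`. -/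
noncomputable def scaleMat (m : ℕ) (n : ℕ) : SLR (m + 1) :=
  -- The scaling factor is n + 1 rather than n, which keeps it invertible at n = 0.
  mkSLR (Matrix.diagonal (Fin.cons (((n : ℝ) + 1) ^ (m + 1)) fun _ => ((n : ℝ) + 1)⁻¹)) <| by
    rw [Matrix.det_diagonal, Fin.prod_univ_succ]
    simp only [Fin.cons_zero, Fin.cons_succ, Finset.prod_const, Finset.card_univ, Fintype.card_fin]
    rw [← mul_pow, mul_inv_cancel₀ (by positivity), one_pow]

/-- A long cylinder of fixed radius is equivalent to one that grows in all directions; the latter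
exhaust the half-space x_1 > 0. -/
theorem preimage_scaleMat_tube (n : ℕ) (r : ℝ) :
    (fun x => vecMul x (scaleMat m n).1) ⁻¹' tube (m + 1) (((n : ℝ) + 1) ^ (2 * (m + 1))) r =
      tube (m + 1) (((n : ℝ) + 1) ^ (m + 1)) (((n : ℝ) + 1) * r) := by
  have hn : (0 : ℝ) < (n : ℝ) + 1 := by positivity
  ext x
  have h0 : vecMul x (scaleMat m n).1 0 = x 0 * ((n : ℝ) + 1) ^ (m + 1) := by
    rw [scaleMat, mkSLR_val, Matrix.vecMul_diagonal, Fin.cons_zero]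
  have h1 : WithLp.toLp 2 (Fin.tail (vecMul x (scaleMat m n).1)) =
      ((n : ℝ) + 1)⁻¹ • WithLp.toLp 2 (Fin.tail x) := by
    ext i
    change vecMul x (scaleMat m n).1 i.succ = ((n : ℝ) + 1)⁻¹ * x i.succ
    rw [scaleMat, mkSLR_val, Matrix.vecMul_diagonal, Fin.cons_succ, mul_comm]
  have hp : (0 : ℝ) < ((n : ℝ) + 1) ^ (m + 1) := by positivity
  rw [Set.mem_preimage, tube, tube, Set.mem_ofPred_eq, Set.mem_ofPred_eq, h0, h1, norm_smul,
    norm_inv, Real.norm_of_nonneg hn.le, inv_mul_lt_iff₀ hn, two_mul,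
    pow_add _ (m + 1) (m + 1),
    mul_lt_mul_iff_left₀ hp, mul_pos_iff_of_pos_right hp]

theorem exists_pos_zero (M : SLR m) : ∃ k : Fin (m + 1) → ℤ, 0 < vecMul (castVec k) M.1 0 := by
  by_contra! h
  have h0 : ∀ i, M.1 i 0 = 0 := fun i => by
    have hi : vecMul (castVec (Pi.single i 1)) M.1 0 = M.1 i 0 := by
      have : castVec (Pi.single i (1 : ℤ)) = Pi.single i (1 : ℝ) := by
        ext j
        by_cases hj : j = i <;> simp [castVec, hj]
      rw [this, Matrix.single_one_vecMul]
      rfl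
    have h1 := h (Pi.single i 1)
    have h2 := h (-Pi.single i 1)
    rw [castVec_neg, Matrix.neg_vecMul, Pi.neg_apply, hi] at h2
    rw [hi] at h1
    linarith
  have hdet : M.1.det = 0 := Matrix.det_eq_zero_of_column_eq_zero 0 h0
  have := M.2
  rw [hdet] at this
  exact zero_ne_one this

theorem exists_mem_tube (M : SLR (m + 1)) (t : Fin (m + 2) → ℝ) {r : ℝ} (hr : 0 < r) :
    ∃ (n : ℕ) (k : Fin (m + 2) → ℤ), vecMul (castVec k + t) M.1 ∈
      tube (m + 1) (((n : ℝ) + 1) ^ (m + 1)) (((n : ℝ) + 1) * r) := by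
  obtain ⟨k, hk⟩ := exists_pos_zero M
  obtain ⟨j, hj⟩ := Archimedean.arch (1 - vecMul t M.1 0) hk
  set y := vecMul (castVec ((j : ℤ) • k) + t) M.1 with hy
  have hy0 : 0 < y 0 := by
    rw [hy, Matrix.add_vecMul, castVec_smul, Matrix.smul_vecMul, Pi.add_apply, Pi.smul_apply,
      smul_eq_mul]
    rw [nsmul_eq_mul] at hj
    linarith
  obtain ⟨n, hn⟩ := exists_nat_gt (max (y 0) (‖WithLp.toLp 2 (Fin.tail y)‖ / r))
  refine ⟨n, (j : ℤ) • k, hy0, ?_, ?_⟩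
  · calc y 0 < n := (le_max_left _ _).trans_lt hn
      _ ≤ n + 1 := by linarith
      _ ≤ ((n : ℝ) + 1) ^ (m + 1) := le_self_pow₀ (by linarith [n.cast_nonneg (α := ℝ)]) (by omega)
  · have h1 := (le_max_right _ _).trans_lt hn
    rw [div_lt_iff₀ hr] at h1
    nlinarith

/-- The growing tubes exhaust a half-space, which every affine lattice meets (`exists_mem_tube`), so
the avoidance events decrease to the empty set. Both the centred and the affine case are covered
through `t`. -/
theorem tendsto_measure_avoid_tube {X : Type*} [MeasurableSpace X] (μ : Measure X)
    [IsFiniteMeasure μ] {f : X → SLR (m + 1)} {t : X → Fin (m + 2) → ℝ} (hf : Measurable f)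
    (ht : Measurable t) {r : ℝ} (hr : 0 < r) :
    Filter.Tendsto (fun n : ℕ => μ {x | ∀ k : Fin (m + 2) → ℤ, vecMul (castVec k + t x) (f x).1 ∉
      tube (m + 1) (((n : ℝ) + 1) ^ (m + 1)) (((n : ℝ) + 1) * r)}) Filter.atTop (𝓝 0) := by
  set A : ℕ → Set X := fun n => {x | ∀ k : Fin (m + 2) → ℤ, vecMul (castVec k + t x) (f x).1 ∉
      tube (m + 1) (((n : ℝ) + 1) ^ (m + 1)) (((n : ℝ) + 1) * r)} with hA
  have hmeas : ∀ n, MeasurableSet (A n) := fun n => by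
    simp only [hA, Set.ofPred_forall]
    exact MeasurableSet.iInter fun k => (((isOpen_tube _ _).measurableSet).preimage
      (measurable_vecMul_comp hf (ht.const_add _))).compl
  have hanti : Antitone A := fun a b hab x hx k hk => hx k <| tube_mono (by gcongr) (by gcongr) hk
  have hempty : ⋂ n, A n = ∅ := by
    refine Set.eq_empty_of_forall_notMem fun x hx => ?_
    obtain ⟨n, k, hk⟩ := exists_mem_tube (f x) (t x) hr
    exact Set.mem_iInter.1 hx n k hk
  have h := tendsto_measure_iInter_atTop (μ := μ) (fun n => (hmeas n).nullMeasurableSet) hanti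
    ⟨0, measure_ne_top _ _⟩
  rwa [hempty, measure_empty] at h

theorem measurableSet_cylinder (ξ : ℝ) (z : EuclideanSpace ℝ (Fin m)) :
    MeasurableSet (cylinder m ξ z) :=
  ((isOpen_lt continuous_const (continuous_apply 0)).inter
    ((isOpen_lt (continuous_apply 0) continuous_const).inter
      (isOpen_lt (continuous_tail.sub continuous_const).norm continuous_const))).measurableSet

theorem voidProb₀_eq (z : EuclideanSpace ℝ (Fin m)) (ξ : ℝ) :
    voidProb₀ m z ξ = (latticeMeasure m).real {M | IsVoid M (cylinder m ξ z)} := by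
  simp only [voidProb₀, disjoint_affineLattice_zero_iff]

theorem antitone_voidProb₀ (z : EuclideanSpace ℝ (Fin m)) : Antitone (voidProb₀ m z) := by
  intro a b hab
  rw [voidProb₀_eq, voidProb₀_eq]
  exact measureReal_mono fun M hM => IsVoid.mono hM (cylinder_mono hab z)

theorem tendsto_atTop_zero_of_antitone {f : ℝ → ℝ} (hf : Antitone f) (h0 : ∀ x, 0 ≤ f x)
    {u : ℕ → ℝ} (h : Filter.Tendsto (fun n => f (u n)) Filter.atTop (𝓝 0)) :
    Filter.Tendsto f Filter.atTop (𝓝 0) := by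
  rw [Metric.tendsto_atTop] at h ⊢
  intro ε hε
  obtain ⟨n, hn⟩ := h ε hε
  refine ⟨u n, fun x hx => ?_⟩
  have h1 := hn n le_rfl
  rw [Real.dist_0_eq_abs, abs_of_nonneg (h0 _)] at h1 ⊢
  exact (hf hx).trans_lt h1

/-- Since ‖z‖ < 1 the cylinder contains a tube of radius 1 - ‖z‖ about the axis through the origin.
The limit 0 identifies the tail integral of Φ₀ with the void probability. -/
theorem tendsto_voidProb₀ {z : EuclideanSpace ℝ (Fin (m + 1))} (hz : ‖z‖ < 1) :
    Filter.Tendsto (voidProb₀ (m + 1) z) Filter.atTop (𝓝 0) := by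
  have hr : 0 < 1 - ‖z‖ := by linarith
  refine tendsto_atTop_zero_of_antitone (antitone_voidProb₀ z) (fun _ => measureReal_nonneg)
    (u := fun n : ℕ => ((n : ℝ) + 1) ^ (2 * (m + 1))) ?_
  have h := tendsto_measure_avoid_tube (latticeMeasure (m + 1)) (f := id) (t := fun _ => 0)
    measurable_id measurable_const hr
  have h' := (ENNReal.tendsto_toReal ENNReal.zero_ne_top).comp h
  refine squeeze_zero (fun _ => measureReal_nonneg) (fun n => ?_) h'
  rw [voidProb₀_eq]
  have h1 : (latticeMeasure (m + 1)).real {M | IsVoid M (cylinder (m + 1)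
      (((n : ℝ) + 1) ^ (2 * (m + 1))) z)} ≤ (latticeMeasure (m + 1)).real
        {M | IsVoid M (tube (m + 1) (((n : ℝ) + 1) ^ (2 * (m + 1))) (1 - ‖z‖))} :=
    measureReal_mono fun M hM => IsVoid.mono hM (tube_subset_cylinder _ z)
  refine h1.trans_eq ?_
  rw [measureReal_def, ← latticeMeasure_isVoid_preimage (isOpen_tube _ _).measurableSet
    (scaleMat m n), preimage_scaleMat_tube]
  simp only [Function.comp_apply, add_zero, id, IsVoid]

end Void

end LatticeUnion

namespace LatticeUnion

open scoped ENNReal NNReal Topology Pointwise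
open Matrix (vecMul)

/-! ### Generic initial points -/

section Palm

variable {m : ℕ}

/-- Unfolding for ℤⁿ in ℝⁿ: every point has exactly one integer translate in the cube. -/
theorem lintegral_unitCube_tsum {n : ℕ} {f : (Fin n → ℝ) → ℝ≥0∞} (hf : Measurable f) :
    ∫⁻ t in unitCube n, ∑' k : Fin n → ℤ, f (castVec k + t) = ∫⁻ t, f t := by
  have hadd : ∀ k : Fin n → ℤ, Measurable fun t : Fin n → ℝ => castVec k + t := fun k =>
    measurable_const_add _
  have hind : Measurable ((unitCube n).indicator (1 : (Fin n → ℝ) → ℝ≥0∞)) :=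
    measurable_one.indicator (measurableSet_unitCube n)
  have h1 : ∀ k : Fin n → ℤ, ∫⁻ t in unitCube n, f (castVec k + t) =
      ∫⁻ t, (unitCube n).indicator 1 (castVec (-k) + t) * f t := by
    intro k
    rw [← lintegral_indicator (measurableSet_unitCube n),
      ← lintegral_add_left_eq_self (fun t => (unitCube n).indicator 1 (castVec (-k) + t) * f t)
        (castVec k)]
    refine lintegral_congr fun t => ?_
    have h2 : castVec (-k) + (castVec k + t) = t := by
      rw [castVec_neg, neg_add_cancel_left]
    simp only [h2]
    by_cases ht : t ∈ unitCube n <;> simp [ht]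
  rw [lintegral_tsum (f := fun k t => f (castVec k + t)) fun k => (hf.comp (hadd k)).aemeasurable]
  simp_rw [h1]
  rw [← lintegral_tsum (f := fun k t => (unitCube n).indicator 1 (castVec (-k) + t) * f t)
    fun k => ((hind.comp (hadd _)).mul hf).aemeasurable]
  refine lintegral_congr fun t => ?_
  have h3 : ∑' k : Fin n → ℤ, (unitCube n).indicator (1 : (Fin n → ℝ) → ℝ≥0∞) (castVec (-k) + t) =
      ∑' k : Fin n → ℤ, (unitCube n).indicator 1 (castVec k + t) := (Equiv.neg _).tsum_eq
    (fun k => (unitCube n).indicator (1 : (Fin n → ℝ) → ℝ≥0∞) (castVec k + t))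
  rw [ENNReal.tsum_mul_right, h3]
  obtain ⟨k, hk, huniq⟩ := existsUnique_castVec_add_mem t
  rw [tsum_eq_single k fun l hl => Set.indicator_of_notMem (fun h => hl (huniq l h)) _,
    Set.indicator_of_mem hk, Pi.one_apply, one_mul]

/-- The points of `S` whose translates by the lattice vectors pointing downwards avoid `S`. -/
def lowestSet (M : SLR m) (S : Set (Fin (m + 1) → ℝ)) : Set (Fin (m + 1) → ℝ) :=
  {x ∈ S | ∀ k : Fin (m + 1) → ℤ, vecMul (castVec k) M.1 0 < 0 → x + vecMul (castVec k) M.1 ∉ S}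

theorem measurableSet_lowestSet {S : Set (Fin (m + 1) → ℝ)} (hS : MeasurableSet S) :
    MeasurableSet {p : SLR m × (Fin (m + 1) → ℝ) | p.2 ∈ lowestSet p.1 S} := by
  have : {p : SLR m × (Fin (m + 1) → ℝ) | p.2 ∈ lowestSet p.1 S} = {p | p.2 ∈ S} ∩
      ⋂ k : Fin (m + 1) → ℤ, ({p | vecMul (castVec k) p.1.1 0 < 0} ∩
        {p | p.2 + vecMul (castVec k) p.1.1 ∈ S})ᶜ := by
    ext p
    simp [lowestSet]
  rw [this]
  have hk : ∀ k : Fin (m + 1) → ℤ, Measurable fun p : SLR m × (Fin (m + 1) → ℝ) =>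
      vecMul (castVec k) p.1.1 := fun k => (measurable_vecMul_prod _).comp measurable_fst
  refine (hS.preimage measurable_snd).inter (MeasurableSet.iInter fun k => MeasurableSet.compl ?_)
  exact (measurableSet_lt ((measurable_pi_apply 0).comp (hk k)) measurable_const).inter
    (hS.preimage (measurable_snd.add (hk k)))

/-- No nonzero point of the lattice `ℤ^d M` lies in the hyperplane `x_1 = 0`. -/
def IsGeneric (M : SLR m) : Prop := ∀ k : Fin (m + 1) → ℤ, k ≠ 0 → vecMul (castVec k) M.1 0 ≠ 0

/-- By the mean value formula, the expected number of nonzero lattice points in the hyperplane is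
its volume, which is 0. -/
theorem ae_isGeneric : ∀ᵐ M ∂(latticeMeasure (m + 1)), IsGeneric M := by
  have h0 : ∀ᵐ y : Fin (m + 2) → ℝ, y 0 ≠ 0 := Measure.ae_eval_ne (fun _ => volume) 0 0
  have hm : MeasurableSet {y : Fin (m + 2) → ℝ | y 0 = 0} :=
    (measurableSet_singleton (0 : ℝ)).preimage (measurable_pi_apply (0 : Fin (m + 2)))
  have hf : Measurable ({y : Fin (m + 2) → ℝ | y 0 = 0}.indicator
      (1 : (Fin (m + 2) → ℝ) → ℝ≥0∞)) := measurable_one.indicator hm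
  have h := lintegral_tsum_ne_zero_eq hf
  rw [lintegral_indicator_one hm, show volume {y : Fin (m + 2) → ℝ | y 0 = 0} = 0 by
    simpa [ae_iff] using h0] at h
  have hmeas : Measurable fun M : SLR (m + 1) => ∑' k : {k : Fin (m + 2) → ℤ // k ≠ 0},
      {y : Fin (m + 2) → ℝ | y 0 = 0}.indicator (1 : (Fin (m + 2) → ℝ) → ℝ≥0∞)
        (vecMul (castVec k.1) M.1) :=
    Measurable.tsum fun k => hf.comp (measurable_vecMul_prod _)
  replace h := (lintegral_eq_zero_iff hmeas).1 h
  filter_upwards [h] with M hM k hk hk0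
  have h1 := ENNReal.tsum_eq_zero.1 hM ⟨k, hk⟩
  rw [Set.indicator_of_mem (s := {y : Fin (m + 2) → ℝ | y 0 = 0}) hk0] at h1
  exact one_ne_zero h1

theorem exists_lowest {M : SLR m} {S : Set (Fin (m + 1) → ℝ)}
    (hS : Bornology.IsBounded S) (t : Fin (m + 1) → ℝ)
    (h : ∃ k : Fin (m + 1) → ℤ, vecMul (castVec k + t) M.1 ∈ S) :
    ∃ k : Fin (m + 1) → ℤ, vecMul (castVec k + t) M.1 ∈ S ∧ ∀ l : Fin (m + 1) → ℤ,
      vecMul (castVec l + t) M.1 ∈ S → vecMul (castVec k) M.1 0 ≤ vecMul (castVec l) M.1 0 := by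
  have hfin : {k : Fin (m + 1) → ℤ | vecMul (castVec k + t) M.1 ∈ S}.Finite := by
    have hb : Bornology.IsBounded ((fun x => x + vecMul t M.1) ⁻¹' S) :=
      (IsometryEquiv.addRight (vecMul t M.1)).isometry.antilipschitz.isBounded_preimage hS
    refine (finite_castVec_mem M hb).subset fun k hk => ?_
    simpa [Matrix.add_vecMul] using hk
  exact Set.exists_min_image _ (fun k => vecMul (castVec k) M.1 0) hfin h

/-- If the translated lattice meets S, boundedness provides a lowest point in S, and genericity
makes it unique, since two points of equal height would differ by a lattice vector in the
hyperplane. -/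
theorem tsum_indicator_lowestSet {M : SLR m} (hM : IsGeneric M) {S : Set (Fin (m + 1) → ℝ)}
    (hS : Bornology.IsBounded S) (t : Fin (m + 1) → ℝ) :
    ∑' k : Fin (m + 1) → ℤ, (lowestSet M S).indicator (1 : (Fin (m + 1) → ℝ) → ℝ≥0∞)
      (vecMul (castVec k + t) M.1) =
    {t : Fin (m + 1) → ℝ | ∀ k : Fin (m + 1) → ℤ, vecMul (castVec k + t) M.1 ∉ S}ᶜ.indicator 1 t := by
  by_cases h : ∃ k : Fin (m + 1) → ℤ, vecMul (castVec k + t) M.1 ∈ S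
  · rw [Set.indicator_of_mem (by simpa using h), Pi.one_apply]
    obtain ⟨k, hk, hmin⟩ := exists_lowest hS t h
    have hdiff : ∀ i j : Fin (m + 1) → ℤ, vecMul (castVec i + t) M.1 =
        vecMul (castVec j + t) M.1 + vecMul (castVec (i - j)) M.1 := fun i j => by
      rw [← Matrix.add_vecMul, castVec_sub]
      congr 1
      abel
    have hsub : ∀ i j : Fin (m + 1) → ℤ, vecMul (castVec (i - j)) M.1 0 =
        vecMul (castVec i) M.1 0 - vecMul (castVec j) M.1 0 := fun i j => by
      rw [castVec_sub, Matrix.sub_vecMul, Pi.sub_apply]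
    rw [tsum_eq_single k, Set.indicator_of_mem, Pi.one_apply]
    · refine ⟨hk, fun l hl hmem => ?_⟩
      have h1 := hmin (k + l) (by rwa [hdiff (k + l) k, add_sub_cancel_left])
      rw [castVec_add, Matrix.add_vecMul, Pi.add_apply] at h1
      linarith
    · intro l hlk
      refine Set.indicator_of_notMem (fun hl => ?_) _
      have h1 := hmin l hl.1
      have h2 := hM (k - l) (sub_ne_zero.2 (Ne.symm hlk))
      have h3 : vecMul (castVec (k - l)) M.1 0 < 0 := by
        refine lt_of_le_of_ne ?_ h2
        rw [hsub]
        linarith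
      exact hl.2 (k - l) h3 (by rwa [← hdiff])
  · rw [Set.indicator_of_notMem (by simpa using h), ENNReal.tsum_eq_zero]
    intro k
    exact Set.indicator_of_notMem (fun hk => h ⟨k, hk.1⟩) _

/-- The proportion of translates of a generic lattice that meet `S`. -/
theorem volume_unitCube_inter_compl {M : SLR m} (hM : IsGeneric M) {S : Set (Fin (m + 1) → ℝ)}
    (hS : Bornology.IsBounded S) (hSm : MeasurableSet S) :
    volume (unitCube (m + 1) ∩
      {t | ∀ k : Fin (m + 1) → ℤ, vecMul (castVec k + t) M.1 ∉ S}ᶜ) =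
      volume (lowestSet M S) := by
  have hlow : MeasurableSet (lowestSet M S) :=
    (measurableSet_lowestSet hSm).preimage measurable_prodMk_left
  have hind : Measurable ((lowestSet M S).indicator (1 : (Fin (m + 1) → ℝ) → ℝ≥0∞)) :=
    measurable_one.indicator hlow
  have hA : MeasurableSet {t | ∀ k : Fin (m + 1) → ℤ, vecMul (castVec k + t) M.1 ∉ S} := by
    simp only [Set.ofPred_forall]
    exact MeasurableSet.iInter fun k => (hSm.preimage ((continuous_vecMul_const M).measurable.comp
      (measurable_const_add _))).compl
  have h1 := lintegral_unitCube_tsum (hind.comp (continuous_vecMul_const M).measurable)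
  simp only [Function.comp_apply, tsum_indicator_lowestSet hM hS] at h1
  rw [lintegral_indicator_one hA.compl, Measure.restrict_apply hA.compl,
    (measurePreserving_vecMul M).lintegral_comp hind, lintegral_indicator_one hlow] at h1
  rw [Set.inter_comm, h1]

end Palm

end LatticeUnion

namespace LatticeUnion

open scoped ENNReal NNReal Topology Pointwise
open Matrix (vecMul)

/-! ### The void probability of a random affine lattice -/

section Affine

variable {m : ℕ}

instance instIsProbabilityMeasureUnitCube (n : ℕ) :
    IsProbabilityMeasure ((volume : Measure (Fin n → ℝ)).restrict (unitCube n)) :=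
  ⟨by rw [Measure.restrict_apply_univ, volume_unitCube]⟩

theorem affineLatticeMeasure_eq (m : ℕ) :
    affineLatticeMeasure m = (latticeMeasure m).prod (volume.restrict (unitCube (m + 1))) := rfl

instance instIsProbabilityMeasureAffine (m : ℕ) : IsProbabilityMeasure (affineLatticeMeasure m) := by
  rw [affineLatticeMeasure_eq]
  infer_instance

theorem measurableSet_disjoint_affineLattice {S : Set (Fin (m + 1) → ℝ)} (hS : MeasurableSet S) :
    MeasurableSet {p : SLR m × (Fin (m + 1) → ℝ) | Disjoint (affineLattice m p.1 p.2) S} := by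
  simp only [disjoint_affineLattice_iff, Set.ofPred_forall]
  exact MeasurableSet.iInter fun k => (hS.preimage
    (measurable_vecMul_comp measurable_fst (measurable_snd.const_add _))).compl

theorem affineLatticeMeasure_compl {S : Set (Fin (m + 2) → ℝ)} (hS : Bornology.IsBounded S)
    (hSm : MeasurableSet S) :
    affineLatticeMeasure (m + 1) {p | Disjoint (affineLattice (m + 1) p.1 p.2) S}ᶜ =
      ∫⁻ M, volume (lowestSet M S) ∂(latticeMeasure (m + 1)) := by
  have hm := (measurableSet_disjoint_affineLattice hSm).compl
  rw [affineLatticeMeasure_eq, Measure.prod_apply hm]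
  refine lintegral_congr_ae ?_
  filter_upwards [ae_isGeneric] with M hM
  rw [Measure.restrict_apply (hm.preimage measurable_prodMk_left), Set.inter_comm,
    ← volume_unitCube_inter_compl hM hS hSm]
  congr 2
  ext t
  simp [disjoint_affineLattice_iff]

theorem lowestSet_smul (γ : SLZ m) (M : SLR m) (S : Set (Fin (m + 1) → ℝ)) :
    lowestSet (γ • M) S = lowestSet M S := by
  obtain ⟨σ, hσ⟩ := exists_equiv_smul γ
  ext x
  simp only [lowestSet, hσ]
  refine and_congr_right fun _ => ?_
  exact σ.forall_congr_left.trans (by simp)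

theorem volume_lowestSet_mul {g : SLR m} {c : ℝ} (hc : 0 < c)
    (hg : ∀ x : Fin (m + 1) → ℝ, vecMul x g.1 0 = x 0 * c) (M : SLR m)
    {S : Set (Fin (m + 1) → ℝ)} (hS : MeasurableSet S) :
    volume (lowestSet (M * g) S) = volume (lowestSet M ((fun x => vecMul x g.1) ⁻¹' S)) := by
  have hlow : MeasurableSet (lowestSet (M * g) S) :=
    (measurableSet_lowestSet hS).preimage measurable_prodMk_left
  rw [← (measurePreserving_vecMul g).measure_preimage hlow.nullMeasurableSet]
  congr 1
  ext x
  simp only [lowestSet, Set.mem_preimage, Set.mem_ofPred_eq, vecMul_mul, hg, Matrix.add_vecMul]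
  refine and_congr_right fun _ => forall_congr' fun k => imp_congr_left ?_
  exact ⟨fun h => by nlinarith, fun h => mul_neg_of_neg_of_pos h hc⟩

theorem vecMul_scaleMat_zero (n : ℕ) (x : Fin (m + 2) → ℝ) :
    vecMul x (scaleMat m n).1 0 = x 0 * ((n : ℝ) + 1) ^ (m + 1) := by
  rw [scaleMat, mkSLR_val, Matrix.vecMul_diagonal, Fin.cons_zero]

theorem isBounded_tube (a r : ℝ) : Bornology.IsBounded (tube m a r) := by
  refine (Metric.isBounded_closedBall (x := (0 : Fin (m + 1) → ℝ)) (r := max a r)).subset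
    fun x hx => ?_
  rw [mem_closedBall_zero_iff, pi_norm_le_iff_of_nonneg (le_max_of_le_left (hx.1.trans hx.2.1).le)]
  refine Fin.cases ?_ fun i => ?_
  · rw [Real.norm_of_nonneg hx.1.le]
    exact le_max_of_le_left hx.2.1.le
  · exact le_max_of_le_right ((PiLp.norm_apply_le (WithLp.toLp 2 (Fin.tail x)) i).trans hx.2.2.le)

/-- For fixed t the void event is not determined by the lattice ℤ^d M alone. Averaging over t
replaces it by the volume of `lowestSet`, an SL(d, ℤ)-invariant function of M, to which invariance
under `scaleMat` applies. -/
theorem affineLatticeMeasure_tube (n : ℕ) (r : ℝ) :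
    affineLatticeMeasure (m + 1) {p | Disjoint (affineLattice (m + 1) p.1 p.2)
      (tube (m + 1) (((n : ℝ) + 1) ^ (2 * (m + 1))) r)} =
    affineLatticeMeasure (m + 1) {p | Disjoint (affineLattice (m + 1) p.1 p.2)
      (tube (m + 1) (((n : ℝ) + 1) ^ (m + 1)) (((n : ℝ) + 1) * r))} := by
  have hT : ∀ a r : ℝ, MeasurableSet (tube (m + 1) a r) := fun a r => (isOpen_tube a r).measurableSet
  have h1 : ∀ a r : ℝ, affineLatticeMeasure (m + 1) {p | Disjoint (affineLattice (m + 1) p.1 p.2)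
      (tube (m + 1) a r)} = 1 - ∫⁻ M, volume (lowestSet M (tube (m + 1) a r))
        ∂(latticeMeasure (m + 1)) := fun a r => by
    rw [← affineLatticeMeasure_compl (isBounded_tube a r) (hT a r),
      ← prob_compl_eq_one_sub (measurableSet_disjoint_affineLattice (hT a r)).compl, compl_compl]
  rw [h1, h1, ← preimage_scaleMat_tube]
  have h2 := lintegral_latticeMeasure_mul_right
    (f := fun M => volume (lowestSet M (tube (m + 1) (((n : ℝ) + 1) ^ (2 * (m + 1))) r)))
    (fun γ M => by rw [lowestSet_smul]) (scaleMat m n)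
  rw [← h2]
  simp_rw [volume_lowestSet_mul (by positivity : (0 : ℝ) < ((n : ℝ) + 1) ^ (m + 1))
    (vecMul_scaleMat_zero n) _ (hT _ _)]

theorem antitone_voidProb : Antitone (voidProb m) := by
  intro a b hab
  exact measureReal_mono fun p hp => Set.disjoint_of_subset_right (cylinder_mono hab 0) hp

theorem tendsto_voidProb :
    Filter.Tendsto (voidProb (m + 1)) Filter.atTop (𝓝 0) := by
  refine tendsto_atTop_zero_of_antitone antitone_voidProb (fun _ => measureReal_nonneg)
    (u := fun n : ℕ => ((n : ℝ) + 1) ^ (2 * (m + 1))) ?_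
  have h := tendsto_measure_avoid_tube (affineLatticeMeasure (m + 1)) measurable_fst
    measurable_snd one_pos
  have h' := (ENNReal.tendsto_toReal ENNReal.zero_ne_top).comp h
  refine h'.congr fun n => ?_
  rw [voidProb, cylinder_zero, measureReal_def, affineLatticeMeasure_tube]
  simp only [disjoint_affineLattice_iff]
  rfl

/-- Reflection in the point x: the lattice is symmetric, and the part of the cylinder below x turns
into a cylinder of length x_1 whose axis starts at the transverse coordinates of x. This is how Φ
comes to be expressed through `voidProb₀`. -/
theorem lowestSet_cylinder (M : SLR m) (ξ : ℝ) :
    lowestSet M (cylinder m ξ 0) = {x | (0 < x 0 ∧ x 0 < ξ ∧ ‖WithLp.toLp 2 (Fin.tail x)‖ < 1) ∧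
      IsVoid M (cylinder m (x 0) (WithLp.toLp 2 (Fin.tail x)))} := by
  rw [cylinder_zero]
  ext x
  have hiff : ∀ y : Fin (m + 1) → ℝ, x 0 < ξ → ((y 0 < 0 ∧ x + y ∈ tube m ξ 1) ↔
      -y ∈ cylinder m (x 0) (WithLp.toLp 2 (Fin.tail x))) := by
    intro y hx
    have hn : ‖WithLp.toLp 2 (Fin.tail (x + y))‖ =
        ‖WithLp.toLp 2 (Fin.tail (-y)) - WithLp.toLp 2 (Fin.tail x)‖ := by
      rw [← norm_neg]
      congr 1
      ext i
      change -(x i.succ + y i.succ) = -y i.succ - x i.succ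
      ring
    rw [tube, cylinder, Set.mem_ofPred_eq, Set.mem_ofPred_eq, hn, Pi.add_apply, Pi.neg_apply]
    constructor
    · rintro ⟨h0, h1, h2, h3⟩
      exact ⟨by linarith, by linarith, h3⟩
    · rintro ⟨h1, h2, h3⟩
      exact ⟨by linarith, by linarith, by linarith, h3⟩
  constructor
  · rintro ⟨hx, hl⟩
    refine ⟨hx, fun k hk => ?_⟩
    have h1 := (hiff (vecMul (castVec (-k)) M.1) hx.2.1).2 (by
      rwa [castVec_neg, Matrix.neg_vecMul, neg_neg])
    exact hl (-k) h1.1 h1.2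
  · rintro ⟨hx, hl⟩
    refine ⟨hx, fun k hk0 hk => ?_⟩
    have h1 := (hiff _ hx.2.1).1 ⟨hk0, hk⟩
    rw [← Matrix.neg_vecMul, ← castVec_neg] at h1
    exact hl (-k) h1

theorem lintegral_comp_cons {f : ℝ → EuclideanSpace ℝ (Fin m) → ℝ≥0∞}
    (hf : Measurable (Function.uncurry f)) :
    ∫⁻ x : Fin (m + 1) → ℝ, f (x 0) (WithLp.toLp 2 (Fin.tail x)) = ∫⁻ s, ∫⁻ w, f s w := by
  have h1 := volume_preserving_piFinSuccAbove (fun _ : Fin (m + 1) => ℝ) 0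
  have h2 : MeasurePreserving (WithLp.toLp 2 : (Fin m → ℝ) → EuclideanSpace ℝ (Fin m)) :=
    PiLp.volume_preserving_toLp (Fin m)
  have h3 := ((MeasurePreserving.id (volume : Measure ℝ)).prod h2).comp h1
  have h4 := h3.lintegral_comp hf
  rw [lintegral_prod _ hf.aemeasurable] at h4
  exact h4

theorem measurableSet_mem_cylinder : MeasurableSet
    {p : (ℝ × EuclideanSpace ℝ (Fin m)) × (Fin (m + 1) → ℝ) | p.2 ∈ cylinder m p.1.1 p.1.2} := by
  have h0 : Continuous fun p : (ℝ × EuclideanSpace ℝ (Fin m)) × (Fin (m + 1) → ℝ) => p.2 0 :=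
    (continuous_apply 0).comp continuous_snd
  exact ((isOpen_lt continuous_const h0).inter ((isOpen_lt h0 (by fun_prop)).inter
    (isOpen_lt ((continuous_tail.comp continuous_snd).sub (by fun_prop)).norm
      continuous_const))).measurableSet

theorem measurableSet_isVoid_cylinder : MeasurableSet
    {p : SLR m × (ℝ × EuclideanSpace ℝ (Fin m)) | IsVoid p.1 (cylinder m p.2.1 p.2.2)} :=
  measurableSet_isVoid measurable_fst (measurableSet_mem_cylinder.preimage
    (f := fun p : (SLR m × (ℝ × EuclideanSpace ℝ (Fin m))) × (Fin (m + 1) → ℝ) => (p.1.2, p.2))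
    (by fun_prop))

theorem affineLatticeMeasure_cylinder_compl (ξ : ℝ) :
    affineLatticeMeasure (m + 1) {p | Disjoint (affineLattice (m + 1) p.1 p.2)
      (cylinder (m + 1) ξ 0)}ᶜ = ∫⁻ s in Set.Ioo 0 ξ, ∫⁻ w in Metric.ball 0 1,
        latticeMeasure (m + 1) {M | IsVoid M (cylinder (m + 1) s w)} := by
  rw [affineLatticeMeasure_compl (by rw [cylinder_zero]; exact isBounded_tube _ _)
    (measurableSet_cylinder _ _)]
  set R : Set (ℝ × EuclideanSpace ℝ (Fin (m + 1))) := Set.Ioo 0 ξ ×ˢ Metric.ball 0 1 with hR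
  have hRm : MeasurableSet R := measurableSet_Ioo.prod Metric.isOpen_ball.measurableSet
  set T : Set (SLR (m + 1) × (ℝ × EuclideanSpace ℝ (Fin (m + 1)))) :=
    {p | IsVoid p.1 (cylinder (m + 1) p.2.1 p.2.2)} with hT
  have hTm : MeasurableSet T := measurableSet_isVoid_cylinder
  have h1 : ∀ M : SLR (m + 1), volume (lowestSet M (cylinder (m + 1) ξ 0)) =
      ∫⁻ q in R, T.indicator 1 (M, q) := by
    intro M
    have hm1 : MeasurableSet {q | (M, q) ∈ T} := hTm.preimage measurable_prodMk_left
    have hm2 : Measurable (Function.uncurry fun (s : ℝ) (w : EuclideanSpace ℝ (Fin (m + 1))) =>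
        (R ∩ {q | (M, q) ∈ T}).indicator
          (1 : ℝ × EuclideanSpace ℝ (Fin (m + 1)) → ℝ≥0∞) (s, w)) :=
      measurable_one.indicator (hRm.inter hm1)
    have h2 := lintegral_comp_cons hm2
    have h3 : ∫⁻ s, ∫⁻ w, (R ∩ {q | (M, q) ∈ T}).indicator
          (1 : ℝ × EuclideanSpace ℝ (Fin (m + 1)) → ℝ≥0∞) (s, w) =
        ∫⁻ q, (R ∩ {q | (M, q) ∈ T}).indicator 1 q :=
      (lintegral_prod _ hm2.aemeasurable).symm
    rw [h3, lintegral_indicator_one (hRm.inter hm1)] at h2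
    have hlow : MeasurableSet (lowestSet M (cylinder (m + 1) ξ 0)) :=
      (measurableSet_lowestSet (measurableSet_cylinder _ _)).preimage measurable_prodMk_left
    have h4 : ∫⁻ q in R, T.indicator 1 (M, q) = volume (R ∩ {q | (M, q) ∈ T}) := by
      rw [Set.inter_comm, ← Measure.restrict_apply hm1, ← lintegral_indicator_one hm1]
      rfl
    rw [h4, ← h2, ← lintegral_indicator_one hlow, lowestSet_cylinder]
    refine lintegral_congr fun x => ?_
    classical
    rw [Set.indicator_apply, Set.indicator_apply]
    refine if_congr ?_ rfl rfl
    simp [hR, hT, and_assoc]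
  simp_rw [h1]
  have hTi : Measurable (T.indicator
      (1 : SLR (m + 1) × (ℝ × EuclideanSpace ℝ (Fin (m + 1))) → ℝ≥0∞)) := measurable_one.indicator hTm
  rw [lintegral_lintegral_swap (f := fun M q => T.indicator 1 (M, q)) hTi.aemeasurable, hR,
    Measure.volume_eq_prod, ← Measure.prod_restrict, lintegral_prod _
      (hTi.lintegral_prod_left').aemeasurable]
  refine lintegral_congr fun s => lintegral_congr fun w => ?_
  exact lintegral_indicator_one (hTm.preimage (measurable_prodMk_right (y := (s, w))))

end Affine

end LatticeUnion

namespace LatticeUnion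

open scoped ENNReal NNReal Topology Pointwise
open Matrix (vecMul)

/-! ### The first lattice point in a cylinder -/

section FirstPoint

variable {m : ℕ}

theorem isBounded_cylinder (ξ : ℝ) (z : EuclideanSpace ℝ (Fin m)) :
    Bornology.IsBounded (cylinder m ξ z) :=
  (isBounded_tube ξ (1 + ‖z‖)).subset fun x hx => ⟨hx.1, hx.2.1, by
    linarith [norm_le_norm_sub_add (WithLp.toLp 2 (Fin.tail x)) z, hx.2.2]⟩

/-- The ball around z contains 0, so the cylinder is stable under shrinking towards the origin.
Hence its lowest lattice point is primitive. -/
theorem smul_mem_cylinder {ξ a : ℝ} {z : EuclideanSpace ℝ (Fin m)} (hz : ‖z‖ < 1) (ha : 0 < a)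
    (ha1 : a ≤ 1) {x : Fin (m + 1) → ℝ} (hx : x ∈ cylinder m ξ z) : a • x ∈ cylinder m ξ z := by
  obtain ⟨h0, h1, h2⟩ := hx
  refine ⟨?_, ?_, ?_⟩
  · rw [Pi.smul_apply, smul_eq_mul]; positivity
  · rw [Pi.smul_apply, smul_eq_mul]; nlinarith
  · have hc := convex_ball z 1 (x := WithLp.toLp 2 (Fin.tail x)) (y := 0)
      (by rwa [mem_ball_iff_norm]) (by rwa [mem_ball_iff_norm, zero_sub, norm_neg]) ha.le
      (sub_nonneg.2 ha1) (by ring)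
    rw [smul_zero, add_zero, mem_ball_iff_norm] at hc
    exact hc

/-- `y` is the lowest point of the lattice in the cylinder. -/
def firstSet (m : ℕ) (ξ : ℝ) (z : EuclideanSpace ℝ (Fin m)) :
    Set ((Fin (m + 1) → ℝ) × SLR m) :=
  {p | p.1 ∈ cylinder m ξ z ∧ IsVoid p.2 (cylinder m (p.1 0) z)}

theorem measurableSet_firstSet (ξ : ℝ) (z : EuclideanSpace ℝ (Fin m)) :
    MeasurableSet (firstSet m ξ z) := by
  refine ((measurableSet_cylinder ξ z).preimage measurable_fst).inter ?_
  exact measurableSet_isVoid measurable_snd (measurableSet_mem_cylinder.preimage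
    (f := fun p : ((Fin (m + 1) → ℝ) × SLR m) × (Fin (m + 1) → ℝ) => ((p.1.1 0, z), p.2))
    ((((measurable_pi_apply 0).comp (measurable_fst.comp measurable_fst)).prodMk
      measurable_const).prodMk measurable_snd))

theorem tsum_indicator_firstSet {M : SLR (m + 1)} (hM : IsGeneric M) (ξ : ℝ)
    {z : EuclideanSpace ℝ (Fin (m + 1))} (hz : ‖z‖ < 1) :
    ∑' p : primVec (m + 1), (firstSet (m + 1) ξ z).indicator
      (1 : (Fin (m + 2) → ℝ) × SLR (m + 1) → ℝ≥0∞) (vecMul (castVec p.1) M.1, M) =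
    {M : SLR (m + 1) | IsVoid M (cylinder (m + 1) ξ z)}ᶜ.indicator 1 M := by
  by_cases h : ∃ k : Fin (m + 2) → ℤ, vecMul (castVec k + 0) M.1 ∈ cylinder (m + 1) ξ z
  · have hMc : M ∈ {M : SLR (m + 1) | IsVoid M (cylinder (m + 1) ξ z)}ᶜ := by
      simpa [IsVoid] using h
    rw [Set.indicator_of_mem hMc, Pi.one_apply]
    obtain ⟨k, hk, hmin⟩ := exists_lowest (isBounded_cylinder ξ z) 0 h
    simp only [add_zero] at hk hmin
    have hk0 : k ≠ 0 := by
      rintro rfl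
      have := hk.1
      rw [castVec_zero, Matrix.zero_vecMul] at this
      exact lt_irrefl _ this
    obtain ⟨n, p, hnp⟩ : ∃ (n : ℕ+) (p : primVec (m + 1)), k = ((n : ℕ) : ℤ) • p.1 := by
      obtain ⟨⟨n, p⟩, hnp⟩ := (equivPrimVec m).surjective ⟨k, hk0⟩
      exact ⟨n, p, (congrArg Subtype.val hnp).symm⟩
    have hn : (1 : ℝ) ≤ ((n : ℕ) : ℝ) := by exact_mod_cast n.pos
    have hkM : vecMul (castVec k) M.1 = ((n : ℕ) : ℝ) • vecMul (castVec p.1) M.1 := by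
      rw [hnp, castVec_smul, Matrix.smul_vecMul]
    have hpM : vecMul (castVec p.1) M.1 = ((n : ℕ) : ℝ)⁻¹ • vecMul (castVec k) M.1 := by
      rw [hkM, inv_smul_smul₀ (by positivity)]
    have hp : vecMul (castVec p.1) M.1 ∈ cylinder (m + 1) ξ z := by
      rw [hpM]
      exact smul_mem_cylinder hz (by positivity) (inv_le_one_of_one_le₀ hn) hk
    have hle : vecMul (castVec p.1) M.1 0 ≤ vecMul (castVec k) M.1 0 := by
      rw [hkM, Pi.smul_apply, smul_eq_mul]
      nlinarith [hp.1]
    have hpf : (vecMul (castVec p.1) M.1, M) ∈ firstSet (m + 1) ξ z := by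
      refine ⟨hp, fun l hl => ?_⟩
      have h1 := hmin l ⟨hl.1, hl.2.1.trans hp.2.1, hl.2.2⟩
      have h2 : vecMul (castVec l) M.1 0 < vecMul (castVec p.1) M.1 0 := hl.2.1
      linarith
    rw [tsum_eq_single p, Set.indicator_of_mem hpf, Pi.one_apply]
    intro q hq
    refine Set.indicator_of_notMem (fun hqf => ?_) _
    have h1 : vecMul (castVec p.1) M.1 0 = vecMul (castVec q.1) M.1 0 := by
      refine le_antisymm (not_lt.1 fun hlt => hpf.2 q.1 ⟨hqf.1.1, hlt, hqf.1.2.2⟩)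
        (not_lt.1 fun hlt => hqf.2 p.1 ⟨hp.1, hlt, hp.2.2⟩)
    refine hM (q.1 - p.1) (sub_ne_zero.2 fun h => hq (Subtype.ext h)) ?_
    rw [castVec_sub, Matrix.sub_vecMul, Pi.sub_apply, h1, sub_self]
  · have hMc : M ∉ {M : SLR (m + 1) | IsVoid M (cylinder (m + 1) ξ z)}ᶜ := by
      simpa [IsVoid] using h
    rw [Set.indicator_of_notMem hMc, ENNReal.tsum_eq_zero]
    intro p
    exact Set.indicator_of_notMem (fun hp => h ⟨p.1, by simpa using hp.1⟩) _

theorem vecMul_stabMat (b : Fin (m + 1) → ℝ) (A : SLR m) (k : Fin (m + 2) → ℝ) :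
    vecMul k (stabMat b A).1 = Fin.cons (k 0 + Fin.tail k ⬝ᵥ b) (vecMul (Fin.tail k) A.1) := by
  ext j
  refine Fin.cases ?_ (fun j => ?_) j
  · simp [Matrix.vecMul, dotProduct, Fin.sum_univ_succ, Fin.tail]
  · simp [Matrix.vecMul, dotProduct, Fin.sum_univ_succ, Fin.tail]

theorem vecMul_sec {y : Fin (m + 2) → ℝ} (hy : 0 < y 0) (v : Fin (m + 2) → ℝ) :
    vecMul v (sec y).1 = Fin.cons (v 0 * y 0)
      (v 0 • Fin.tail y + (y 0 ^ (-(1 / (m + 1 : ℝ)))) • Fin.tail v) := by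
  have h0 := row_zero_sec hy.ne'
  have h1 := sec_succ hy.ne'
  ext j
  rw [Matrix.vecMul, dotProduct, Fin.sum_univ_succ, h0]
  simp_rw [h1]
  refine Fin.cases ?_ (fun j => ?_) j
  · simp
  · simp [secDiag_of_pos hy, Fin.tail, mul_comm]

/-- The first coordinate of the point `k` of a lattice with the first row `y`, in units of `y 0`. -/
noncomputable def height (k : Fin (m + 2) → ℤ) (b : Fin (m + 1) → ℝ) : ℝ :=
  k 0 + castVec (Fin.tail k) ⬝ᵥ b

/-- The other coordinates of the point `k` of a lattice with the first row `(s, w)`. -/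
noncomputable def slope (k : Fin (m + 2) → ℤ) (s : ℝ) (A : SLR m) (b : Fin (m + 1) → ℝ)
    (w : EuclideanSpace ℝ (Fin (m + 1))) : EuclideanSpace ℝ (Fin (m + 1)) :=
  height k b • w + (s ^ (-(1 / (m + 1 : ℝ)))) • WithLp.toLp 2 (vecMul (castVec (Fin.tail k)) A.1)

/-- The point `k` of the lattice with the first row `(s, w)` lies in the cylinder of length `s`. -/
def IsHit (k : Fin (m + 2) → ℤ) (s : ℝ) (z : EuclideanSpace ℝ (Fin (m + 1))) (A : SLR m)
    (b : Fin (m + 1) → ℝ) (w : EuclideanSpace ℝ (Fin (m + 1))) : Prop :=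
  0 < height k b ∧ height k b < 1 ∧ ‖slope k s A b w - z‖ < 1

/-- Heights are measured in units of `y 0`. The first row itself has height 1, so the strict
inequality in `IsHit` excludes it. -/
theorem isVoid_coord_iff {y : Fin (m + 2) → ℝ} (hy : 0 < y 0) (A : SLR m) (b : Fin (m + 1) → ℝ)
    (z : EuclideanSpace ℝ (Fin (m + 1))) :
    IsVoid (coord (y, A, b)) (cylinder (m + 1) (y 0) z) ↔
      ∀ k, ¬ IsHit k (y 0) z A b (WithLp.toLp 2 (Fin.tail y)) := by
  refine forall_congr' fun k => not_congr ?_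
  have h : vecMul (castVec k) (coord (y, A, b)).1 = Fin.cons (height k b * y 0)
      (WithLp.ofLp (slope k (y 0) A b (WithLp.toLp 2 (Fin.tail y)))) := by
    rw [coord, vecMul_mul, vecMul_stabMat, vecMul_sec hy]
    rfl
  rw [h, cylinder, Set.mem_ofPred_eq, Fin.cons_zero, Fin.tail_cons, IsHit]
  refine and_congr (by rw [mul_pos_iff_of_pos_right hy]) (and_congr ?_ Iff.rfl)
  exact ⟨fun h => by nlinarith, fun h => by nlinarith⟩

/-- The parameters for which the lattice with the first row `(s, w)` has no point in the cylinder
of length `s` that starts at `(0, z)`. -/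
def freeSet (m : ℕ) : Set ((EuclideanSpace ℝ (Fin (m + 1)) × ℝ) ×
    ((SLR m × (Fin (m + 1) → ℝ)) × EuclideanSpace ℝ (Fin (m + 1)))) :=
  {p | p.2.2 ∈ Metric.ball p.1.1 1 ∧ ∀ k, ¬ IsHit k p.1.2 p.1.1 p.2.1.1 p.2.1.2 p.2.2}

theorem measurable_height (k : Fin (m + 2) → ℤ) : Measurable fun b => height k b := by
  unfold height
  simp only [dotProduct]
  fun_prop

theorem measurable_slope (k : Fin (m + 2) → ℤ) : Measurable fun p : ℝ ×
    ((SLR m × (Fin (m + 1) → ℝ)) × EuclideanSpace ℝ (Fin (m + 1))) =>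
      slope k p.1 p.2.1.1 p.2.1.2 p.2.2 := by
  unfold slope
  refine Measurable.add ?_ (Measurable.smul (measurable_fst.pow_const _) ?_)
  · exact ((measurable_height k).comp (measurable_snd.comp (measurable_fst.comp
      measurable_snd))).smul (measurable_snd.comp measurable_snd)
  · exact (PiLp.continuous_toLp 2 _).measurable.comp
      ((measurable_vecMul_prod _).comp (measurable_fst.comp (measurable_fst.comp measurable_snd)))

theorem measurableSet_isHit (k : Fin (m + 2) → ℤ) : MeasurableSet
    {p : (EuclideanSpace ℝ (Fin (m + 1)) × ℝ) ×
      ((SLR m × (Fin (m + 1) → ℝ)) × EuclideanSpace ℝ (Fin (m + 1))) |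
      IsHit k p.1.2 p.1.1 p.2.1.1 p.2.1.2 p.2.2} := by
  have h1 : Measurable fun p : (EuclideanSpace ℝ (Fin (m + 1)) × ℝ) ×
      ((SLR m × (Fin (m + 1) → ℝ)) × EuclideanSpace ℝ (Fin (m + 1))) => height k p.2.1.2 :=
    (measurable_height k).comp (by fun_prop)
  have h2 : Measurable fun p : (EuclideanSpace ℝ (Fin (m + 1)) × ℝ) ×
      ((SLR m × (Fin (m + 1) → ℝ)) × EuclideanSpace ℝ (Fin (m + 1))) =>
        slope k p.1.2 p.2.1.1 p.2.1.2 p.2.2 :=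
    (measurable_slope k).comp (f := fun p : (EuclideanSpace ℝ (Fin (m + 1)) × ℝ) ×
      ((SLR m × (Fin (m + 1) → ℝ)) × EuclideanSpace ℝ (Fin (m + 1))) => (p.1.2, p.2))
      (by fun_prop)
  exact (measurableSet_lt measurable_const h1).inter ((measurableSet_lt h1 measurable_const).inter
    (measurableSet_lt (h2.sub (by fun_prop)).norm measurable_const))

theorem measurableSet_freeSet : MeasurableSet (freeSet m) := by
  have h : freeSet m = {p | dist p.2.2 p.1.1 < 1} ∩
      ⋂ k, {p | IsHit k p.1.2 p.1.1 p.2.1.1 p.2.1.2 p.2.2}ᶜ := by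
    ext p
    simp [freeSet]
  rw [h]
  exact (measurableSet_lt (by fun_prop) measurable_const).inter
    (MeasurableSet.iInter fun k => (measurableSet_isHit k).compl)

/-- The distribution of the parameters. -/
noncomputable def paramMeasure (m : ℕ) :
    Measure ((SLR m × (Fin (m + 1) → ℝ)) × EuclideanSpace ℝ (Fin (m + 1))) :=
  ((latticeMeasure m).prod (volume.restrict (unitCube (m + 1)))).prod volume

instance instSFiniteParamMeasure : SFinite (paramMeasure m) := by
  unfold paramMeasure
  infer_instance

/-- The density of the first point of a random lattice in the cylinder that starts at `(0, z)`, up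
to the constant of the mean value formula. -/
noncomputable def freeDensity (m : ℕ) (z : EuclideanSpace ℝ (Fin (m + 1))) (s : ℝ) : ℝ≥0∞ :=
  paramMeasure m (Prod.mk (z, s) ⁻¹' freeSet m)

theorem measurable_freeDensity : Measurable fun p : EuclideanSpace ℝ (Fin (m + 1)) × ℝ =>
    freeDensity m p.1 p.2 :=
  measurable_measure_prodMk_left measurableSet_freeSet

/-- The lattice meets the cylinder exactly when, almost surely, one primitive vector is its lowest
point there. Unfolding the sum over primitive vectors and writing y = (s, w) produces the density in
s. -/
theorem latticeMeasure_isVoid_compl (ξ : ℝ) {z : EuclideanSpace ℝ (Fin (m + 1))} (hz : ‖z‖ < 1) :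
    latticeMeasure (m + 1) {M | IsVoid M (cylinder (m + 1) ξ z)}ᶜ =
      meanConst m * ∫⁻ s in Set.Ioo 0 ξ, freeDensity m z s := by
  have hind : Measurable ((firstSet (m + 1) ξ z).indicator
      (1 : (Fin (m + 2) → ℝ) × SLR (m + 1) → ℝ≥0∞)) :=
    measurable_one.indicator (measurableSet_firstSet ξ z)
  have h1 := lintegral_tsum_primVec (H := fun y M => (firstSet (m + 1) ξ z).indicator 1 (y, M))
    hind (fun y γ M => by
      classical
      simp only [Set.indicator_apply, firstSet, Set.mem_ofPred_eq, isVoid_smul_iff]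
      rfl)
  have h2 : ∫⁻ M, (∑' p : primVec (m + 1), (firstSet (m + 1) ξ z).indicator
      (1 : (Fin (m + 2) → ℝ) × SLR (m + 1) → ℝ≥0∞) (vecMul (castVec p.1) M.1, M))
        ∂(latticeMeasure (m + 1)) =
      latticeMeasure (m + 1) {M | IsVoid M (cylinder (m + 1) ξ z)}ᶜ := by
    rw [← lintegral_indicator_one (measurableSet_isVoid_const (measurableSet_cylinder ξ z)).compl]
    refine lintegral_congr_ae ?_
    filter_upwards [ae_isGeneric] with M hM
    exact tsum_indicator_firstSet hM ξ hz
  rw [← h2, h1]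
  congr 1
  set U : Set ((ℝ × EuclideanSpace ℝ (Fin (m + 1))) × (SLR m × (Fin (m + 1) → ℝ))) :=
    {p | p.1.1 ∈ Set.Ioo 0 ξ ∧ ((z, p.1.1), (p.2, p.1.2)) ∈ freeSet m} with hU
  have hUm : MeasurableSet U := (measurableSet_Ioo.preimage (by fun_prop)).inter
    (measurableSet_freeSet.preimage (by fun_prop))
  have hUi : Measurable (U.indicator (1 : (ℝ × EuclideanSpace ℝ (Fin (m + 1))) ×
    (SLR m × (Fin (m + 1) → ℝ)) → ℝ≥0∞)) := measurable_one.indicator hUm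
  have h3 : ∀ y : Fin (m + 2) → ℝ, ∫⁻ A, (∫⁻ b in unitCube (m + 1),
      (firstSet (m + 1) ξ z).indicator 1 (y, coord (y, A, b))) ∂(latticeMeasure m) =
      ∫⁻ q, U.indicator 1 ((y 0, WithLp.toLp 2 (Fin.tail y)), q)
        ∂((latticeMeasure m).prod (volume.restrict (unitCube (m + 1)))) := by
    intro y
    have hUy : Measurable fun q : SLR m × (Fin (m + 1) → ℝ) => U.indicator
        (1 : (ℝ × EuclideanSpace ℝ (Fin (m + 1))) × (SLR m × (Fin (m + 1) → ℝ)) → ℝ≥0∞)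
          ((y 0, WithLp.toLp 2 (Fin.tail y)), q) := hUi.comp measurable_prodMk_left
    rw [lintegral_prod _ hUy.aemeasurable]
    refine lintegral_congr fun A => lintegral_congr fun b => ?_
    classical
    rw [Set.indicator_apply, Set.indicator_apply]
    refine if_congr ?_ rfl rfl
    simp only [firstSet, hU, freeSet, Set.mem_ofPred_eq, cylinder, Set.mem_Ioo, mem_ball_iff_norm]
    constructor
    · rintro ⟨⟨h0, h1, h2⟩, h3⟩
      exact ⟨⟨h0, h1⟩, h2, (isVoid_coord_iff h0 A b z).1 h3⟩
    · rintro ⟨⟨h0, h1⟩, h2, h3⟩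
      exact ⟨⟨h0, h1, h2⟩, (isVoid_coord_iff h0 A b z).2 h3⟩
  simp_rw [h3]
  rw [lintegral_comp_cons (f := fun s w => ∫⁻ q, U.indicator 1 ((s, w), q)
    ∂((latticeMeasure m).prod (volume.restrict (unitCube (m + 1))))) hUi.lintegral_prod_right']
  rw [← lintegral_indicator measurableSet_Ioo]
  refine lintegral_congr fun s => ?_
  by_cases hs : s ∈ Set.Ioo 0 ξ
  · rw [Set.indicator_of_mem hs, freeDensity, paramMeasure, Measure.prod_apply_symm
      (measurableSet_freeSet.preimage measurable_prodMk_left)]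
    refine lintegral_congr fun w => ?_
    rw [← lintegral_indicator_one ((measurableSet_freeSet.preimage
      measurable_prodMk_left).preimage measurable_prodMk_right)]
    refine lintegral_congr fun q => ?_
    classical
    rw [Set.indicator_apply, Set.indicator_apply]
    refine if_congr ?_ rfl rfl
    simp only [hU, Set.mem_ofPred_eq, hs, true_and, Set.mem_preimage]
  · rw [Set.indicator_of_notMem hs]
    have h4 : ∀ w q, U.indicator (1 : (ℝ × EuclideanSpace ℝ (Fin (m + 1))) ×
        (SLR m × (Fin (m + 1) → ℝ)) → ℝ≥0∞) ((s, w), q) = 0 := fun w q =>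
      Set.indicator_of_notMem (fun h => hs h.1) _
    simp only [h4, lintegral_zero]

end FirstPoint

end LatticeUnion

namespace LatticeUnion

open scoped ENNReal NNReal Topology Pointwise
open Matrix (vecMul)

/-! ### The density of the first lattice point is continuous and nearly constant -/

section Density

variable {m : ℕ}

/-- A hit bounds the contribution of A to `slope`; undoing the factor s^(-1/(d-1)) gives a short
vector of the lattice of dimension d-1. -/
theorem IsHit.mem_tube {k : Fin (m + 2) → ℤ} {s : ℝ} (hs : 0 < s)
    {z w : EuclideanSpace ℝ (Fin (m + 1))} {A : SLR m} {b : Fin (m + 1) → ℝ}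
    (h : IsHit k s z A b w) {R : ℝ} (hR : ‖height k b • w - z‖ ≤ R) :
    ‖WithLp.toLp 2 (vecMul (castVec (Fin.tail k)) A.1)‖ < (1 + R) * s ^ (1 / (m + 1 : ℝ)) := by
  have hc : 0 < s ^ (1 / (m + 1 : ℝ)) := Real.rpow_pos_of_pos hs _
  have h1 : (s ^ (-(1 / (m + 1 : ℝ)))) • WithLp.toLp 2 (vecMul (castVec (Fin.tail k)) A.1) =
      (slope k s A b w - z) - (height k b • w - z) := by
    rw [slope]; abel
  have h2 : ‖(s ^ (-(1 / (m + 1 : ℝ)))) • WithLp.toLp 2 (vecMul (castVec (Fin.tail k)) A.1)‖ <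
      1 + R := by
    rw [h1]
    exact (norm_sub_le _ _).trans_lt (add_lt_add_of_lt_of_le h.2.2 hR)
  rw [norm_smul, Real.rpow_neg hs.le, norm_inv, Real.norm_of_nonneg hc.le,
    inv_mul_lt_iff₀ hc, mul_comm] at h2
  exact h2

theorem finite_height_slope (A : SLR m) (b : Fin (m + 1) → ℝ) (R : ℝ) :
    {k : Fin (m + 2) → ℤ | 0 < height k b ∧ height k b < 1 ∧
      ‖WithLp.toLp 2 (vecMul (castVec (Fin.tail k)) A.1)‖ < R}.Finite := by
  refine (finite_castVec_mem (stabMat b A) (isBounded_tube (m := m + 1) 1 R)).subset fun k hk => ?_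
  rw [Set.mem_ofPred_eq, vecMul_stabMat]
  exact hk

theorem eventually_isHit_iff {k : Fin (m + 2) → ℤ} {s₀ : ℝ} (hs : 0 < s₀)
    {z w : EuclideanSpace ℝ (Fin (m + 1))} {A : SLR m} {b : Fin (m + 1) → ℝ}
    (h : height k b ≠ 0 → ‖slope k s₀ A b w - z‖ ≠ 1) :
    ∀ᶠ s in 𝓝 s₀, (IsHit k s z A b w ↔ IsHit k s₀ z A b w) := by
  by_cases h0 : 0 < height k b
  · have hc : ContinuousAt (fun s => ‖slope k s A b w - z‖) s₀ := by
      unfold slope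
      exact ((continuousAt_const.add ((continuousAt_id.rpow_const (Or.inl hs.ne')).smul
        continuousAt_const)).sub continuousAt_const).norm
    rcases (h h0.ne').lt_or_gt with h1 | h1
    · filter_upwards [hc.eventually_lt_const h1] with s hs'
      simp only [IsHit, h1, hs']
    · filter_upwards [hc.eventually_const_lt h1] with s hs'
      simp only [IsHit, h1.not_gt, hs'.not_gt]
  · exact Filter.Eventually.of_forall fun s => by simp only [IsHit, h0, false_and]

/-- For all s < 2 s₀ the possible hits lie in one finite set of k, chosen independently of s. Each
has locally constant status unless it sits on the boundary of the cylinder. -/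
theorem eventually_mem_freeSet_iff {s₀ : ℝ} (hs : 0 < s₀)
    {z w : EuclideanSpace ℝ (Fin (m + 1))} {A : SLR m} {b : Fin (m + 1) → ℝ}
    (h : ∀ k : Fin (m + 2) → ℤ, height k b ≠ 0 → ‖slope k s₀ A b w - z‖ ≠ 1) :
    ∀ᶠ s in 𝓝 s₀, (((z, s), ((A, b), w)) ∈ freeSet m ↔ ((z, s₀), ((A, b), w)) ∈ freeSet m) := by
  set R : ℝ := (1 + (‖w‖ + ‖z‖)) * (2 * s₀) ^ (1 / (m + 1 : ℝ)) with hR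
  have hfin := finite_height_slope A b R
  have hhit : ∀ s, 0 < s → s < 2 * s₀ → ∀ k, IsHit k s z A b w →
      k ∈ {k : Fin (m + 2) → ℤ | 0 < height k b ∧ height k b < 1 ∧
      ‖WithLp.toLp 2 (vecMul (castVec (Fin.tail k)) A.1)‖ < R} := by
    intro s hs0 hs1 k hk
    refine ⟨hk.1, hk.2.1, (hk.mem_tube hs0 (R := ‖w‖ + ‖z‖) ?_).trans_le ?_⟩
    · refine (norm_sub_le _ _).trans (add_le_add_left ?_ _)
      rw [norm_smul, Real.norm_of_nonneg hk.1.le]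
      exact mul_le_of_le_one_left (norm_nonneg _) hk.2.1.le
    · rw [hR]
      gcongr
  have hall := (hfin.eventually_all (l := 𝓝 s₀)).2 fun k _ => eventually_isHit_iff hs (h k)
  filter_upwards [hall, lt_mem_nhds hs, gt_mem_nhds (by linarith : s₀ < 2 * s₀)] with s h1 h2 h3
  refine and_congr_right fun _ => ⟨fun hf k hk => ?_, fun hf k hk => ?_⟩
  · exact hf k ((h1 k (hhit s₀ hs (by linarith) k hk)).2 hk)
  · exact hf k ((h1 k (hhit s h2 h3 k hk)).1 hk)

theorem volume_norm_smul_add_eq {E : Type*} [NormedAddCommGroup E] [InnerProductSpace ℝ E]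
    [FiniteDimensional ℝ E] [MeasurableSpace E] [BorelSpace E] [Nontrivial E] {h : ℝ} (hh : h ≠ 0)
    (v : E) : volume {w : E | ‖h • w + v‖ = 1} = 0 := by
  refine measure_mono_null (fun w hw => ?_)
    (Measure.addHaar_sphere (volume : Measure E) (-(h⁻¹ • v)) |h|⁻¹)
  have h1 : w - -(h⁻¹ • v) = h⁻¹ • (h • w + v) := by
    rw [smul_add, inv_smul_smul₀ hh, sub_neg_eq_add]
  rw [mem_sphere_iff_norm, h1, norm_smul, show ‖h • w + v‖ = 1 from hw, mul_one, norm_inv,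
    Real.norm_eq_abs]

/-- For fixed A and b, the exceptional w for a given k lie on a sphere. The case of height 0 is
never a hit and is left out. -/
theorem ae_norm_slope_ne (s : ℝ) (z : EuclideanSpace ℝ (Fin (m + 1))) :
    ∀ᵐ p ∂(paramMeasure m), ∀ k : Fin (m + 2) → ℤ, height k p.1.2 ≠ 0 →
      ‖slope k s p.1.1 p.1.2 p.2 - z‖ ≠ 1 := by
  rw [ae_all_iff]
  intro k
  have h1 : Measurable fun p : (SLR m × (Fin (m + 1) → ℝ)) × EuclideanSpace ℝ (Fin (m + 1)) =>
      height k p.1.2 := (measurable_height k).comp (measurable_snd.comp measurable_fst)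
  have h2 : Measurable fun p : (SLR m × (Fin (m + 1) → ℝ)) × EuclideanSpace ℝ (Fin (m + 1)) =>
      slope k s p.1.1 p.1.2 p.2 := (measurable_slope k).comp (f := fun p => (s, p))
    measurable_prodMk_left
  have hm : MeasurableSet {p : (SLR m × (Fin (m + 1) → ℝ)) × EuclideanSpace ℝ (Fin (m + 1)) |
      height k p.1.2 ≠ 0 ∧ ‖slope k s p.1.1 p.1.2 p.2 - z‖ = 1} :=
    (measurableSet_eq_fun h1 measurable_const).compl.inter
      (measurableSet_eq_fun (h2.sub_const z).norm measurable_const)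
  have h3 : paramMeasure m {p : (SLR m × (Fin (m + 1) → ℝ)) × EuclideanSpace ℝ (Fin (m + 1)) |
      height k p.1.2 ≠ 0 ∧ ‖slope k s p.1.1 p.1.2 p.2 - z‖ = 1} = 0 := by
    rw [paramMeasure, Measure.measure_prod_null hm]
    refine Filter.Eventually.of_forall fun q => ?_
    by_cases hq : height k q.2 = 0
    · simp [hq]
    · refine measure_mono_null (fun w hw => ?_) (volume_norm_smul_add_eq hq
        ((s ^ (-(1 / (m + 1 : ℝ)))) • WithLp.toLp 2 (vecMul (castVec (Fin.tail k)) q.1.1) - z))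
      have := hw.2
      rw [slope, add_sub_assoc] at this
      exact this
  rw [ae_iff]
  convert h3 using 3
  simp

theorem preimage_freeSet_subset (z : EuclideanSpace ℝ (Fin (m + 1))) (s : ℝ) :
    Prod.mk (z, s) ⁻¹' freeSet m ⊆ Set.univ ×ˢ Metric.ball z 1 := fun _ hp => ⟨trivial, hp.1⟩

theorem paramMeasure_univ_prod (S : Set (EuclideanSpace ℝ (Fin (m + 1)))) :
    paramMeasure m (Set.univ ×ˢ S) = volume S := by
  rw [paramMeasure, Measure.prod_prod, measure_univ, one_mul]

theorem freeDensity_le (z : EuclideanSpace ℝ (Fin (m + 1))) (s : ℝ) :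
    freeDensity m z s ≤ volume (Metric.ball z 1) :=
  (measure_mono (preimage_freeSet_subset z s)).trans_eq (paramMeasure_univ_prod _)

theorem tendsto_freeDensity (z : EuclideanSpace ℝ (Fin (m + 1))) {s₀ : ℝ} (hs : 0 < s₀) :
    Filter.Tendsto (freeDensity m z) (𝓝 s₀) (𝓝 (freeDensity m z s₀)) := by
  refine tendsto_measure_of_ae_tendsto_indicator (𝓝 s₀)
    (measurableSet_freeSet.preimage measurable_prodMk_left)
    (fun s => measurableSet_freeSet.preimage measurable_prodMk_left)
    (MeasurableSet.univ.prod Metric.isOpen_ball.measurableSet)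
    (B := Set.univ ×ˢ Metric.ball z 1) ?_
    (Filter.Eventually.of_forall fun s => preimage_freeSet_subset z s) ?_
  · rw [paramMeasure_univ_prod]
    exact measure_ball_lt_top.ne
  · filter_upwards [ae_norm_slope_ne s₀ z] with p hp
    exact eventually_mem_freeSet_iff hs hp

/-- The random lattice of dimension `d - 1` has a short nonzero vector. -/
def shortSet (m : ℕ) (r : ℝ) : Set (SLR m) :=
  {A | ∃ l : Fin (m + 1) → ℤ, l ≠ 0 ∧ ‖WithLp.toLp 2 (vecMul (castVec l) A.1)‖ < r}

/-- In dimension at least two this is Markov's inequality with the mean value formula. In dimension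
one the lattice is ℤ, which has no nonzero vector shorter than 1. -/
theorem latticeMeasure_shortSet_le (m : ℕ) : ∃ C : ℝ≥0∞, C ≠ ∞ ∧ ∀ r : ℝ, 0 < r →
    latticeMeasure m (shortSet m r) ≤ C * ENNReal.ofReal (r ^ (m + 1)) := by
  rcases m with _ | m
  · refine ⟨1, ENNReal.one_ne_top, fun r hr => ?_⟩
    rw [one_mul, zero_add, pow_one]
    by_cases h : 1 ≤ r
    · exact prob_le_one.trans (by simpa using ENNReal.ofReal_le_ofReal h)
    · have hempty : shortSet 0 r = ∅ := by
        refine Set.eq_empty_of_forall_notMem ?_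
        rintro A ⟨l, hl, hlr⟩
        have hA : A = 1 := Subsingleton.elim (α := Matrix.SpecialLinearGroup (Fin 1) ℝ) A 1
        have hl0 : l 0 ≠ 0 := fun h0 => hl (funext fun i => by
          rw [show i = 0 from Fin.fin_one_eq_zero i]; exact h0)
        rw [hA, vecMul_one_SLR] at hlr
        have h1 := (PiLp.norm_apply_le (WithLp.toLp 2 (castVec l)) 0).trans_lt hlr
        have h2 : (1 : ℝ) ≤ |((l 0 : ℤ) : ℝ)| := by
          exact_mod_cast Int.one_le_abs hl0
        exact h (h2.trans h1.le)
      rw [hempty, measure_empty]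
      exact zero_le
  · refine ⟨volume (Metric.ball (0 : EuclideanSpace ℝ (Fin (m + 2))) 1), measure_ball_lt_top.ne,
      fun r hr => ?_⟩
    set S : Set (Fin (m + 2) → ℝ) := WithLp.toLp 2 ⁻¹' Metric.ball
      (0 : EuclideanSpace ℝ (Fin (m + 2))) r with hS
    have hSm : MeasurableSet S :=
      Metric.isOpen_ball.measurableSet.preimage (PiLp.continuous_toLp 2 _).measurable
    have hf : Measurable (S.indicator (1 : (Fin (m + 2) → ℝ) → ℝ≥0∞)) := measurable_one.indicator hSm
    have h1 := lintegral_tsum_ne_zero_eq hf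
    rw [lintegral_indicator_one hSm, hS, (PiLp.volume_preserving_toLp _).measure_preimage
      Metric.isOpen_ball.measurableSet.nullMeasurableSet, Measure.addHaar_ball _ _ hr.le,
      finrank_euclideanSpace, Fintype.card_fin, mul_comm] at h1
    rw [← h1]
    calc latticeMeasure (m + 1) (shortSet (m + 1) r)
        = ∫⁻ M in shortSet (m + 1) r, 1 ∂(latticeMeasure (m + 1)) := (setLIntegral_one _).symm
      _ ≤ ∫⁻ M in shortSet (m + 1) r, (∑' k : {k : Fin (m + 2) → ℤ // k ≠ 0},
          S.indicator (1 : (Fin (m + 2) → ℝ) → ℝ≥0∞) (vecMul (castVec k.1) M.1))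
            ∂(latticeMeasure (m + 1)) := by
          refine setLIntegral_mono (Measurable.tsum fun k => hf.comp (measurable_vecMul_prod _)) ?_
          rintro M ⟨l, hl, hlr⟩
          refine le_trans ?_ (ENNReal.le_tsum ⟨l, hl⟩)
          rw [Set.indicator_of_mem (s := S) (by rwa [hS, Set.mem_preimage, mem_ball_zero_iff]),
            Pi.one_apply]
      _ ≤ _ := setLIntegral_le_lintegral _ _

/-- If the last coordinates of k vanished, the height would be an integer strictly between 0 and 1.
The bound 2 comes from convexity: h w - z combines w - z and -z with weights h and 1 - h, so its
norm is at most 1. -/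
theorem IsHit.mem_shortSet {k : Fin (m + 2) → ℤ} {s : ℝ} (hs : 0 < s)
    {z w : EuclideanSpace ℝ (Fin (m + 1))} (hz : ‖z‖ < 1) (hw : w ∈ Metric.ball z 1) {A : SLR m}
    {b : Fin (m + 1) → ℝ} (h : IsHit k s z A b w) :
    A ∈ shortSet m (2 * s ^ (1 / (m + 1 : ℝ))) := by
  refine ⟨Fin.tail k, fun h0 => ?_, ?_⟩
  · have h1 : height k b = k 0 := by rw [height, h0, castVec_zero, zero_dotProduct, add_zero]
    have h2 := h.1
    have h3 := h.2.1
    rw [h1] at h2 h3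
    have h4 : (0 : ℤ) < k 0 := by exact_mod_cast h2
    have h5 : k 0 < (1 : ℤ) := by exact_mod_cast h3
    omega
  · have h1 := h.mem_tube hs (R := 1) ?_
    · rwa [one_add_one_eq_two] at h1
    · have h2 : height k b • w - z = height k b • (w - z) + (1 - height k b) • (-z) := by
        module
      rw [h2]
      refine (norm_add_le _ _).trans ?_
      rw [norm_smul, norm_smul, norm_neg, Real.norm_of_nonneg h.1.le,
        Real.norm_of_nonneg (sub_nonneg.2 h.2.1.le)]
      rw [mem_ball_iff_norm] at hw
      nlinarith [h.1, h.2.1]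

/-- A hit requires a vector of A shorter than r = 2 s^(1/(d-1)), an event of probability O(r^(d-1))
= O(s). This linear rate gives all error terms. -/
theorem volume_ball_le_freeDensity (m : ℕ) : ∃ C : ℝ≥0∞, C ≠ ∞ ∧
    ∀ (z : EuclideanSpace ℝ (Fin (m + 1))), ‖z‖ < 1 → ∀ s : ℝ, 0 < s →
      volume (Metric.ball z 1) ≤ freeDensity m z s + C * ENNReal.ofReal s := by
  obtain ⟨C, hC, hshort⟩ := latticeMeasure_shortSet_le m
  refine ⟨C * 2 ^ (m + 1) * volume (Metric.ball (0 : EuclideanSpace ℝ (Fin (m + 1))) 1),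
    ENNReal.mul_ne_top (ENNReal.mul_ne_top hC (ENNReal.pow_ne_top ENNReal.ofNat_ne_top))
      measure_ball_lt_top.ne, fun z hz s hs => ?_⟩
  set r := 2 * s ^ (1 / (m + 1 : ℝ)) with hr
  have hr0 : 0 < r := by positivity
  have hpow : r ^ (m + 1) = 2 ^ (m + 1) * s := by
    rw [hr, mul_pow, ← Real.rpow_natCast (s ^ _), ← Real.rpow_mul hs.le]
    congr 1
    have : 1 / (m + 1 : ℝ) * ((m + 1 : ℕ) : ℝ) = 1 := by
      push_cast
      field_simp
    rw [this, Real.rpow_one]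
  have hsub : (Set.univ ×ˢ Metric.ball z 1 : Set ((SLR m × (Fin (m + 1) → ℝ)) ×
      EuclideanSpace ℝ (Fin (m + 1)))) ⊆ Prod.mk (z, s) ⁻¹' freeSet m ∪
        (shortSet m r ×ˢ Set.univ) ×ˢ Metric.ball z 1 := by
    rintro ⟨⟨A, b⟩, w⟩ ⟨-, hw⟩
    by_cases h : ∀ k, ¬ IsHit k s z A b w
    · exact Or.inl ⟨hw, h⟩
    · push Not at h
      obtain ⟨k, hk⟩ := h
      exact Or.inr ⟨⟨hk.mem_shortSet hs hz hw, trivial⟩, hw⟩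
  calc volume (Metric.ball z 1) = paramMeasure m (Set.univ ×ˢ Metric.ball z 1) :=
        (paramMeasure_univ_prod _).symm
    _ ≤ _ := measure_mono hsub
    _ ≤ freeDensity m z s + paramMeasure m ((shortSet m r ×ˢ Set.univ) ×ˢ Metric.ball z 1) :=
        measure_union_le _ _
    _ ≤ _ := by
        gcongr
        rw [paramMeasure, Measure.prod_prod, Measure.prod_prod, measure_univ, mul_one,
          Measure.addHaar_ball_center]
        calc _ ≤ C * ENNReal.ofReal (r ^ (m + 1)) *
              volume (Metric.ball (0 : EuclideanSpace ℝ (Fin (m + 1))) 1) := by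
              gcongr
              exact hshort r hr0
          _ = _ := by
              rw [hpow, ENNReal.ofReal_mul (by positivity), ENNReal.ofReal_pow zero_le_two,
                ENNReal.ofReal_ofNat]
              ring

end Density

end LatticeUnion

namespace LatticeUnion

open scoped ENNReal NNReal Topology Pointwise
open Matrix (vecMul)

/-! ### Derivatives of the void probabilities -/

section Derivatives

variable {m : ℕ}

theorem sigmaBar_nonneg (m : ℕ) : 0 ≤ sigmaBar m := measureReal_nonneg

theorem volume_real_ball (z : EuclideanSpace ℝ (Fin m)) :
    volume.real (Metric.ball z 1) = sigmaBar m := by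
  rw [sigmaBar, measureReal_def, measureReal_def, Measure.addHaar_ball_center]

/-- The density of the first lattice point, extended to a continuous function on the line. -/
noncomputable def psi (m : ℕ) (z : EuclideanSpace ℝ (Fin (m + 1))) (s : ℝ) : ℝ :=
  -- The value for s ≤ 0 is the limit of the density as s decreases to 0, at least for ‖z‖ < 1.
  if s ≤ 0 then sigmaBar (m + 1) else (freeDensity m z s).toReal

theorem freeDensity_ne_top (z : EuclideanSpace ℝ (Fin (m + 1))) (s : ℝ) : freeDensity m z s ≠ ∞ :=
  ne_top_of_le_ne_top measure_ball_lt_top.ne (freeDensity_le z s)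

theorem psi_nonneg (z : EuclideanSpace ℝ (Fin (m + 1))) (s : ℝ) : 0 ≤ psi m z s := by
  unfold psi
  split_ifs
  · exact sigmaBar_nonneg _
  · exact ENNReal.toReal_nonneg

theorem psi_le (z : EuclideanSpace ℝ (Fin (m + 1))) (s : ℝ) : psi m z s ≤ sigmaBar (m + 1) := by
  unfold psi
  split_ifs
  · exact le_rfl
  · rw [← volume_real_ball z, measureReal_def]
    exact ENNReal.toReal_mono measure_ball_lt_top.ne (freeDensity_le z s)

theorem abs_psi_sub_le (m : ℕ) : ∃ C : ℝ, 0 ≤ C ∧ ∀ (z : EuclideanSpace ℝ (Fin (m + 1))),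
    ‖z‖ < 1 → ∀ s : ℝ, 0 ≤ s → |psi m z s - sigmaBar (m + 1)| ≤ C * s := by
  obtain ⟨C, hC, h⟩ := volume_ball_le_freeDensity m
  refine ⟨C.toReal, ENNReal.toReal_nonneg, fun z hz s hs => ?_⟩
  rcases hs.eq_or_lt with rfl | hs
  · simp [psi]
  · rw [abs_sub_comm, abs_of_nonneg (sub_nonneg.2 (psi_le z s)), sub_le_iff_le_add', psi,
      if_neg hs.not_ge, ← volume_real_ball z, measureReal_def]
    have h1 := ENNReal.toReal_mono (ENNReal.add_ne_top.2 ⟨freeDensity_ne_top z s,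
      ENNReal.mul_ne_top hC ENNReal.ofReal_ne_top⟩) (h z hz s hs)
    rwa [ENNReal.toReal_add (freeDensity_ne_top z s) (ENNReal.mul_ne_top hC ENNReal.ofReal_ne_top),
      ENNReal.toReal_mul, ENNReal.toReal_ofReal hs.le] at h1

theorem measurable_psi (s : ℝ) : Measurable fun z => psi m z s := by
  unfold psi
  split_ifs
  · exact measurable_const
  · exact (measurable_freeDensity.comp measurable_prodMk_right).ennreal_toReal

theorem continuous_psi {z : EuclideanSpace ℝ (Fin (m + 1))} (hz : ‖z‖ < 1) :
    Continuous (psi m z) := by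
  refine continuous_iff_continuousAt.2 fun s => ?_
  rcases lt_trichotomy s 0 with hs | rfl | hs
  · refine continuousAt_const.congr (f := fun _ => sigmaBar (m + 1)) ?_
    filter_upwards [gt_mem_nhds hs] with t ht
    rw [psi, if_pos ht.le]
  · obtain ⟨C, -, hC⟩ := abs_psi_sub_le m
    have h0 : psi m z 0 = sigmaBar (m + 1) := if_pos le_rfl
    rw [ContinuousAt, h0, tendsto_iff_norm_sub_tendsto_zero]
    have h1 : Filter.Tendsto (fun t : ℝ => |C| * |t|) (𝓝 0) (𝓝 0) := by
      have : Continuous fun t : ℝ => |C| * |t| := by fun_prop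
      simpa using this.tendsto 0
    refine squeeze_zero (fun _ => norm_nonneg _) (fun t => ?_) h1
    rw [Real.norm_eq_abs]
    rcases le_total t 0 with ht | ht
    · rw [psi, if_pos ht, sub_self, abs_zero]
      positivity
    · rw [← abs_mul]
      exact (hC z hz t ht).trans (le_abs_self _)
  · have h := (ENNReal.tendsto_toReal (freeDensity_ne_top z s)).comp (tendsto_freeDensity z hs)
    refine ContinuousAt.congr (f := fun t => (freeDensity m z t).toReal) h ?_
    filter_upwards [lt_mem_nhds hs] with t ht
    rw [psi, if_neg ht.not_ge]

/-- The constant of the mean value formula as a real number. -/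
noncomputable def kappa (m : ℕ) : ℝ := (meanConst m).toReal

theorem kappa_nonneg (m : ℕ) : 0 ≤ kappa m := ENNReal.toReal_nonneg

theorem voidProb₀_eq_integral {z : EuclideanSpace ℝ (Fin (m + 1))} (hz : ‖z‖ < 1) {ξ : ℝ}
    (hξ : 0 ≤ ξ) : voidProb₀ (m + 1) z ξ = 1 - kappa m * ∫ s in (0 : ℝ)..ξ, psi m z s := by
  have hmeas : Measurable fun s => freeDensity m z s :=
    Measurable.comp (g := fun p : EuclideanSpace ℝ (Fin (m + 1)) × ℝ => freeDensity m p.1 p.2)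
      (f := fun s : ℝ => (z, s)) measurable_freeDensity measurable_prodMk_left
  have h := congrArg ENNReal.toReal (latticeMeasure_isVoid_compl ξ hz)
  rw [← measureReal_def, probReal_compl_eq_one_sub
    (measurableSet_isVoid_const (measurableSet_cylinder ξ z)), ENNReal.toReal_mul,
    ← integral_toReal hmeas.aemeasurable
      (Filter.Eventually.of_forall fun s => (freeDensity_ne_top z s).lt_top)] at h
  rw [voidProb₀_eq, intervalIntegral.integral_of_le hξ, integral_Ioc_eq_integral_Ioo, kappa]
  have h2 : ∫ s in Set.Ioo 0 ξ, psi m z s = ∫ s in Set.Ioo 0 ξ, (freeDensity m z s).toReal :=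
    setIntegral_congr_fun measurableSet_Ioo fun s hs => if_neg hs.1.not_ge
  rw [h2]
  linarith

theorem voidProb₀_nonneg (z : EuclideanSpace ℝ (Fin m)) (ξ : ℝ) : 0 ≤ voidProb₀ m z ξ :=
  measureReal_nonneg

theorem voidProb₀_le_one (z : EuclideanSpace ℝ (Fin m)) (ξ : ℝ) : voidProb₀ m z ξ ≤ 1 :=
  measureReal_le_one

theorem voidProb_nonneg (ξ : ℝ) : 0 ≤ voidProb m ξ := measureReal_nonneg

theorem voidProb_le_one (ξ : ℝ) : voidProb m ξ ≤ 1 := measureReal_le_one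

theorem hasDerivAt_one_sub_integral {f : ℝ → ℝ} (hf : Continuous f) (ξ : ℝ) :
    HasDerivAt (fun ξ => 1 - ∫ s in (0 : ℝ)..ξ, f s) (-f ξ) ξ := by
  have h := (hf.integral_hasStrictDerivAt 0 ξ).hasDerivAt.const_sub 1
  exact h

/-- The density of a distribution on the half-line with the tail `1 - ∫ f`. -/
theorem tail_eq {g f : ℝ → ℝ} (hf : Continuous f) (hf0 : ∀ s, 0 ≤ f s)
    (hg : ∀ ξ, 0 ≤ ξ → g ξ = 1 - ∫ s in (0 : ℝ)..ξ, f s)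
    (hlim : Filter.Tendsto g Filter.atTop (𝓝 0)) :
    (∀ ξ, 0 ≤ ξ → HasDerivWithinAt g (-f ξ) (Set.Ici 0) ξ) ∧
    (∀ ξ, 0 ≤ ξ → -ddξ g ξ = f ξ) ∧
    (∀ ξ, 0 ≤ ξ → ∫ s in Set.Ioi ξ, -ddξ g s = g ξ) := by
  have h1 : ∀ ξ, 0 ≤ ξ → HasDerivWithinAt g (-f ξ) (Set.Ici 0) ξ := fun ξ hξ =>
    (hasDerivAt_one_sub_integral hf ξ).hasDerivWithinAt.congr (fun s hs => hg s hs) (hg ξ hξ)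
  have h2 : ∀ ξ, 0 ≤ ξ → -ddξ g ξ = f ξ := fun ξ hξ => by
    rw [ddξ, (h1 ξ hξ).derivWithin (uniqueDiffOn_Ici 0 ξ hξ), neg_neg]
  refine ⟨h1, h2, fun ξ hξ => ?_⟩
  have h3 : Filter.Tendsto (fun ξ => 1 - ∫ s in (0 : ℝ)..ξ, f s) Filter.atTop (𝓝 0) := by
    refine hlim.congr' ?_
    filter_upwards [Filter.eventually_ge_atTop 0] with s hs
    exact hg s hs
  -- Integrability at infinity follows from the constant sign of the derivative and the existence of
  -- the limit.
  have h4 := integral_Ioi_of_hasDerivAt_of_nonpos' (a := ξ)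
    (fun x _ => hasDerivAt_one_sub_integral hf x) (fun x _ => neg_nonpos.2 (hf0 x)) h3
  rw [integral_neg] at h4
  rw [hg ξ hξ, setIntegral_congr_fun measurableSet_Ioi fun s hs => h2 s (hξ.trans hs.out.le)]
  linarith

theorem voidProb₀_tail {z : EuclideanSpace ℝ (Fin (m + 1))} (hz : ‖z‖ < 1) :
    (∀ ξ, 0 ≤ ξ → HasDerivWithinAt (voidProb₀ (m + 1) z) (-(kappa m * psi m z ξ)) (Set.Ici 0) ξ) ∧
    (∀ ξ, 0 ≤ ξ → -ddξ (voidProb₀ (m + 1) z) ξ = kappa m * psi m z ξ) ∧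
    (∀ ξ, 0 ≤ ξ → ∫ s in Set.Ioi ξ, -ddξ (voidProb₀ (m + 1) z) s = voidProb₀ (m + 1) z ξ) :=
  tail_eq ((continuous_psi hz).const_mul _) (fun s => mul_nonneg (kappa_nonneg m) (psi_nonneg z s))
    (fun ξ hξ => by rw [voidProb₀_eq_integral hz hξ, intervalIntegral.integral_const_mul])
    (tendsto_voidProb₀ hz)

theorem abs_voidProb₀_sub_le {z : EuclideanSpace ℝ (Fin (m + 1))} (hz : ‖z‖ < 1) {a b : ℝ}
    (ha : 0 ≤ a) (hb : 0 ≤ b) : |voidProb₀ (m + 1) z a - voidProb₀ (m + 1) z b| ≤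
      kappa m * sigmaBar (m + 1) * |a - b| := by
  have hint : ∀ c d, IntervalIntegrable (psi m z) volume c d := fun c d =>
    (continuous_psi hz).intervalIntegrable c d
  rw [voidProb₀_eq_integral hz ha, voidProb₀_eq_integral hz hb, sub_sub_sub_cancel_left, ← mul_sub,
    intervalIntegral.integral_interval_sub_left (hint _ _) (hint _ _), abs_mul,
    abs_of_nonneg (kappa_nonneg m), mul_assoc, abs_sub_comm]
  refine mul_le_mul_of_nonneg_left ?_ (kappa_nonneg m)
  exact intervalIntegral.norm_integral_le_of_norm_le_const fun s _ => by
    rw [Real.norm_of_nonneg (psi_nonneg z s)]; exact psi_le z s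

theorem measurable_voidProb₀ : Measurable fun p : ℝ × EuclideanSpace ℝ (Fin m) =>
    voidProb₀ m p.2 p.1 := by
  simp_rw [voidProb₀_eq, measureReal_def]
  exact (measurable_measure_prodMk_right measurableSet_isVoid_cylinder).ennreal_toReal

theorem integrableOn_voidProb₀ (s : ℝ) : IntegrableOn (fun z => voidProb₀ m z s)
    (Metric.ball (0 : EuclideanSpace ℝ (Fin m)) 1) := by
  refine Measure.integrableOn_of_bounded (M := 1) measure_ball_lt_top.ne
    (measurable_voidProb₀.comp measurable_prodMk_left).aestronglyMeasurable ?_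
  exact Filter.Eventually.of_forall fun z => by
    rw [Real.norm_of_nonneg (voidProb₀_nonneg z s)]; exact voidProb₀_le_one z s

/-- The mean of the void probability over the exit parameter. -/
noncomputable def meanVoid (m : ℕ) (s : ℝ) : ℝ :=
  -- The cutoff `max s 0` extends the function continuously to negative s. The integral is not
  -- divided by the volume of the ball.
  ∫ z in Metric.ball (0 : EuclideanSpace ℝ (Fin m)) 1, voidProb₀ m z (max s 0)

theorem meanVoid_nonneg (s : ℝ) : 0 ≤ meanVoid m s :=
  integral_nonneg fun z => voidProb₀_nonneg z _

theorem abs_setIntegral_ball_sub_le {f g : EuclideanSpace ℝ (Fin m) → ℝ} {C : ℝ}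
    (hf : IntegrableOn f (Metric.ball 0 1)) (hg : IntegrableOn g (Metric.ball 0 1))
    (h : ∀ z, ‖z‖ < 1 → |f z - g z| ≤ C) :
    |(∫ z in Metric.ball 0 1, f z) - ∫ z in Metric.ball 0 1, g z| ≤ C * sigmaBar m := by
  rw [← integral_sub hf hg, sigmaBar]
  exact norm_setIntegral_le_of_norm_le_const (f := fun z => f z - g z) measure_ball_lt_top
    fun z hz => h z (mem_ball_zero_iff.1 hz)

theorem continuous_meanVoid : Continuous (meanVoid (m + 1)) := by
  have hL : LipschitzWith (Real.toNNReal (kappa m * sigmaBar (m + 1) * sigmaBar (m + 1)))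
      (meanVoid (m + 1)) := by
    refine LipschitzWith.of_dist_le_mul fun a b => ?_
    rw [Real.coe_toNNReal _ (mul_nonneg (mul_nonneg (kappa_nonneg m) (sigmaBar_nonneg _))
      (sigmaBar_nonneg _)), Real.dist_eq, Real.dist_eq]
    refine (abs_setIntegral_ball_sub_le (integrableOn_voidProb₀ _) (integrableOn_voidProb₀ _)
      fun z hz => abs_voidProb₀_sub_le hz (le_max_right _ _) (le_max_right _ _)).trans ?_
    have h1 : |max a 0 - max b 0| ≤ |a - b| := abs_max_sub_max_le_abs a b 0
    have h2 := sigmaBar_nonneg (m + 1)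
    have h3 := kappa_nonneg m
    calc _ ≤ kappa m * sigmaBar (m + 1) * |a - b| * sigmaBar (m + 1) := by gcongr
      _ = _ := by ring
  exact hL.continuous

/-- The lowest-point formula `affineLatticeMeasure_cylinder_compl` in real form; it identifies Φ
with `meanVoid` on the half-line. -/
theorem voidProb_eq_integral {ξ : ℝ} (hξ : 0 ≤ ξ) :
    voidProb (m + 1) ξ = 1 - ∫ s in (0 : ℝ)..ξ, meanVoid (m + 1) s := by
  have h := congrArg ENNReal.toReal (affineLatticeMeasure_cylinder_compl (m := m) ξ)
  have hmeas : Measurable fun p : ℝ × EuclideanSpace ℝ (Fin (m + 1)) =>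
      latticeMeasure (m + 1) {M | IsVoid M (cylinder (m + 1) p.1 p.2)} :=
    measurable_measure_prodMk_right measurableSet_isVoid_cylinder
  have hfin : ∀ s : ℝ, ∫⁻ w in Metric.ball 0 1,
      latticeMeasure (m + 1) {M | IsVoid M (cylinder (m + 1) s w)} < ∞ := fun s =>
    setLIntegral_lt_top_of_le_nnreal measure_ball_lt_top.ne ⟨1, fun w _ => prob_le_one⟩
  rw [← measureReal_def, probReal_compl_eq_one_sub (measurableSet_disjoint_affineLattice
    (measurableSet_cylinder ξ 0)),
    ← integral_toReal hmeas.lintegral_prod_right'.aemeasurable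
      (Filter.Eventually.of_forall hfin)] at h
  rw [voidProb, intervalIntegral.integral_of_le hξ, integral_Ioc_eq_integral_Ioo]
  have h2 : ∫ s in Set.Ioo 0 ξ, meanVoid (m + 1) s = ∫ s in Set.Ioo 0 ξ,
      (∫⁻ w in Metric.ball 0 1,
        latticeMeasure (m + 1) {M | IsVoid M (cylinder (m + 1) s w)}).toReal := by
    refine setIntegral_congr_fun measurableSet_Ioo fun s hs => ?_
    simp only [meanVoid, max_eq_left hs.1.le, voidProb₀_eq, measureReal_def]
    exact integral_toReal (hmeas.comp measurable_prodMk_left).aemeasurable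
      (Filter.Eventually.of_forall fun w => measure_lt_top _ _)
  rw [h2]
  linarith

theorem voidProb_tail :
    (∀ ξ, 0 ≤ ξ → HasDerivWithinAt (voidProb (m + 1)) (-meanVoid (m + 1) ξ) (Set.Ici 0) ξ) ∧
    (∀ ξ, 0 ≤ ξ → -ddξ (voidProb (m + 1)) ξ = meanVoid (m + 1) ξ) ∧
    (∀ ξ, 0 ≤ ξ → ∫ s in Set.Ioi ξ, -ddξ (voidProb (m + 1)) s = voidProb (m + 1) ξ) :=
  tail_eq continuous_meanVoid meanVoid_nonneg (fun _ hξ => voidProb_eq_integral hξ) tendsto_voidProb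

theorem abs_integral_sub_le {f : ℝ → ℝ} (hf : Continuous f) {c C : ℝ} (hC0 : 0 ≤ C) {ξ : ℝ}
    (hξ : 0 ≤ ξ) (h : ∀ s, 0 ≤ s → |f s - c| ≤ C * s) :
    |(∫ s in (0 : ℝ)..ξ, f s) - c * ξ| ≤ C * ξ ^ 2 := by
  have h1 : (∫ s in (0 : ℝ)..ξ, f s) - c * ξ = ∫ s in (0 : ℝ)..ξ, (f s - c) := by
    rw [intervalIntegral.integral_sub (hf.intervalIntegrable _ _) intervalIntegrable_const,
      intervalIntegral.integral_const, smul_eq_mul, sub_zero, mul_comm]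
  have h2 := intervalIntegral.norm_integral_le_of_norm_le_const (a := 0) (b := ξ)
    (f := fun s => f s - c) (C := C * ξ) fun s hs => by
      rw [Set.uIoc_of_le hξ] at hs
      exact (h s hs.1.le).trans (mul_le_mul_of_nonneg_left hs.2 hC0)
  rw [h1]
  refine h2.trans_eq ?_
  rw [sub_zero, abs_of_nonneg hξ]
  ring

theorem abs_voidProb₀_sub_linear_le (m : ℕ) : ∃ C : ℝ, 0 ≤ C ∧
    ∀ (z : EuclideanSpace ℝ (Fin (m + 1))), ‖z‖ < 1 → ∀ ξ : ℝ, 0 ≤ ξ →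
      |voidProb₀ (m + 1) z ξ - (1 - kappa m * sigmaBar (m + 1) * ξ)| ≤ C * ξ ^ 2 := by
  obtain ⟨C, hC0, hC⟩ := abs_psi_sub_le m
  refine ⟨kappa m * C, mul_nonneg (kappa_nonneg m) hC0, fun z hz ξ hξ => ?_⟩
  have h := abs_integral_sub_le (continuous_psi hz) hC0 hξ (hC z hz)
  rw [voidProb₀_eq_integral hz hξ, sub_sub_sub_cancel_left, mul_assoc, ← mul_sub, abs_mul,
    abs_of_nonneg (kappa_nonneg m), abs_sub_comm, mul_assoc]
  exact mul_le_mul_of_nonneg_left h (kappa_nonneg m)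

theorem setIntegral_ball_const (c : ℝ) :
    ∫ _ in Metric.ball (0 : EuclideanSpace ℝ (Fin m)) 1, c = sigmaBar m * c := by
  rw [setIntegral_const, smul_eq_mul, sigmaBar]

theorem abs_meanVoid_sub_linear_le (m : ℕ) : ∃ C : ℝ, 0 ≤ C ∧ ∀ ξ : ℝ, 0 ≤ ξ →
    |meanVoid (m + 1) ξ - (sigmaBar (m + 1) - kappa m * sigmaBar (m + 1) ^ 2 * ξ)| ≤ C * ξ ^ 2 := by
  obtain ⟨C, hC0, hC⟩ := abs_voidProb₀_sub_linear_le m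
  refine ⟨C * sigmaBar (m + 1), mul_nonneg hC0 (sigmaBar_nonneg _), fun ξ hξ => ?_⟩
  have h := abs_setIntegral_ball_sub_le (integrableOn_voidProb₀ (m := m + 1) ξ)
    (integrableOn_const measure_ball_lt_top.ne) fun z hz => hC z hz ξ hξ
  rw [setIntegral_ball_const] at h
  rw [meanVoid, max_eq_left hξ]
  calc _ = |(∫ z in Metric.ball (0 : EuclideanSpace ℝ (Fin (m + 1))) 1, voidProb₀ (m + 1) z ξ) -
        sigmaBar (m + 1) * (1 - kappa m * sigmaBar (m + 1) * ξ)| := by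
        congr 1
        ring
    _ ≤ _ := h
    _ = _ := by ring

theorem abs_meanVoid_sub_le (m : ℕ) : ∃ C : ℝ, 0 ≤ C ∧ ∀ ξ : ℝ, 0 ≤ ξ →
    |meanVoid (m + 1) ξ - sigmaBar (m + 1)| ≤ C * ξ := by
  have h0 := mul_nonneg (kappa_nonneg m) (sigmaBar_nonneg (m + 1))
  refine ⟨kappa m * sigmaBar (m + 1) * sigmaBar (m + 1), mul_nonneg h0 (sigmaBar_nonneg _),
    fun ξ hξ => ?_⟩
  have h := abs_setIntegral_ball_sub_le (integrableOn_voidProb₀ (m := m + 1) ξ)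
    (integrableOn_const (C := (1 : ℝ)) measure_ball_lt_top.ne)
    (C := kappa m * sigmaBar (m + 1) * ξ) fun z hz => by
      have h1 := abs_voidProb₀_sub_le hz hξ le_rfl
      rw [voidProb₀_eq_integral hz le_rfl, intervalIntegral.integral_same, mul_zero, sub_zero,
        sub_zero, abs_of_nonneg hξ] at h1
      exact h1
  rw [setIntegral_ball_const, mul_one] at h
  rw [meanVoid, max_eq_left hξ]
  refine h.trans_eq ?_
  ring

theorem abs_voidProb_sub_linear_le (m : ℕ) : ∃ C : ℝ, 0 ≤ C ∧ ∀ ξ : ℝ, 0 ≤ ξ →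
    |voidProb (m + 1) ξ - (1 - sigmaBar (m + 1) * ξ)| ≤ C * ξ ^ 2 := by
  obtain ⟨C, hC0, hC⟩ := abs_meanVoid_sub_le m
  refine ⟨C, hC0, fun ξ hξ => ?_⟩
  rw [voidProb_eq_integral hξ, sub_sub_sub_cancel_left, abs_sub_comm]
  exact abs_integral_sub_le continuous_meanVoid hC0 hξ hC

end Derivatives

end LatticeUnion

namespace LatticeUnion

open scoped ENNReal NNReal Topology
open Asymptotics Filter

/-! ### The union of lattices -/

section Union

variable {m N : ℕ}

theorem kappa_eq (m : ℕ) : kappa m = 1 / (riemannZeta ((m + 1 + 1 : ℕ) : ℂ)).re :=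
  toReal_meanConst m

theorem sigmaBar_pos (m : ℕ) : 0 < sigmaBar m := by
  rw [sigmaBar, measureReal_def]
  exact ENNReal.toReal_pos (Metric.measure_ball_pos _ _ one_pos).ne' measure_ball_lt_top.ne

/-- The void probability of the union of the affine lattices in `s`. -/
noncomputable def tailProd (m : ℕ) (n : Fin N → ℝ) (s : Finset (Fin N)) (ξ : ℝ) : ℝ :=
  ∏ i ∈ s, voidProb m (n i * ξ)

/-- Minus the derivative of `tailProd`. -/
noncomputable def tailProdDensity (m : ℕ) (n : Fin N → ℝ) (s : Finset (Fin N)) (ξ : ℝ) : ℝ :=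
  ∑ i ∈ s, tailProd m n (s.erase i) ξ * (n i * meanVoid m (n i * ξ))

theorem hasDerivWithinAt_comp_mul {f : ℝ → ℝ} {f' a ξ : ℝ} (ha : 0 ≤ a)
    (hf : HasDerivWithinAt f f' (Set.Ici 0) (a * ξ)) :
    HasDerivWithinAt (fun ξ => f (a * ξ)) (a * f') (Set.Ici 0) ξ := by
  have h := HasDerivWithinAt.comp ξ hf
    ((hasDerivAt_id ξ).const_mul a).hasDerivWithinAt (s := Set.Ici 0)
    (fun x hx => mul_nonneg ha hx)
  rw [mul_one, mul_comm] at h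
  exact h

theorem hasDerivWithinAt_tailProd {n : Fin N → ℝ} (hn : ∀ i, 0 < n i) (s : Finset (Fin N)) {ξ : ℝ}
    (hξ : 0 ≤ ξ) : HasDerivWithinAt (tailProd (m + 1) n s) (-tailProdDensity (m + 1) n s ξ)
      (Set.Ici 0) ξ := by
  have h := HasDerivWithinAt.fun_finsetProd (u := s) (x := ξ) (s := Set.Ici 0)
    (f := fun i ξ => voidProb (m + 1) (n i * ξ))
    (f' := fun i => n i * -meanVoid (m + 1) (n i * ξ)) fun i _ =>
      hasDerivWithinAt_comp_mul (hn i).le (voidProb_tail.1 _ (mul_nonneg (hn i).le hξ))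
  refine h.congr_deriv ?_
  rw [tailProdDensity, ← Finset.sum_neg_distrib]
  refine Finset.sum_congr rfl fun i _ => ?_
  rw [smul_eq_mul, tailProd]
  ring

theorem survival_eq {n : Fin N → ℝ} (hn : ∀ i, 0 < n i) {ξ : ℝ} (hξ : 0 ≤ ξ) :
    survival (m + 1) n ξ = tailProd (m + 1) n Finset.univ ξ :=
  Finset.prod_congr rfl fun i _ => voidProb_tail.2.2 _ (mul_nonneg (hn i).le hξ)

theorem hasDerivWithinAt_survival {n : Fin N → ℝ} (hn : ∀ i, 0 < n i) {ξ : ℝ} (hξ : 0 ≤ ξ) :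
    HasDerivWithinAt (survival (m + 1) n) (-tailProdDensity (m + 1) n Finset.univ ξ)
      (Set.Ici 0) ξ :=
  (hasDerivWithinAt_tailProd hn _ hξ).congr (fun _ hx => survival_eq hn hx) (survival_eq hn hξ)

theorem ΦUnion_eq {n : Fin N → ℝ} (hn : ∀ i, 0 < n i) {ξ : ℝ} (hξ : 0 ≤ ξ) :
    ΦUnion (m + 1) n ξ = tailProdDensity (m + 1) n Finset.univ ξ := by
  rw [ΦUnion, ddξ, (hasDerivWithinAt_survival hn hξ).derivWithin (uniqueDiffOn_Ici 0 ξ hξ), neg_neg]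

theorem survival₀_eq {n : Fin N → ℝ} (hn : ∀ i, 0 < n i) (j : Fin N)
    {z : EuclideanSpace ℝ (Fin (m + 1))} (hz : ‖z‖ < 1) {ξ : ℝ} (hξ : 0 ≤ ξ) :
    survival₀ (m + 1) n j z ξ =
      voidProb₀ (m + 1) z (n j * ξ) * tailProd (m + 1) n (Finset.univ.erase j) ξ := by
  rw [survival₀, tailProd]
  congr 1
  · exact (voidProb₀_tail hz).2.2 _ (mul_nonneg (hn j).le hξ)
  · exact Finset.prod_congr rfl fun i _ => voidProb_tail.2.2 _ (mul_nonneg (hn i).le hξ)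

/-- Minus the derivative of `survival₀`. -/
noncomputable def exitDensity (m : ℕ) (n : Fin N → ℝ) (j : Fin N) (ξ : ℝ)
    (z : EuclideanSpace ℝ (Fin (m + 1))) : ℝ :=
  n j * (kappa m * psi m z (n j * ξ)) * tailProd (m + 1) n (Finset.univ.erase j) ξ +
    voidProb₀ (m + 1) z (n j * ξ) * tailProdDensity (m + 1) n (Finset.univ.erase j) ξ

theorem hasDerivWithinAt_survival₀ {n : Fin N → ℝ} (hn : ∀ i, 0 < n i) (j : Fin N)
    {z : EuclideanSpace ℝ (Fin (m + 1))} (hz : ‖z‖ < 1) {ξ : ℝ} (hξ : 0 ≤ ξ) :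
    HasDerivWithinAt (survival₀ (m + 1) n j z) (-exitDensity m n j ξ z) (Set.Ici 0) ξ := by
  have h1 := hasDerivWithinAt_comp_mul (hn j).le
    ((voidProb₀_tail hz).1 _ (mul_nonneg (hn j).le hξ))
  have h2 := (h1.mul (hasDerivWithinAt_tailProd (m := m) hn (Finset.univ.erase j) hξ)).congr
    (fun _ hx => survival₀_eq hn j hz hx) (survival₀_eq hn j hz hξ)
  refine h2.congr_deriv ?_
  rw [exitDensity]
  ring

theorem Φ₀Union_eq {n : Fin N → ℝ} (hn : ∀ i, 0 < n i) (j : Fin N)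
    {z : EuclideanSpace ℝ (Fin (m + 1))} (hz : ‖z‖ < 1) {ξ : ℝ} (hξ : 0 ≤ ξ) :
    Φ₀Union (m + 1) n j ξ z = exitDensity m n j ξ z := by
  rw [Φ₀Union, ddξ, (hasDerivWithinAt_survival₀ hn j hz hξ).derivWithin (uniqueDiffOn_Ici 0 ξ hξ),
    neg_neg]

theorem integrableOn_psi (s : ℝ) : IntegrableOn (fun z => psi m z s)
    (Metric.ball (0 : EuclideanSpace ℝ (Fin (m + 1))) 1) := by
  refine Measure.integrableOn_of_bounded (M := sigmaBar (m + 1)) measure_ball_lt_top.ne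
    (measurable_psi s).aestronglyMeasurable ?_
  exact Filter.Eventually.of_forall fun z => by
    rw [Real.norm_of_nonneg (psi_nonneg z s)]; exact psi_le z s

theorem integrableOn_exitDensity (n : Fin N → ℝ) (j : Fin N) (ξ : ℝ) :
    IntegrableOn (exitDensity m n j ξ) (Metric.ball 0 1) :=
  Integrable.add ((((integrableOn_psi (n j * ξ)).const_mul (kappa m)).const_mul (n j)).mul_const _)
    ((integrableOn_voidProb₀ (n j * ξ)).mul_const _)

theorem integrableOn_Φ₀Union {n : Fin N → ℝ} (hn : ∀ i, 0 < n i) (j : Fin N) {ξ : ℝ}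
    (hξ : 0 ≤ ξ) : IntegrableOn (Φ₀Union (m + 1) n j ξ) (Metric.ball 0 1) :=
  (integrableOn_exitDensity n j ξ).congr_fun
    (fun _ hz => (Φ₀Union_eq hn j (mem_ball_zero_iff.1 hz) hξ).symm) Metric.isOpen_ball.measurableSet

/-! ### Expansions at the origin -/

/-- The principal filter of the half-line makes big-O a bound valid for all ξ ≥ 0, as the theorem
requires, and not only near 0. -/
theorem isBigO_comp_mul {f : ℝ → ℝ} {k : ℕ} {C a : ℝ} (ha : 0 < a)
    (h : ∀ ξ, 0 ≤ ξ → |f ξ| ≤ C * ξ ^ k) :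
    (fun ξ => f (a * ξ)) =O[𝓟 (Set.Ici 0)] fun ξ => ξ ^ k := by
  refine isBigO_principal.2 ⟨C * a ^ k, fun ξ (hξ : 0 ≤ ξ) => ?_⟩
  rw [Real.norm_eq_abs, Real.norm_of_nonneg (by positivity), mul_assoc, ← mul_pow]
  exact h _ (by positivity)

theorem abs_voidProb_sub_one_le {ξ : ℝ} (hξ : 0 ≤ ξ) :
    |voidProb (m + 1) ξ - 1| ≤ sigmaBar (m + 1) * ξ ^ 1 := by
  rw [voidProb_eq_integral hξ, sub_sub_cancel_left, abs_neg, pow_one]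
  have h := intervalIntegral.norm_integral_le_of_norm_le_const (a := 0) (b := ξ)
    (f := meanVoid (m + 1)) (C := sigmaBar (m + 1)) fun s _ => by
      rw [Real.norm_of_nonneg (meanVoid_nonneg s)]
      calc meanVoid (m + 1) s ≤ ∫ _ in Metric.ball (0 : EuclideanSpace ℝ (Fin (m + 1))) 1, (1 : ℝ) :=
            setIntegral_mono (integrableOn_voidProb₀ _) (integrableOn_const measure_ball_lt_top.ne)
              fun z => voidProb₀_le_one z _
        _ = _ := by rw [setIntegral_ball_const, mul_one]
  rwa [sub_zero, abs_of_nonneg hξ, Real.norm_eq_abs] at h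

theorem tailProd_nonneg (n : Fin N → ℝ) (s : Finset (Fin N)) (ξ : ℝ) : 0 ≤ tailProd m n s ξ :=
  Finset.prod_nonneg fun _ _ => voidProb_nonneg _

theorem tailProd_le_one (n : Fin N → ℝ) (s : Finset (Fin N)) (ξ : ℝ) : tailProd m n s ξ ≤ 1 :=
  Finset.prod_le_one (fun _ _ => voidProb_nonneg _) fun _ _ => voidProb_le_one _

theorem isBigO_tailProd_sub_one {n : Fin N → ℝ} (hn : ∀ i, 0 < n i) (s : Finset (Fin N)) :
    (fun ξ => tailProd (m + 1) n s ξ - 1) =O[𝓟 (Set.Ici 0)] fun ξ => ξ ^ 1 := by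
  induction s using Finset.induction_on with
  | empty => simpa [tailProd] using isBigO_zero _ _
  | insert a s ha ih =>
    have h1 := isBigO_comp_mul (f := fun ξ => voidProb (m + 1) ξ - 1) (hn a)
      fun ξ hξ => abs_voidProb_sub_one_le hξ
    have h2 : (fun ξ => tailProd (m + 1) n s ξ) =O[𝓟 (Set.Ici 0)] fun _ : ℝ => (1 : ℝ) :=
      isBigO_principal.2 ⟨1, fun ξ _ => by
        rw [norm_one, mul_one, Real.norm_of_nonneg (tailProd_nonneg _ _ _)]
        exact tailProd_le_one _ _ _⟩
    refine ((h1.mul h2).add (ih.congr_right fun ξ => (mul_one _).symm)).congr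
      (fun ξ => ?_) fun ξ => mul_one _
    rw [tailProd, tailProd, Finset.prod_insert ha]
    ring

/-- By induction on the factors: ab - 1 is (a - 1) + (b - 1) plus (a - 1)(b - 1), and the last
product is O(ξ²). -/
theorem isBigO_tailProd {n : Fin N → ℝ} (hn : ∀ i, 0 < n i) (s : Finset (Fin N)) :
    (fun ξ => tailProd (m + 1) n s ξ - (1 - sigmaBar (m + 1) * (∑ i ∈ s, n i) * ξ))
      =O[𝓟 (Set.Ici 0)] fun ξ => ξ ^ 2 := by
  obtain ⟨C, -, hC⟩ := abs_voidProb_sub_linear_le m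
  induction s using Finset.induction_on with
  | empty => simpa [tailProd] using isBigO_zero _ _
  | insert a s ha ih =>
    have h1 := isBigO_comp_mul (f := fun ξ => voidProb (m + 1) ξ - 1) (hn a)
      fun ξ hξ => abs_voidProb_sub_one_le hξ
    have h2 := isBigO_comp_mul (hn a) hC
    have h3 := (h1.mul (isBigO_tailProd_sub_one (m := m) hn s)).congr_right
      (g₂ := fun ξ => ξ ^ 2) fun ξ => by ring
    refine ((h2.add ih).add h3).congr_left fun ξ => ?_
    rw [tailProd, tailProd, Finset.prod_insert ha, Finset.sum_insert ha]
    ring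

theorem isBigO_mul_meanVoid_sub {n : Fin N → ℝ} (hn : ∀ i, 0 < n i) (i : Fin N) :
    (fun ξ => n i * meanVoid (m + 1) (n i * ξ) - n i * sigmaBar (m + 1))
      =O[𝓟 (Set.Ici 0)] fun ξ => ξ ^ 1 := by
  obtain ⟨C, -, hC⟩ := abs_meanVoid_sub_le m
  have h := isBigO_comp_mul (k := 1) (f := fun ξ => meanVoid (m + 1) ξ - sigmaBar (m + 1)) (hn i)
    fun ξ hξ => by rw [pow_one]; exact hC ξ hξ
  exact (h.const_mul_left (n i)).congr_left fun ξ => by ring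

theorem isBigO_tailProdDensity_sub {n : Fin N → ℝ} (hn : ∀ i, 0 < n i) (s : Finset (Fin N)) :
    (fun ξ => tailProdDensity (m + 1) n s ξ - sigmaBar (m + 1) * ∑ i ∈ s, n i)
      =O[𝓟 (Set.Ici 0)] fun ξ => ξ ^ 1 := by
  have h : ∀ i ∈ s, (fun ξ => tailProd (m + 1) n (s.erase i) ξ *
      (n i * meanVoid (m + 1) (n i * ξ)) - sigmaBar (m + 1) * n i)
      =O[𝓟 (Set.Ici 0)] fun ξ => ξ ^ 1 := by
    intro i _
    have h1 : (fun ξ => tailProd (m + 1) n (s.erase i) ξ) =O[𝓟 (Set.Ici 0)] fun _ : ℝ => (1 : ℝ) :=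
      isBigO_principal.2 ⟨1, fun ξ _ => by
        rw [norm_one, mul_one, Real.norm_of_nonneg (tailProd_nonneg _ _ _)]
        exact tailProd_le_one _ _ _⟩
    have h2 := (h1.mul (isBigO_mul_meanVoid_sub (m := m) hn i)).congr_right fun ξ => one_mul _
    have h3 := (isBigO_tailProd_sub_one (m := m) hn (s.erase i)).const_mul_left
      (n i * sigmaBar (m + 1))
    exact (h2.add h3).congr_left fun ξ => by ring
  refine (IsBigO.sum h).congr_left fun ξ => ?_
  rw [tailProdDensity, Finset.sum_apply, Finset.sum_sub_distrib, Finset.mul_sum]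

/-- Term i has slope -σ²(κ n_i² + n_i(1 - n_i)): the first part comes from the expansion of
`meanVoid`, the second from the other lattices. Summation over i uses that the densities add up to
1. -/
theorem isBigO_tailProdDensity {n : Fin N → ℝ} (hn : ∀ i, 0 < n i) (hsum : ∑ i, n i = 1) :
    (fun ξ => tailProdDensity (m + 1) n Finset.univ ξ - (sigmaBar (m + 1) -
      sigmaBar (m + 1) ^ 2 * (1 - (1 - kappa m) * ∑ j, n j ^ 2) * ξ))
      =O[𝓟 (Set.Ici 0)] fun ξ => ξ ^ 2 := by
  obtain ⟨C, -, hC⟩ := abs_meanVoid_sub_linear_le m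
  have h : ∀ i ∈ Finset.univ, (fun ξ => tailProd (m + 1) n (Finset.univ.erase i) ξ *
      (n i * meanVoid (m + 1) (n i * ξ)) - (sigmaBar (m + 1) * n i -
        sigmaBar (m + 1) ^ 2 * (n i - (1 - kappa m) * n i ^ 2) * ξ))
      =O[𝓟 (Set.Ici 0)] fun ξ => ξ ^ 2 := by
    intro i _
    have h1 := (isBigO_comp_mul (hn i) hC).const_mul_left (n i)
    have h2 := (isBigO_tailProd (m := m) hn (Finset.univ.erase i)).const_mul_left
      (n i * sigmaBar (m + 1))
    have h3 := ((isBigO_tailProd_sub_one (m := m) hn (Finset.univ.erase i)).mul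
      (isBigO_mul_meanVoid_sub (m := m) hn i)).congr_right (g₂ := fun ξ => ξ ^ 2) fun ξ => by ring
    refine ((h1.add h2).add h3).congr_left fun ξ => ?_
    rw [Finset.sum_erase_eq_sub (Finset.mem_univ i), hsum]
    ring
  refine (IsBigO.sum h).congr_left fun ξ => ?_
  rw [tailProdDensity, Finset.sum_apply, Finset.sum_sub_distrib, Finset.sum_sub_distrib, ← Finset.mul_sum, hsum,
    ← Finset.sum_mul, ← Finset.mul_sum, Finset.sum_sub_distrib, ← Finset.mul_sum, hsum, mul_one]

/-- The value at ξ = 0 is κσ n_j from the own lattice plus σ(1 - n_j) from the others. The constant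
does not depend on z, which permits integration over the ball. -/
theorem abs_exitDensity_sub_le {n : Fin N → ℝ} (hn : ∀ i, 0 < n i) (hsum : ∑ i, n i = 1)
    (j : Fin N) : ∃ C : ℝ, ∀ ξ : ℝ, 0 ≤ ξ → ∀ z : EuclideanSpace ℝ (Fin (m + 1)), ‖z‖ < 1 →
      |exitDensity m n j ξ z - sigmaBar (m + 1) * (1 - (1 - kappa m) * n j)| ≤ C * ξ := by
  obtain ⟨C₁, hC₁, h₁⟩ := abs_psi_sub_le m
  obtain ⟨C₂, h₂⟩ := isBigO_principal.1 (isBigO_tailProd_sub_one (m := m) hn (Finset.univ.erase j))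
  obtain ⟨C₃, h₃⟩ := isBigO_principal.1
    (isBigO_tailProdDensity_sub (m := m) hn (Finset.univ.erase j))
  rw [Finset.sum_erase_eq_sub (Finset.mem_univ j), hsum] at h₃
  have hk := kappa_nonneg m
  have hσ := sigmaBar_nonneg (m + 1)
  have hj := (hn j).le
  refine ⟨n j * kappa m * (C₁ * n j) + n j * kappa m * sigmaBar (m + 1) * C₂ + C₃ +
    |sigmaBar (m + 1) * (1 - n j)| * (kappa m * sigmaBar (m + 1) * n j), fun ξ hξ z hz => ?_⟩
  have hjξ := mul_nonneg hj hξ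
  set P := tailProd (m + 1) n (Finset.univ.erase j) ξ with hP
  set Q := tailProdDensity (m + 1) n (Finset.univ.erase j) ξ with hQ
  set V := voidProb₀ (m + 1) z (n j * ξ) with hV
  have hP1 : |P| ≤ 1 := by
    rw [abs_of_nonneg (tailProd_nonneg _ _ _)]; exact tailProd_le_one _ _ _
  have hV1 : |V| ≤ 1 := by
    rw [abs_of_nonneg (voidProb₀_nonneg _ _)]; exact voidProb₀_le_one _ _
  have e₁ := h₁ z hz _ hjξ
  have e₂ : |P - 1| ≤ C₂ * ξ := by
    have := h₂ ξ hξ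
    rwa [pow_one, Real.norm_eq_abs, Real.norm_of_nonneg hξ] at this
  have e₃ : |Q - sigmaBar (m + 1) * (1 - n j)| ≤ C₃ * ξ := by
    have := h₃ ξ hξ
    rwa [pow_one, Real.norm_eq_abs, Real.norm_of_nonneg hξ] at this
  have e₄ : |V - 1| ≤ kappa m * sigmaBar (m + 1) * (n j * ξ) := by
    have h1 := abs_voidProb₀_sub_le hz hjξ le_rfl
    rwa [voidProb₀_eq_integral hz le_rfl, intervalIntegral.integral_same, mul_zero, sub_zero,
      sub_zero, abs_of_nonneg hjξ] at h1
  have hsplit : exitDensity m n j ξ z - sigmaBar (m + 1) * (1 - (1 - kappa m) * n j) =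
      n j * kappa m * ((psi m z (n j * ξ) - sigmaBar (m + 1)) * P) +
      n j * kappa m * sigmaBar (m + 1) * (P - 1) + V * (Q - sigmaBar (m + 1) * (1 - n j)) +
      sigmaBar (m + 1) * (1 - n j) * (V - 1) := by
    rw [exitDensity]
    ring
  rw [hsplit]
  calc _ ≤ n j * kappa m * (C₁ * (n j * ξ) * 1) + n j * kappa m * sigmaBar (m + 1) * (C₂ * ξ) +
        1 * (C₃ * ξ) +
        |sigmaBar (m + 1) * (1 - n j)| * (kappa m * sigmaBar (m + 1) * (n j * ξ)) := by
        refine (abs_add_le _ _).trans (add_le_add ((abs_add_le _ _).trans (add_le_add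
          ((abs_add_le _ _).trans (add_le_add ?_ ?_)) ?_)) ?_)
        · rw [abs_mul (n j * kappa m), abs_mul (psi m z (n j * ξ) - _),
            abs_of_nonneg (mul_nonneg hj hk)]
          gcongr
        · rw [abs_mul (n j * kappa m * _), abs_of_nonneg (mul_nonneg (mul_nonneg hj hk) hσ)]
          gcongr
        · rw [abs_mul]
          exact mul_le_mul hV1 e₃ (abs_nonneg _) zero_le_one
        · rw [abs_mul (sigmaBar (m + 1) * _)]
          gcongr
    _ = _ := by ring

theorem abs_ΦBar₀_sub_le {n : Fin N → ℝ} (hn : ∀ i, 0 < n i) (hsum : ∑ i, n i = 1) :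
    ∃ C : ℝ, ∀ ξ : ℝ, 0 ≤ ξ → |ΦBar₀ (m + 1) n ξ -
      sigmaBar (m + 1) * (1 - (1 - kappa m) * ∑ j, n j ^ 2)| ≤ C * ξ := by
  choose C hC using fun j => abs_exitDensity_sub_le (m := m) hn hsum j
  have hσ := sigmaBar_pos (m + 1)
  refine ⟨∑ j, n j * C j, fun ξ hξ => ?_⟩
  set c : Fin N → ℝ := fun j => sigmaBar (m + 1) * (1 - (1 - kappa m) * n j) with hc
  have hint : ∀ j, ∫ z in Metric.ball (0 : EuclideanSpace ℝ (Fin (m + 1))) 1,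
      Φ₀Union (m + 1) n j ξ z = ∫ z in Metric.ball (0 : EuclideanSpace ℝ (Fin (m + 1))) 1,
        exitDensity m n j ξ z := fun j =>
    setIntegral_congr_fun Metric.isOpen_ball.measurableSet
      fun z hz => Φ₀Union_eq hn j (mem_ball_zero_iff.1 hz) hξ
  have hj : ∀ j, |(∫ z in Metric.ball (0 : EuclideanSpace ℝ (Fin (m + 1))) 1,
      Φ₀Union (m + 1) n j ξ z) - sigmaBar (m + 1) * c j| ≤ C j * ξ * sigmaBar (m + 1) := by
    intro j
    rw [hint, ← setIntegral_ball_const]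
    exact abs_setIntegral_ball_sub_le (integrableOn_exitDensity n j ξ)
      (integrableOn_const measure_ball_lt_top.ne) (hC j ξ hξ)
  have hsplit : ΦBar₀ (m + 1) n ξ - sigmaBar (m + 1) * (1 - (1 - kappa m) * ∑ j, n j ^ 2) =
      1 / sigmaBar (m + 1) * ∑ j, n j *
        ((∫ z in Metric.ball (0 : EuclideanSpace ℝ (Fin (m + 1))) 1,
          Φ₀Union (m + 1) n j ξ z) - sigmaBar (m + 1) * c j) := by
    have h1 : ∑ j, n j * (sigmaBar (m + 1) * c j) =
        sigmaBar (m + 1) ^ 2 * (1 - (1 - kappa m) * ∑ j, n j ^ 2) := by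
      have : ∀ j, n j * (sigmaBar (m + 1) * c j) =
          sigmaBar (m + 1) ^ 2 * (n j - (1 - kappa m) * n j ^ 2) := fun j => by
        simp only [hc]; ring
      simp_rw [this]
      rw [← Finset.mul_sum, Finset.sum_sub_distrib, ← Finset.mul_sum, hsum]
    simp_rw [mul_sub]
    rw [Finset.sum_sub_distrib, h1, ΦBar₀]
    field_simp
  rw [hsplit, abs_mul, abs_of_nonneg (by positivity), one_div, inv_mul_le_iff₀ hσ]
  refine (Finset.abs_sum_le_sum_abs _ _).trans ?_
  rw [Finset.sum_mul, Finset.mul_sum]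
  refine Finset.sum_le_sum fun j _ => ?_
  rw [abs_mul, abs_of_nonneg (hn j).le]
  refine (mul_le_mul_of_nonneg_left (hj j) (hn j).le).trans_eq ?_
  ring

end Union

end LatticeUnion

/-! ### The expansions for the union of lattices -/

theorem mainTheorem4 (m : ℕ) (hm : 1 ≤ m) (N : ℕ) (n : Fin N → ℝ) (hn : ∀ i, 0 < n i)
    (hsum : ∑ i, n i = 1) :
    (∃ C : ℝ, ∀ ξ : ℝ, 0 ≤ ξ →
      (∀ j, ∀ᵐ z ∂(MeasureTheory.volume.restrict
          (Metric.ball (0 : EuclideanSpace ℝ (Fin m)) 1)),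
        DifferentiableWithinAt ℝ (LatticeUnion.survival₀ m n j z) (Set.Ici 0) ξ) ∧
      (∀ j, MeasureTheory.IntegrableOn (LatticeUnion.Φ₀Union m n j ξ)
        (Metric.ball (0 : EuclideanSpace ℝ (Fin m)) 1)) ∧
      |LatticeUnion.ΦBar₀ m n ξ - LatticeUnion.sigmaBar m *
          (1 - (1 - 1 / (riemannZeta ((m + 1 : ℕ) : ℂ)).re) * ∑ j, n j ^ 2)| ≤ C * ξ) ∧
    (∃ C : ℝ, ∀ ξ : ℝ, 0 ≤ ξ →
      DifferentiableWithinAt ℝ (LatticeUnion.survival m n) (Set.Ici 0) ξ ∧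
      |LatticeUnion.ΦUnion m n ξ - (LatticeUnion.sigmaBar m - LatticeUnion.sigmaBar m ^ 2 *
          (1 - (1 - 1 / (riemannZeta ((m + 1 : ℕ) : ℂ)).re) * ∑ j, n j ^ 2) * ξ)|
        ≤ C * ξ ^ 2) := by
  obtain ⟨m, rfl⟩ := Nat.exists_eq_add_of_le' hm
  rw [← LatticeUnion.kappa_eq]
  obtain ⟨C₁, h₁⟩ := LatticeUnion.abs_ΦBar₀_sub_le (m := m) hn hsum
  obtain ⟨C₂, h₂⟩ := Asymptotics.isBigO_principal.1
    (LatticeUnion.isBigO_tailProdDensity (m := m) hn hsum)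
  refine ⟨⟨C₁, fun ξ hξ => ⟨fun j => ?_, fun j => LatticeUnion.integrableOn_Φ₀Union hn j hξ,
    h₁ ξ hξ⟩⟩, ⟨C₂, fun ξ hξ =>
      ⟨(LatticeUnion.hasDerivWithinAt_survival hn hξ).differentiableWithinAt, ?_⟩⟩⟩
  · exact ae_restrict_of_forall_mem Metric.isOpen_ball.measurableSet fun z hz =>
      (LatticeUnion.hasDerivWithinAt_survival₀ hn j (mem_ball_zero_iff.1 hz)
        hξ).differentiableWithinAt
  · have h := h₂ ξ hξ
    rwa [Real.norm_eq_abs, Real.norm_of_nonneg (by positivity), ← LatticeUnion.ΦUnion_eq hn hξ] at h
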